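/- **Setting.** Let $F$ be a nonarchimedean local field of characteristic $\neq 2$ with ring of integers $\mathcal O$, uniformizer $\varpi$ and normalised absolute value $|\cdot|$, let $\psi:F\to S^1$ be a continuous additive character of conductor $\mathcal O$, and let $dx$ be the Haar measure on $F$ self-dual for $\psi(xy)$ (so $\mathcal O$ has volume $1$). Let $(V,q)$ be a nondegenerate quadratic space over $F$ of even dimension $\dim V\ge 3$ and (signed) discriminant $1\in F^\times/F^{\times2}$, put $\langle x,y\rangle=q(x+y)-q(x)-q(y)$, and give $V$ the Haar measure self-dual for $\psi(\langle x,y\rangle)$. Fix $v_1\in V$ with $q(v_1)=1$, let $X_a=\{v\in V: q(v)=a\}$, and let $\mathrm O(v_1^\perp)$ be the stabiliser of $v_1$ in $\mathrm O(V)$. $S(\cdot)$ denotes the locally constant compactly supported complex functions. Write $n(b)=\begin{pmatrix}1&b\\0&1\end{pmatrix}$, $t(a)=\begin{pmatrix}a&0\\0&a^{-1}\end{pmatrix}$, $w=\begin{pmatrix}0&1\\-1&0\end{pmatrix}$. Let $\mathrm{SL}_2(F)$ act on $S(V)$ by the Weil representation: $(n(b)\Phi)(v)=\psi(b\,q(v))\Phi(v)$,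 $(t(a)\Phi)(v)=|a|^{\dim V/2}\chi_{\mathrm{disc}\,V}(a)\Phi(av)$, where $\chi_{\mathrm{disc}\,V}$ is the quadratic character of $F^\times$ attached to the discriminant (trivial here), and $(w\Phi)(v)=\gamma_{\psi,q}\int_V\Phi(y)\psi(\langle v,y\rangle)\,dy$, where $\gamma_{\psi,q}$ is the Weil index, i.e. the stable value of $\int_L\psi(q(x))\,dx$ over large compact open subgroups $L\subset V$. For $\Phi\in S(V)$ let $p(\Phi)(g)=(g\cdot\Phi)(v_1)$, let $\mathcal S(N,\psi\backslash \mathrm{SL}_2)=p(S(V))$, and let $$\mathcal I(N,\psi\backslash \mathrm{SL}_2)=\mathcal S(N,\psi\backslash \mathrm{SL}_2)_{N,\psi},\qquad \mathcal I(X_1)=S(X_1)_{\mathrm O(v_1^\perp)}$$ be the coinvariants ($N$ acting by right translation). **Statement.** (1) There is a unique linear map $t_\psi:\mathcal I(X_1)\to\mathcal I(N,\psi\backslash\mathrm{SL}_2)$, the transfer map, which for every $\Phi\in S(V)$ sends the class of $\Phi|_{X_1}$ to the class of $p(\Phi)$. (2) There are measures $|\omega_a|$ on $X_a$ ($a\in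 F^\times$), finite on compact sets, such that for every $f\in S(V)$ vanishing on $X_0$ the function $a\mapsto\int_{X_a}f\,|\omega_a|$ is locally constant and compactly supported on $F^\times$ and $\int_V f(v)\,dv=\int_{F^\times}\int_{X_a}f\,|\omega_a|\,da$. Likewise, with $F^\heartsuit=F\setminus\{\pm2\}$, there are measures $|\nu_\xi|$ ($\xi\in F^\heartsuit$), finite on compact sets, on the fibres of $x\mapsto\langle v_1,x\rangle$, $X_1\to F$, such that for every $f\in S(X_1)$ supported over $F^\heartsuit$ the fibre integral of $f$ is locally constant and compactly supported on $F^\heartsuit$ and $\int_{X_1}f\,|\omega_1|=\int_{F^\heartsuit}\int_{\langle v_1,x\rangle=\xi}f(x)\,|\nu_\xi(x)|\,d\xi$. (3) For any such measures, the elements of the two spaces of orbital integrals are regarded as functions as follows. There is a linear map from $\mathcal I(X_1)$ to the locally constant functions on $F^\heartsuit$ which sends the class of $\varphi\in S(X_1)$ to $\xi\mapsto\int_{\langle v_1,x\rangle=\xi}\varphi(x)\,|\nu_\xi(x)|$. There is a linear map from $\mathcal I(N,\psi\backslash\mathrm{SL}_2)$ to the locally constant functions on $F^\times$ which sends the class of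 $f$ to the function of $a$ given by the stable value, for $n$ large, of $\int_{\varpi^{-n}\mathcal O}f(wt(a)n(b))\,\overline{\psi(b)}\,db$ (in particular this sequence stabilizes for every $a$). In these terms $t_\psi$ is the integral transform $$t_\psi(\phi)(a)=\gamma_{\psi,q}\,|a|^{-\frac12\dim V}\int_{F^\heartsuit}\phi(\xi)\,\psi(a^{-1}\xi)\,d\xi\qquad(\phi\in\mathcal I(X_1),\ a\in F^\times),$$ the integral being absolutely convergent. -/

import Mathlib

open MeasureTheory Filter Topology
open scoped MatrixGroups

noncomputable section

namespace ThetaTransfer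

/-! ### Schwartz-Bruhat functions and measures -/

/-- The Schwartz-Bruhat space `S(X)` of a totally disconnected locally compact space `X`:
locally constant, compactly supported functions `X → ℂ`. -/
def SchwartzBruhat (X : Type*) [TopologicalSpace X] : Submodule ℂ (X → ℂ) where
  carrier := {f | IsLocallyConstant f ∧ HasCompactSupport f}
  zero_mem' := ⟨IsLocallyConstant.const 0, HasCompactSupport.zero⟩
  add_mem' hf hg := ⟨hf.1.add hg.1, hf.2.add hg.2⟩
  smul_mem' c _ hf := ⟨hf.1.comp (fun z => c • z), hf.2.smul_left (f := fun _ => c)⟩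

/-- The Fourier transform of `f : V → ℂ` for the pairing `ψ(B(x, y))` and the measure `μ`. -/
def fourier {F V : Type*} [Field F] [MeasurableSpace V] (ψ : AddChar F Circle) (B : V → V → F)
    (μ : Measure V) (f : V → ℂ) (x : V) : ℂ :=
  ∫ y, f y * (ψ (B x y) : ℂ) ∂μ

/-- `μ` is self-dual for the pairing `ψ(B(x, y))`: Fourier inversion holds on `S(V)`. -/
def IsSelfDual {F V : Type*} [Field F] [AddCommGroup V] [TopologicalSpace V] [MeasurableSpace V]
    (ψ : AddChar F Circle) (B : V → V → F) (μ : Measure V) : Prop :=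
  ∀ f ∈ SchwartzBruhat V, ∀ x, fourier ψ B μ (fourier ψ B μ f) x = f (-x)

/-- Let `π : X → Y` be submersive over the open set `Y₀ ⊆ Y`.  The measures `μ` on `X` and `lam` on
`Y` induce measures `ν y` on the fibres of `π` over `Y₀`, characterised as follows: for every
`f ∈ S(X)` supported in `π⁻¹(Y₀)` the integral of `f` along the fibres is locally constant and
compactly supported, and integrating it against `lam` gives `∫ f dμ`.  (For such `f` the integral
along a fibre outside `Y₀` is `0`; the `ν y` with `y ∉ Y₀` play no role.) -/
structure IsFiberMeasure {X Y : Type*} [TopologicalSpace X] [MeasurableSpace X]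
    [TopologicalSpace Y] [MeasurableSpace Y] (μ : Measure X) (lam : Measure Y) (π : X → Y)
    (Y₀ : Set Y) (ν : (y : Y) → Measure {x : X // π x = y}) : Prop where
  finite_on_compacts : ∀ y ∈ Y₀, IsFiniteMeasureOnCompacts (ν y)
  fiber_integral_mem : ∀ f ∈ SchwartzBruhat X, (∀ x, f x ≠ 0 → π x ∈ Y₀) →
    (fun y => ∫ x : {x : X // π x = y}, f x ∂(ν y)) ∈ SchwartzBruhat Y
  integral_eq : ∀ f ∈ SchwartzBruhat X, (∀ x, f x ≠ 0 → π x ∈ Y₀) →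
    ∫ x, f x ∂μ = ∫ y, (∫ x : {x : X // π x = y}, f x ∂(ν y)) ∂lam

/-! ### The field

A nonarchimedean local field is a nontrivially normed field `F` that is ultrametric and locally
compact.  Its norm need not be the normalised one, so the normalised absolute value is defined
separately. -/

section Field

variable {F : Type*} [NontriviallyNormedField F]

/-- The normalised absolute value `|a|` of `F`: the factor by which multiplication by `a` scales
additive Haar measure. -/
def absF [LocallyCompactSpace F] (a : F) : ℝ := by
  classical
  exact if h : a = 0 then 0 else (distribHaarChar F (Units.mk0 a h) : ℝ)

/-- The conductor of `ψ` is the ring of integers `{x | ‖x‖ ≤ 1}`: this is the largest fractional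
ideal on which `ψ` is trivial. -/
def HasConductorIntegers (ψ : AddChar F Circle) : Prop :=
  ∀ x : F, (∀ y : F, ‖y‖ ≤ 1 → ψ (x * y) = 1) ↔ ‖x‖ ≤ 1

/-- `ϖ` generates the maximal ideal `{x | ‖x‖ < 1}` of the ring of integers. -/
def IsUniformizer (ϖ : F) : Prop :=
  ‖ϖ‖ < 1 ∧ ∀ x : F, ‖x‖ < 1 → ‖x‖ ≤ ‖ϖ‖

/-- The fractional ideal `U_n = ϖ⁻ⁿ 𝒪`. -/
def idealU (ϖ : F) (n : ℕ) : Set F := {b | ‖ϖ ^ n * b‖ ≤ 1}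

/-- The quadratic character `χ_d` of `Fˣ` attached to `d ∈ Fˣ / Fˣ²`, i.e. the Hilbert symbol
`(a, d)`: it is `1` exactly if `a` is a value of the form `x² - d y²`. -/
def quadChar (d a : F) : ℂ := by
  classical
  exact if ∃ x y : F, a = x ^ 2 - d * y ^ 2 then 1 else -1

/-- `n(b)` is the upper triangular unipotent matrix with entry `b`. -/
def nMat (b : F) : SL(2, F) := ⟨!![1, b; 0, 1], by simp⟩

/-- `t(a) = diag(a, a⁻¹)`. -/
def tMat (a : Fˣ) : SL(2, F) := ⟨!![(a : F), 0; 0, ((a⁻¹ : Fˣ) : F)], by simp⟩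

/-- The Weyl element `w`. -/
def wMat (F : Type*) [NontriviallyNormedField F] : SL(2, F) := ⟨!![0, 1; -1, 0], by simp⟩

/-- The set `F ∖ {2, -2}`. -/
abbrev Heart (F : Type*) [NontriviallyNormedField F] : Type _ := {ξ : F // ξ ≠ 2 ∧ ξ ≠ -2}

end Field

/-! ### The Weil representation of `SL₂(F)` on `S(V)`, for `dim V` even -/

section Weil

variable {F : Type*} [NontriviallyNormedField F]
variable {V : Type*} [AddCommGroup V] [Module F V]

/-- The discriminant `(-1)^(m(m-1)/2) det(⟨e_i, e_j⟩)`, `m = dim V`, where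
`⟨x, y⟩ = Q(x + y) - Q(x) - Q(y)`; its square class does not depend on the basis. -/
def disc [FiniteDimensional F V] (Q : QuadraticForm F V) : F :=
  (-1) ^ (Module.finrank F V * (Module.finrank F V - 1) / 2) *
    (Matrix.of fun i j => QuadraticMap.polar Q (Module.finBasis F V i)
      (Module.finBasis F V j)).det

/-- The Weil index `γ_{ψ,Q}`: the stable value of `∫_L ψ(Q(x)) dx` as `L` runs through the compact
open subgroups of `V`, directed by inclusion. -/
def weilIndex [TopologicalSpace V] [MeasurableSpace V] (ψ : AddChar F Circle)
    (Q : QuadraticForm F V) (μ : Measure V) : ℂ :=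
  limUnder atTop fun L : {L : AddSubgroup V // IsOpen (L : Set V) ∧ IsCompact (L : Set V)} =>
    ∫ x in (L.1 : Set V), (ψ (Q x) : ℂ) ∂μ

/-- The action of `n(b)`: multiplication by `ψ(b Q(v))`. -/
def weilN (ψ : AddChar F Circle) (Q : QuadraticForm F V) (b : F) (Φ : V → ℂ) (v : V) : ℂ :=
  (ψ (b * Q v) : ℂ) * Φ v

/-- The action of `t(a)`: `(t(a) Φ)(v) = |a|^(dim V / 2) χ_{disc V}(a) Φ(a v)`. -/
def weilT [LocallyCompactSpace F] [FiniteDimensional F V] (Q : QuadraticForm F V) (a : F)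
    (Φ : V → ℂ) (v : V) : ℂ :=
  ((absF a ^ ((Module.finrank F V : ℝ) / 2) : ℝ) : ℂ) * quadChar (disc Q) a * Φ (a • v)

/-- The action of `w`: the Fourier transform normalised by the Weil index. -/
def weilW [TopologicalSpace V] [MeasurableSpace V] (ψ : AddChar F Circle)
    (Q : QuadraticForm F V) (μ : Measure V) (Φ : V → ℂ) (v : V) : ℂ :=
  weilIndex ψ Q μ * fourier ψ (QuadraticMap.polar Q) μ Φ v

/-- The action of `g = (a b; c d) ∈ SL₂(F)` in the Weil representation, through the Bruhat
decomposition: `g = t(a) n(b/a)` if `c = 0`, and `g = n(a/c) w t(-c) n(d/c)` if `c ≠ 0`. -/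
def weil [LocallyCompactSpace F] [FiniteDimensional F V] [TopologicalSpace V] [MeasurableSpace V]
    (ψ : AddChar F Circle) (Q : QuadraticForm F V) (μ : Measure V) (g : SL(2, F)) (Φ : V → ℂ) :
    V → ℂ := by
  classical
  exact
    if g 1 0 = 0 then weilT Q (g 0 0) (weilN ψ Q (g 0 1 / g 0 0) Φ)
    else weilN ψ Q (g 0 0 / g 1 0) (weilW ψ Q μ (weilT Q (-(g 1 0))
      (weilN ψ Q (g 1 1 / g 1 0) Φ)))

end Weil

/-! ### Test functions, orbital integrals and transfer -/

section Transfer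

variable {F : Type*} [NontriviallyNormedField F]
variable {V : Type*} [AddCommGroup V] [Module F V] [TopologicalSpace V]

/-- The hyperboloid `X_a = {v | Q(v) = a}`. -/
abbrev Hyperboloid (Q : QuadraticForm F V) (a : F) : Type _ := {v : V // Q v = a}

/-- The action of `O(V)` on `X_a`. -/
def act (Q : QuadraticForm F V) {a : F} (h : Q.IsometryEquiv Q) (x : Hyperboloid Q a) :
    Hyperboloid Q a :=
  ⟨h x.1, (h.map_app x.1).trans x.2⟩

/-- The span of all `h · φ - φ` with `φ ∈ S(X₁)` and `h ∈ O(v₁^⊥)`, where `O(v₁^⊥)` is the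
stabiliser of `v₁` in `O(V)` and `(h · φ)(x) = φ(h⁻¹ x)`. -/
def relX (Q : QuadraticForm F V) (v₁ : V) : Submodule ℂ (SchwartzBruhat (Hyperboloid Q 1)) :=
  Submodule.span ℂ {η | ∃ h : Q.IsometryEquiv Q, h v₁ = v₁ ∧
    ∃ φ : SchwartzBruhat (Hyperboloid Q 1), ∀ x, η.1 x = φ.1 (act Q h.symm x) - φ.1 x}

/-- The space `I(X₁) = S(X₁)_{O(v₁^⊥)}` of coinvariants. -/
abbrev OrbitalX (Q : QuadraticForm F V) (v₁ : V) : Type _ :=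
  SchwartzBruhat (Hyperboloid Q 1) ⧸ relX Q v₁

variable [LocallyCompactSpace F] [FiniteDimensional F V] [MeasurableSpace V]

/-- `p(Φ)(g) = (g · Φ)(v₁)`. -/
def pMap (ψ : AddChar F Circle) (Q : QuadraticForm F V) (μ : Measure V) (v₁ : V) (Φ : V → ℂ)
    (g : SL(2, F)) : ℂ :=
  weil ψ Q μ g Φ v₁

/-- The space `S(N, ψ \ SL₂)`, spanned by the functions `p(Φ)` for `Φ ∈ S(V)`.  As `p` is linear on
`S(V)`, it is simply the image of `p`; see `mem_whittakerSpace_iff`. -/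
def whittakerSpace (ψ : AddChar F Circle) (Q : QuadraticForm F V) (μ : Measure V) (v₁ : V) :
    Submodule ℂ (SL(2, F) → ℂ) :=
  Submodule.span ℂ (pMap ψ Q μ v₁ '' (SchwartzBruhat V : Set (V → ℂ)))

/-- The span of all `n(b) · f - ψ(b) f` with `f ∈ S(N, ψ \ SL₂)` and `b ∈ F`, for the action of
`SL₂(F)` by right translation. -/
def relN (ψ : AddChar F Circle) (Q : QuadraticForm F V) (μ : Measure V) (v₁ : V) :
    Submodule ℂ (whittakerSpace ψ Q μ v₁) :=
  Submodule.span ℂ {η | ∃ b : F, ∃ f : whittakerSpace ψ Q μ v₁,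
    ∀ g, η.1 g = f.1 (g * nMat b) - (ψ b : ℂ) * f.1 g}

/-- The space `I(N, ψ \ SL₂) = S(N, ψ \ SL₂)_{N, ψ}` of coinvariants. -/
abbrev OrbitalN (ψ : AddChar F Circle) (Q : QuadraticForm F V) (μ : Measure V) (v₁ : V) : Type _ :=
  whittakerSpace ψ Q μ v₁ ⧸ relN ψ Q μ v₁

/-- `f ∈ S(N, ψ \ SL₂)` and `φ ∈ S(X₁)` are transfers of each other: there is `Φ ∈ S(V)` with
`p(Φ) = f` whose restriction to `X₁` is `φ`. -/
def AreTransfers (ψ : AddChar F Circle) (Q : QuadraticForm F V) (μ : Measure V) (v₁ : V)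
    (f : whittakerSpace ψ Q μ v₁) (φ : SchwartzBruhat (Hyperboloid Q 1)) : Prop :=
  ∃ Φ ∈ SchwartzBruhat V, pMap ψ Q μ v₁ Φ = f.1 ∧ ∀ x : Hyperboloid Q 1, Φ x.1 = φ.1 x

/-- `t : I(X₁) → I(N, ψ \ SL₂)` is the transfer map `t_ψ`: the linear map induced by the
transfer correspondence. -/
def IsTransferMap (ψ : AddChar F Circle) (Q : QuadraticForm F V) (μ : Measure V) (v₁ : V)
    (t : OrbitalX Q v₁ →ₗ[ℂ] OrbitalN ψ Q μ v₁) : Prop :=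
  ∀ f φ, AreTransfers ψ Q μ v₁ f φ → t ((relX Q v₁).mkQ φ) = (relN ψ Q μ v₁).mkQ f

/-- `J` is the incarnation of `I(X₁)` as functions on `F ∖ {2, -2}`: the class of `φ` is sent to
its integrals over the fibres of `x ↦ ⟨v₁, x⟩` with respect to the measures `ν ξ`. -/
def IsIncarnationX (Q : QuadraticForm F V) (v₁ : V)
    (ν : (ξ : F) → Measure {x : Hyperboloid Q 1 // QuadraticMap.polar Q v₁ x.1 = ξ})
    (J : OrbitalX Q v₁ →ₗ[ℂ] (Heart F → ℂ)) : Prop :=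
  ∀ (φ : SchwartzBruhat (Hyperboloid Q 1)) (ξ : Heart F),
    J ((relX Q v₁).mkQ φ) ξ =
      ∫ x : {x : Hyperboloid Q 1 // QuadraticMap.polar Q v₁ x.1 = ξ.1}, φ.1 x.1 ∂(ν ξ.1)

/-- `J` is the incarnation of `I(N, ψ \ SL₂)` as functions on `Fˣ`: the class of `f` is sent to its
`(N, ψ)`-orbital integrals over the open cell, namely the function whose value at `a` is the stable
value of the integral of `f(w t(a) n(b)) ψ(-b)` over `b ∈ ϖ⁻ⁿ 𝒪` for large `n`. -/
def IsIncarnationN [MeasurableSpace F] (ψ : AddChar F Circle) (μF : Measure F)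
    (Q : QuadraticForm F V) (μ : Measure V) (v₁ : V) (ϖ : F)
    (J : OrbitalN ψ Q μ v₁ →ₗ[ℂ] (Fˣ → ℂ)) : Prop :=
  ∀ (f : whittakerSpace ψ Q μ v₁) (a : Fˣ), ∀ᶠ n : ℕ in atTop,
    ∫ b in idealU ϖ n, f.1 (wMat F * tMat a * nMat b) * (starRingEnd ℂ) (ψ b : ℂ) ∂μF =
      J ((relN ψ Q μ v₁).mkQ f) a

end Transfer

/-! ### The space `S(N, ψ \ SL₂)` is the image of `p` -/

section Image

variable {F : Type*} [NontriviallyNormedField F] [LocallyCompactSpace F]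
variable {V : Type*} [AddCommGroup V] [Module F V] [FiniteDimensional F V] [TopologicalSpace V]
  [IsTopologicalAddGroup V] [ContinuousSMul F V] [T2Space V] [MeasurableSpace V] [BorelSpace V]

theorem continuous_polar (Q : QuadraticForm F V) (v : V) :
    Continuous fun y => QuadraticMap.polar Q v y := by
  have : ProperSpace F := ProperSpace.of_locallyCompactSpace F
  exact (Q.polarBilin v).continuous_of_finiteDimensional

theorem continuous_quadraticForm (h2 : (2 : F) ≠ 0) (Q : QuadraticForm F V) :
    Continuous Q := by
  have : ProperSpace F := ProperSpace.of_locallyCompactSpace F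
  have key : ∀ x, Q x = 2⁻¹ * ∑ i, (Module.finBasis F V).coord i x *
      QuadraticMap.polar Q (Module.finBasis F V i) x := by
    intro x
    have h1 : QuadraticMap.polar Q x x = 2 * Q x := by
      rw [QuadraticMap.polar_self]; simp
    have h3 : QuadraticMap.polar Q x x = ∑ i, (Module.finBasis F V).coord i x *
        QuadraticMap.polar Q (Module.finBasis F V i) x := by
      have : Q.polarBilin x x = Q.polarBilin (∑ i, (Module.finBasis F V).repr x i •
          Module.finBasis F V i) x := by
        rw [(Module.finBasis F V).sum_repr]
      simp only [map_sum, LinearMap.sum_apply, map_smul, LinearMap.smul_apply, smul_eq_mul] at this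
      exact this
    rw [← h3, h1, inv_mul_cancel_left₀ h2]
  have : (Q : V → F) = fun x => 2⁻¹ * ∑ i, (Module.finBasis F V).coord i x *
      QuadraticMap.polar Q (Module.finBasis F V i) x := funext key
  rw [this]
  refine continuous_const.mul (continuous_finsetSum _ fun i _ => ?_)
  exact ((Module.finBasis F V).coord i).continuous_of_finiteDimensional.mul
    (continuous_polar Q _)

theorem integrable_weil (h2 : (2 : F) ≠ 0) {ψ : AddChar F Circle} (hψ : Continuous ψ)
    (Q : QuadraticForm F V) (μ : Measure V) [IsFiniteMeasureOnCompacts μ] {Φ : V → ℂ}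
    (hΦ : Φ ∈ SchwartzBruhat V) {c : F} (hc : c ≠ 0) (d : F) (v : V) :
    Integrable (fun y => weilT Q c (weilN ψ Q d Φ) y * (ψ (QuadraticMap.polar Q v y) : ℂ)) μ := by
  have hQ := continuous_quadraticForm h2 Q
  have hB := continuous_polar Q v
  have hcont : Continuous fun y : V => c • y := continuous_const_smul c
  have hΦc : Continuous Φ := hΦ.1.continuous
  refine Continuous.integrable_of_hasCompactSupport ?_ ?_
  · unfold weilT weilN
    have e1 : Continuous fun y => ((ψ (QuadraticMap.polar Q v y) : Circle) : ℂ) :=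
      continuous_subtype_val.comp (hψ.comp hB)
    have e2 : Continuous fun y => ((ψ (d * Q (c • y)) : Circle) : ℂ) :=
      continuous_subtype_val.comp (hψ.comp (continuous_const.mul (hQ.comp hcont)))
    exact (continuous_const.mul (e2.mul (hΦc.comp hcont))).mul e1
  · have h : HasCompactSupport fun y => Φ (c • y) :=
      hΦ.2.comp_homeomorph (Homeomorph.smulOfNeZero c hc)
    unfold weilT weilN
    exact ((h.mul_left (f := fun y => ((ψ (d * Q (c • y)) : Circle) : ℂ))).mul_left
      (f := fun _ => _)).mul_right

theorem weil_add (h2 : (2 : F) ≠ 0) {ψ : AddChar F Circle} (hψ : Continuous ψ)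
    (Q : QuadraticForm F V) (μ : Measure V) [IsFiniteMeasureOnCompacts μ] {Φ Φ' : V → ℂ}
    (hΦ : Φ ∈ SchwartzBruhat V) (hΦ' : Φ' ∈ SchwartzBruhat V) (g : SL(2, F)) (v : V) :
    weil ψ Q μ g (Φ + Φ') v = weil ψ Q μ g Φ v + weil ψ Q μ g Φ' v := by
  unfold weil
  split_ifs with h
  · simp only [weilT, weilN, Pi.add_apply]; ring
  · have hc : -(g 1 0) ≠ 0 := neg_ne_zero.mpr h
    have key := integral_add (integrable_weil h2 hψ Q μ hΦ hc (g 1 1 / g 1 0) v)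
      (integrable_weil h2 hψ Q μ hΦ' hc (g 1 1 / g 1 0) v)
    have e : weilT Q (-(g 1 0)) (weilN ψ Q (g 1 1 / g 1 0) (Φ + Φ')) =
        weilT Q (-(g 1 0)) (weilN ψ Q (g 1 1 / g 1 0) Φ) +
          weilT Q (-(g 1 0)) (weilN ψ Q (g 1 1 / g 1 0) Φ') := by
      funext y; simp only [weilT, weilN, Pi.add_apply]; ring
    rw [e]
    generalize weilT Q (-(g 1 0)) (weilN ψ Q (g 1 1 / g 1 0) Φ) = A at key ⊢
    generalize weilT Q (-(g 1 0)) (weilN ψ Q (g 1 1 / g 1 0) Φ') = A' at key ⊢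
    unfold weilN weilW fourier
    simp only [Pi.add_apply, add_mul]
    rw [key]; ring

theorem weil_smul (ψ : AddChar F Circle) (Q : QuadraticForm F V) (μ : Measure V) (z : ℂ)
    (Φ : V → ℂ) (g : SL(2, F)) (v : V) :
    weil ψ Q μ g (z • Φ) v = z * weil ψ Q μ g Φ v := by
  unfold weil
  split_ifs with h
  · simp only [weilT, weilN, Pi.smul_apply, smul_eq_mul]; ring
  · have e : weilT Q (-(g 1 0)) (weilN ψ Q (g 1 1 / g 1 0) (z • Φ)) =
        fun y => z * weilT Q (-(g 1 0)) (weilN ψ Q (g 1 1 / g 1 0) Φ) y := by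
      funext y; simp only [weilT, weilN, Pi.smul_apply, smul_eq_mul]; ring
    rw [e]
    generalize weilT Q (-(g 1 0)) (weilN ψ Q (g 1 1 / g 1 0) Φ) = A
    unfold weilN weilW fourier
    simp only [mul_assoc]
    rw [integral_const_mul]; ring

/-- `S(N, ψ \ SL₂)` is the image of `p : S(V) → C^∞(N, ψ \ SL₂)`. -/
theorem mem_whittakerSpace_iff (h2 : (2 : F) ≠ 0) {ψ : AddChar F Circle} (hψ : Continuous ψ)
    (Q : QuadraticForm F V) (μ : Measure V) [IsFiniteMeasureOnCompacts μ] (v₁ : V)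
    (f : SL(2, F) → ℂ) :
    f ∈ whittakerSpace ψ Q μ v₁ ↔ ∃ Φ ∈ SchwartzBruhat V, pMap ψ Q μ v₁ Φ = f := by
  constructor
  · intro hf
    induction hf using Submodule.span_induction with
    | mem f hf => exact hf
    | zero =>
      refine ⟨0, zero_mem _, funext fun g => ?_⟩
      have := weil_smul ψ Q μ 0 0 g v₁
      simpa [pMap] using this
    | add f g _ _ hf hg =>
      obtain ⟨Φ, hΦ, rfl⟩ := hf
      obtain ⟨Φ', hΦ', rfl⟩ := hg
      exact ⟨Φ + Φ', add_mem hΦ hΦ', funext fun g => weil_add h2 hψ Q μ hΦ hΦ' g v₁⟩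
    | smul z f _ hf =>
      obtain ⟨Φ, hΦ, rfl⟩ := hf
      exact ⟨z • Φ, Submodule.smul_mem _ z hΦ, funext fun g => weil_smul ψ Q μ z Φ g v₁⟩
  · rintro ⟨Φ, hΦ, rfl⟩
    exact Submodule.subset_span ⟨Φ, hΦ, rfl⟩

end Image

end ThetaTransfer

end

/-!
The measures on the fibres come from Fourier analysis: if `f` is supported where `q` (or `⟨v₁, ·⟩`
on `X₁`) is submersive, then `∫ f ψ(c q)` vanishes for `c` large by stationary phase, so the image
of `f dv` under `q` has a locally constant density, and the density at `a` is a functional of `f`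
that is a measure on `X_a`.

The transfer map exists because `Φ ↦ p(Φ)` kills, modulo `(N, ψ)`-coinvariants, every `Φ` vanishing
on `X₁` and because the Weil representation commutes with isometries. For the former, choose `b`
with `ψ(b q(v)) ≠ ψ(b)` at a point `v` with `q(v) ≠ 1`: on functions supported near `v`, `n(b)` acts
by the scalar `ψ(b q(v))`, while on the coinvariants it acts by `ψ(b)`, so their classes vanish.

The Bruhat element `w t(a) n(b)` turns `p(Φ)` into the Fourier integral of `Φ ψ(b q)` at `a⁻¹ v₁`.
Integrating against `ψ(-b)` is Fourier inversion in the variable `q`, which collapses `V` to `X₁`;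
disintegrating `X₁` over `⟨v₁, ·⟩` gives the transform, the poles `⟨v₁, x⟩ = ±2` being negligible.
-/

namespace ThetaTransfer

/-! ### Schwartz–Bruhat functions on prespectral spaces -/

section SchwartzBruhat

instance {X : Type*} [PseudoMetricSpace X] [ProperSpace X] [IsUltrametricDist X] :
    PrespectralSpace X := by
  refine .of_isTopologicalBasis
    (B := {K | ∃ x : X, ∃ r : ℝ, r ≠ 0 ∧ K = Metric.closedBall x r}) ?_ ?_
  · refine TopologicalSpace.isTopologicalBasis_of_isOpen_of_nhds ?_ fun x U hx hU => ?_
    · rintro _ ⟨x, r, hr, rfl⟩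
      exact IsUltrametricDist.isOpen_closedBall x hr
    · obtain ⟨r, hr, hrU⟩ := Metric.nhds_basis_closedBall.mem_iff.1 (hU.mem_nhds hx)
      exact ⟨_, ⟨x, r, hr.ne', rfl⟩, Metric.mem_closedBall_self hr.le, hrU⟩
  · rintro _ ⟨x, r, -, rfl⟩
    exact isCompact_closedBall x r

variable {X : Type*} [TopologicalSpace X]

theorem prespectralSpace_subtype [PrespectralSpace X] {p : X → Prop} (hp : IsClosed {x | p x}) :
    PrespectralSpace {x // p x} :=
  .of_isClosedEmbedding _ hp.isClosedEmbedding_subtypeVal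

theorem exists_isCompact_isOpen_extension [PrespectralSpace X] {p : X → Prop}
    {C : Set {x // p x}} (hC : IsCompact C) (hC' : IsOpen C) {U : Set X} (hU : IsOpen U)
    (hCU : ∀ x ∈ C, x.1 ∈ U) :
    ∃ K : Set X, IsCompact K ∧ IsOpen K ∧ (∀ x : {x // p x}, x.1 ∈ K ↔ x ∈ C) ∧ K ⊆ U := by
  obtain ⟨O, hO, rfl⟩ := isOpen_induced_iff.1 hC'
  obtain ⟨K, hK, hK', hCK, hKU⟩ := PrespectralSpace.exists_isCompact_and_isOpen_between
    (hC.image continuous_subtype_val) (hO.inter hU)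
    (by rintro _ ⟨x, hx, rfl⟩; exact ⟨hx, hCU x hx⟩)
  exact ⟨K, hK, hK', fun x => ⟨fun hx => (hKU hx).1, fun hx => hCK ⟨x, hx, rfl⟩⟩,
    fun x hx => (hKU hx).2⟩

theorem isLocallyConstant_indicator {M : Type*} [Zero M] {K : Set X} (hK : IsClopen K) {f : X → M}
    (hf : IsLocallyConstant f) : IsLocallyConstant (K.indicator f) :=
  (LocallyConstant.indicator ⟨f, hf⟩ hK).isLocallyConstant

namespace SchwartzBruhat

theorem indicator_mem_of_mem {K : Set X} (hK : IsClopen K) {f : X → ℂ}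
    (hf : f ∈ SchwartzBruhat X) : K.indicator f ∈ SchwartzBruhat X := by
  refine ⟨isLocallyConstant_indicator hK hf.1, hf.2.mono ?_⟩
  rw [Set.support_indicator]
  exact Set.inter_subset_right

theorem mul_mem {f g : X → ℂ} (hf : f ∈ SchwartzBruhat X) (hg : IsLocallyConstant g) :
    (fun x => f x * g x) ∈ SchwartzBruhat X :=
  ⟨hf.1.mul hg, hf.2.mul_right⟩

theorem indicator_mem [T2Space X] {K : Set X} (hK : IsCompact K) (hK' : IsOpen K) :
    (K.indicator fun _ => 1) ∈ SchwartzBruhat X :=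
  ⟨isLocallyConstant_indicator ⟨hK.isClosed, hK'⟩ (IsLocallyConstant.const 1),
    HasCompactSupport.intro hK fun _ hx => Set.indicator_of_notMem hx _⟩

theorem comp_isClosedEmbedding {Y : Type*} [TopologicalSpace Y] {f : X → ℂ}
    (hf : f ∈ SchwartzBruhat X) {e : Y → X} (he : IsClosedEmbedding e) :
    f ∘ e ∈ SchwartzBruhat Y :=
  ⟨hf.1.comp_continuous he.continuous, hf.2.comp_isClosedEmbedding he⟩

theorem comp_subtype {f : X → ℂ} (hf : f ∈ SchwartzBruhat X) {p : X → Prop}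
    (hp : IsClosed {x | p x}) : (fun x : {x // p x} => f x.1) ∈ SchwartzBruhat {x // p x} :=
  comp_isClosedEmbedding hf hp.isClosedEmbedding_subtypeVal

theorem integrable [MeasurableSpace X] [OpensMeasurableSpace X] (μ : Measure X)
    [IsFiniteMeasureOnCompacts μ] {f : X → ℂ} (hf : f ∈ SchwartzBruhat X) : Integrable f μ :=
  hf.1.continuous.integrable_of_hasCompactSupport hf.2

theorem isClopen_support {f : X → ℂ} (hf : f ∈ SchwartzBruhat X) :
    IsClopen (Function.support f) :=
  ⟨(hf.1.isOpen_fiber 0).isClosed_compl, (hf.1.isClosed_fiber 0).isOpen_compl⟩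

theorem isCompact_support {f : X → ℂ} (hf : f ∈ SchwartzBruhat X) :
    IsCompact (Function.support f) := by
  have := hf.2
  rwa [HasCompactSupport, tsupport, (isClopen_support hf).isClosed.closure_eq] at this

theorem finite_image_support {f : X → ℂ} (hf : f ∈ SchwartzBruhat X) :
    (f '' Function.support f).Finite := by
  have := isCompact_iff_compactSpace.1 (isCompact_support hf)
  rw [Set.image_eq_range]
  exact (hf.1.comp_continuous continuous_subtype_val :
    IsLocallyConstant fun x : Function.support f => f x).range_finite

theorem eq_sum_indicator {f : X → ℂ} (hf : f ∈ SchwartzBruhat X) :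
    f = ∑ c ∈ (finite_image_support hf).toFinset, c • (f ⁻¹' {c}).indicator fun _ => (1 : ℂ) := by
  classical
  funext x
  simp only [Finset.sum_apply, Pi.smul_apply, Set.indicator_apply, Set.mem_preimage,
    Set.mem_singleton_iff, smul_eq_mul, mul_ite, mul_one, mul_zero]
  rw [Finset.sum_ite_eq]
  split_ifs with h
  · rfl
  · by_contra h0
    exact h (by simpa using ⟨x, h0, rfl⟩)

theorem induction_on [T2Space X] {f : X → ℂ} (hf : f ∈ SchwartzBruhat X)
    {p : (X → ℂ) → Prop}
    (indicator : ∀ K : Set X, IsCompact K → IsOpen K → K ⊆ Function.support f →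
      p (K.indicator fun _ => 1))
    (add : ∀ g ∈ SchwartzBruhat X, ∀ h ∈ SchwartzBruhat X, p g → p h → p (g + h))
    (smul : ∀ (c : ℂ), ∀ g ∈ SchwartzBruhat X, p g → p (c • g)) : p f := by
  suffices f ∈ SchwartzBruhat X ∧ p f from this.2
  have key : ∀ K : Set X, IsCompact K → IsOpen K → K ⊆ Function.support f → ∀ c : ℂ,
      c • (K.indicator fun _ => (1 : ℂ)) ∈ SchwartzBruhat X ∧ p (c • K.indicator fun _ => 1) :=
    fun K hK hK' hKf c => ⟨Submodule.smul_mem _ c (indicator_mem hK hK'),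
      smul c _ (indicator_mem hK hK') (indicator K hK hK' hKf)⟩
  rw [eq_sum_indicator hf]
  refine Finset.sum_induction _ (fun g => g ∈ SchwartzBruhat X ∧ p g)
    (fun g h hg hh => ⟨Submodule.add_mem _ hg.1 hh.1, add g hg.1 h hh.1 hg.2 hh.2⟩) ?_ ?_
  · simpa using key ∅ isCompact_empty isOpen_empty (Set.empty_subset _) 0
  · intro c hc
    have hsub : f ⁻¹' {c} ⊆ Function.support f := by
      obtain ⟨x, hx, rfl⟩ := (finite_image_support hf).mem_toFinset.1 hc
      intro y hy
      rwa [Function.mem_support, Set.mem_singleton_iff.1 hy]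
    exact key _ ((isCompact_support hf).of_isClosed_subset (hf.1.isClosed_fiber c) hsub)
      (hf.1.isOpen_fiber c) hsub c

theorem exists_extension [T2Space X] [PrespectralSpace X] {p : X → Prop}
    {φ : {x // p x} → ℂ} (hφ : φ ∈ SchwartzBruhat {x // p x}) :
    ∃ Φ ∈ SchwartzBruhat X, ∀ x : {x // p x}, Φ x.1 = φ x := by
  refine induction_on (p := fun φ => ∃ Φ ∈ SchwartzBruhat X, ∀ x : {x // p x}, Φ x.1 = φ x) hφ
    ?_ ?_ ?_
  · intro C hC hC' _
    obtain ⟨K, hK, hK', hKC, -⟩ :=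
      exists_isCompact_isOpen_extension hC hC' isOpen_univ fun _ _ => trivial
    refine ⟨_, indicator_mem hK hK', fun x => ?_⟩
    classical
    simp only [Set.indicator_apply, hKC]
  · rintro f - g - ⟨Φ, hΦ, hΦf⟩ ⟨Ψ, hΨ, hΨg⟩
    exact ⟨Φ + Ψ, add_mem hΦ hΨ, fun x => by simp only [Pi.add_apply, hΦf, hΨg]⟩
  · rintro c f - ⟨Φ, hΦ, hΦf⟩
    exact ⟨c • Φ, Submodule.smul_mem _ c hΦ, fun x => by simp only [Pi.smul_apply, hΦf]⟩

end SchwartzBruhat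

end SchwartzBruhat

/-! ### Additive characters and measures of balls -/

section Character

theorem integral_character_eq_zero {G : Type*} [AddGroup G] [MeasurableSpace G] [MeasurableAdd G]
    (μ : Measure G) [μ.IsAddRightInvariant] {H : AddSubgroup G} (hH : MeasurableSet (H : Set G))
    {χ : G → ℂ} (hχ : ∀ x ∈ H, ∀ y ∈ H, χ (x + y) = χ x * χ y) {l : G} (hl : l ∈ H)
    (hl1 : χ l ≠ 1) : ∫ x in (H : Set G), χ x ∂μ = 0 := by
  have translate : ∀ x, (H : Set G).indicator χ (x + l) = (H : Set G).indicator χ x * χ l := by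
    intro x
    by_cases hx : x ∈ H
    · rw [Set.indicator_of_mem (by exact H.add_mem hx hl), Set.indicator_of_mem (by exact hx),
        hχ x hx l hl]
    · rw [Set.indicator_of_notMem, Set.indicator_of_notMem (by exact hx), zero_mul]
      exact fun h => hx ((H.add_mem_cancel_right hl).1 h)
  have invariant := integral_add_right_eq_self (μ := μ) ((H : Set G).indicator χ) l
  simp_rw [translate] at invariant
  rw [integral_mul_const, integral_indicator hH] at invariant
  have : (∫ x in (H : Set G), χ x ∂μ) * (χ l - 1) = 0 := by linear_combination invariant
  exact (mul_eq_zero.1 this).resolve_right (sub_ne_zero.2 hl1)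

variable {F : Type*} [NontriviallyNormedField F] {ψ : AddChar F Circle}

namespace HasConductorIntegers

theorem eq_one (hψ : HasConductorIntegers ψ) {x : F} (hx : ‖x‖ ≤ 1) : ψ x = 1 := by
  simpa using (hψ x).2 hx 1 (by simp)

theorem exists_ne_one (hψ : HasConductorIntegers ψ) {x : F} (hx : 1 < ‖x‖) :
    ∃ y : F, ‖y‖ ≤ 1 ∧ ψ (x * y) ≠ 1 := by
  by_contra! h
  exact absurd ((hψ x).1 h) (not_le.2 hx)

theorem isLocallyConstant (hψ : HasConductorIntegers ψ) : IsLocallyConstant ψ := by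
  rw [IsLocallyConstant.iff_eventually_eq]
  intro x
  filter_upwards [Metric.closedBall_mem_nhds x one_pos] with y hy
  rw [← sub_add_cancel y x, AddChar.map_add_eq_mul,
    hψ.eq_one (by simpa [dist_eq_norm] using hy), one_mul]

theorem continuous (hψ : HasConductorIntegers ψ) : Continuous ψ :=
  hψ.isLocallyConstant.continuous

end HasConductorIntegers

theorem measurable_coe_comp [MeasurableSpace F] [BorelSpace F] (hψ : Continuous ψ)
    {X : Type*} [MeasurableSpace X] {f : X → F} (hf : Measurable f) :
    Measurable fun x => (ψ (f x) : ℂ) :=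
  (continuous_subtype_val.comp hψ).measurable.comp hf

theorem continuous_coe_comp (hψ : Continuous ψ) {X : Type*} [TopologicalSpace X] {f : X → F}
    (hf : Continuous f) : Continuous fun x => (ψ (f x) : ℂ) :=
  continuous_subtype_val.comp (hψ.comp hf)

theorem SchwartzBruhat.mul_character_mem (hcond : HasConductorIntegers ψ) {X : Type*}
    [TopologicalSpace X] {π : X → F} (hπ : Continuous π) {f : X → ℂ} (hf : f ∈ SchwartzBruhat X)
    (c : F) : (fun x => f x * (ψ (c * π x) : ℂ)) ∈ SchwartzBruhat X :=
  mul_mem hf ((hcond.isLocallyConstant.comp_continuous (continuous_const.mul hπ)).comp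
    ((↑) : Circle → ℂ))

end Character

section AbsF

variable {F : Type*} [NontriviallyNormedField F] [ProperSpace F]

theorem absF_units (a : Fˣ) : absF (a : F) = distribHaarChar F a := by simp [absF]

theorem absF_pos {a : F} (ha : a ≠ 0) : 0 < absF a := by
  lift a to Fˣ using ha.isUnit
  rw [absF_units]
  exact_mod_cast distribHaarChar_pos

theorem absF_mul (a b : F) : absF (a * b) = absF a * absF b := by
  rcases eq_or_ne a 0 with rfl | ha
  · simp [absF]
  rcases eq_or_ne b 0 with rfl | hb
  · simp [absF]
  lift a to Fˣ using ha.isUnit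
  lift b to Fˣ using hb.isUnit
  rw [← Units.val_mul, absF_units, absF_units, absF_units, map_mul, NNReal.coe_mul]

theorem absF_inv (a : F) : absF a⁻¹ = (absF a)⁻¹ := by
  rcases eq_or_ne a 0 with rfl | ha
  · simp [absF]
  · lift a to Fˣ using ha.isUnit
    rw [← Units.val_inv_eq_inv_val, absF_units, absF_units, map_inv, NNReal.coe_inv]

variable [MeasurableSpace F] (μF : Measure F) [μF.IsAddHaarMeasure]

theorem real_closedBall_pos {r : ℝ} (hr : 0 < r) (y : F) :
    0 < μF.real (Metric.closedBall y r) :=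
  ENNReal.toReal_pos (Metric.measure_closedBall_pos μF y hr).ne'
    (isCompact_closedBall y r).measure_ne_top

variable [BorelSpace F]

theorem measure_closedBall_eq (y : F) (r : ℝ) :
    μF (Metric.closedBall y r) = μF (Metric.closedBall 0 r) := by
  rw [← vadd_closedBall_zero, measure_vadd]

open scoped Pointwise in
theorem real_closedBall_norm (a y : F) :
    μF.real (Metric.closedBall y ‖a‖) = absF a * μF.real (Metric.closedBall 0 1) := by
  rw [measureReal_def, measure_closedBall_eq]
  rcases eq_or_ne a 0 with rfl | ha
  · simp [absF]
  · lift a to Fˣ using ha.isUnit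
    rw [← smul_unitClosedBall, ← Units.smul_def, ← distribHaarChar_mul, ENNReal.toReal_mul,
      absF_units, measureReal_def]
    simp

theorem absF_congr {a b : F} (h : ‖a‖ = ‖b‖) : absF a = absF b := by
  borelize F
  let μ : Measure F := Measure.addHaar
  refine mul_right_cancel₀ (real_closedBall_pos μ one_pos 0).ne' ?_
  rw [← real_closedBall_norm μ a 0, ← real_closedBall_norm μ b 0, h]

theorem tendsto_absF_nhds_zero : Tendsto (absF : F → ℝ) (𝓝 0) (𝓝 0) := by
  borelize F
  let μ : Measure F := Measure.addHaar
  have h0 := (real_closedBall_pos μ one_pos (0 : F)).ne'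
  have balls : Tendsto (fun r => μ (Metric.cthickening r {(0 : F)})) (𝓝 0) (𝓝 0) := by
    simpa using tendsto_measure_cthickening_of_isCompact (μ := μ)
      (isCompact_singleton (x := (0 : F)))
  have := (((ENNReal.tendsto_toReal ENNReal.zero_ne_top).comp balls).comp
    (tendsto_norm_zero (E := F))).div_const (μ.real (Metric.closedBall 0 1))
  rw [ENNReal.toReal_zero, zero_div] at this
  refine this.congr fun a => ?_
  rw [Function.comp_apply, Function.comp_apply, Metric.cthickening_singleton _ (norm_nonneg a),
    ← measureReal_def, real_closedBall_norm μ, mul_div_cancel_right₀ _ h0]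

end AbsF

section Duality

variable {F : Type*} [NontriviallyNormedField F] [IsUltrametricDist F] [MeasurableSpace F]
  [BorelSpace F] {ψ : AddChar F Circle} (μF : Measure F)

theorem setIntegral_closedBall_character [μF.IsAddHaarMeasure] (hcond : HasConductorIntegers ψ)
    {c : F} (hc : c ≠ 0) (x : F) :
    ∫ b in Metric.closedBall 0 ‖c‖, (ψ (b * x) : ℂ) ∂μF =
      (Metric.closedBall 0 ‖c‖⁻¹).indicator
        (fun _ => (μF.real (Metric.closedBall 0 ‖c‖) : ℂ)) x := by
  have hc' := norm_pos_iff.2 hc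
  by_cases hx : x ∈ Metric.closedBall 0 ‖c‖⁻¹
  · have trivial_on : ∀ b ∈ Metric.closedBall 0 ‖c‖, (ψ (b * x) : ℂ) = 1 := by
      intro b hb
      rw [mem_closedBall_zero_iff] at hb hx
      rw [hcond.eq_one, Circle.coe_one]
      calc ‖b * x‖ ≤ ‖c‖ * ‖c‖⁻¹ := by rw [norm_mul]; gcongr
        _ = 1 := mul_inv_cancel₀ hc'.ne'
    rw [Set.indicator_of_mem hx, setIntegral_congr_fun measurableSet_closedBall trivial_on]
    simp
  · rw [Set.indicator_of_notMem hx]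
    obtain ⟨y, hy, hy'⟩ := hcond.exists_ne_one (x := c * x) <| by
      rw [mem_closedBall_zero_iff, not_le, inv_lt_iff_one_lt_mul₀' hc'] at hx
      rwa [norm_mul]
    refine integral_character_eq_zero μF
      (H := (IsUltrametricDist.closedBall_openAddSubgroup F hc').toAddSubgroup) (l := c * y)
      measurableSet_closedBall (fun a _ b _ => ?_) ?_ ?_
    · rw [add_mul, AddChar.map_add_eq_mul, Circle.coe_mul]
    · change c * y ∈ Metric.closedBall 0 ‖c‖
      rw [mem_closedBall_zero_iff, norm_mul]
      exact mul_le_of_le_one_right (norm_nonneg c) hy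
    · rwa [← Circle.coe_one, Ne, Circle.coe_inj, mul_right_comm]

theorem integral_closedBall_fourier_mul [ProperSpace F] [μF.IsAddHaarMeasure]
    {X : Type*} [MeasurableSpace X] (μ : Measure X) [SFinite μ] (hcond : HasConductorIntegers ψ)
    {π : X → F} (hπ : Measurable π) {f : X → ℂ} (hf : Integrable f μ) {c : F} (hc : c ≠ 0)
    (y : F) :
    ∫ b in Metric.closedBall 0 ‖c‖⁻¹, (ψ (-(b * y)) : ℂ) * ∫ x, f x * (ψ (b * π x) : ℂ) ∂μ ∂μF =
      μF.real (Metric.closedBall 0 ‖c‖⁻¹) * ∫ x in π ⁻¹' Metric.closedBall y ‖c‖, f x ∂μ := by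
  have : IsFiniteMeasure (μF.restrict (Metric.closedBall 0 ‖c‖⁻¹)) :=
    ⟨by simpa using (isCompact_closedBall (0 : F) ‖c‖⁻¹).measure_lt_top⟩
  have integrable : Integrable (Function.uncurry fun b x => f x * (ψ (b * (π x - y)) : ℂ))
      ((μF.restrict (Metric.closedBall 0 ‖c‖⁻¹)).prod μ) := by
    refine (hf.comp_snd _).mul_bdd (c := 1) (Measurable.aestronglyMeasurable
      (measurable_coe_comp hcond.continuous ?_))
      (Eventually.of_forall fun p => (Circle.norm_coe _).le)
    exact measurable_fst.mul ((hπ.comp measurable_snd).sub_const y)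
  have dual : ∀ x, ∫ b in Metric.closedBall 0 ‖c‖⁻¹, f x * (ψ (b * (π x - y)) : ℂ) ∂μF =
      (π ⁻¹' Metric.closedBall y ‖c‖).indicator
        (fun x => μF.real (Metric.closedBall 0 ‖c‖⁻¹) * f x) x := by
    intro x
    rw [integral_const_mul, ← norm_inv, setIntegral_closedBall_character μF hcond (inv_ne_zero hc),
      norm_inv, inv_inv]
    by_cases hx : π x ∈ Metric.closedBall y ‖c‖
    · rw [Set.indicator_of_mem (Set.mem_preimage.2 hx), Set.indicator_of_mem, mul_comm]
      simpa [dist_eq_norm] using hx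
    · rw [Set.indicator_of_notMem (s := π ⁻¹' _) hx, Set.indicator_of_notMem, mul_zero]
      simpa [dist_eq_norm] using hx
  calc _ = ∫ b in Metric.closedBall 0 ‖c‖⁻¹, ∫ x, f x * (ψ (b * (π x - y)) : ℂ) ∂μ ∂μF := by
        congr! 2 with b
        rw [← integral_const_mul]
        congr! 2 with _
        rw [mul_sub, sub_eq_neg_add, AddChar.map_add_eq_mul, Circle.coe_mul]
        ring
    _ = ∫ x, ∫ b in Metric.closedBall 0 ‖c‖⁻¹, f x * (ψ (b * (π x - y)) : ℂ) ∂μF ∂μ :=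
        integral_integral_swap integrable
    _ = _ := by
        simp_rw [dual]
        rw [integral_indicator (hπ measurableSet_closedBall), integral_const_mul]

theorem real_closedBall_one [ProperSpace F] [μF.IsAddHaarMeasure] (hcond : HasConductorIntegers ψ)
    (hμF : IsSelfDual ψ (fun x y : F => x * y) μF) : μF.real (Metric.closedBall 0 1) = 1 := by
  have hB : IsClopen (Metric.closedBall (0 : F) 1) :=
    IsUltrametricDist.isClopen_closedBall 0 one_ne_zero
  have fourier_indicator (z : ℂ) : fourier ψ (fun x y : F => x * y) μF
      ((Metric.closedBall 0 1).indicator fun _ => z) =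
      (Metric.closedBall 0 1).indicator fun _ => z * μF.real (Metric.closedBall 0 1) := by
    funext x
    have := setIntegral_closedBall_character μF hcond one_ne_zero x
    simp only [norm_one, inv_one] at this
    have split : ∀ y, (Metric.closedBall 0 1).indicator (fun _ => z) y * (ψ (x * y) : ℂ) =
        (Metric.closedBall 0 1).indicator (fun y => z * (ψ (y * x) : ℂ)) y := fun y => by
      by_cases hy : y ∈ Metric.closedBall 0 1 <;> simp [hy, mul_comm x]
    rw [fourier, integral_congr_ae (.of_forall split), integral_indicator measurableSet_closedBall,
      integral_const_mul, this]
    by_cases hx : x ∈ Metric.closedBall 0 1 <;> simp [hx]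
  have inversion := hμF _ (SchwartzBruhat.indicator_mem (isCompact_closedBall 0 1) hB.isOpen) 0
  rw [fourier_indicator, fourier_indicator, neg_zero,
    Set.indicator_of_mem (Metric.mem_closedBall_self zero_le_one),
    Set.indicator_of_mem (Metric.mem_closedBall_self zero_le_one), one_mul] at inversion
  have h : μF.real (Metric.closedBall 0 1) ^ 2 = 1 := by rw [sq]; exact_mod_cast inversion
  exact (pow_eq_one_iff_of_nonneg measureReal_nonneg two_ne_zero).1 h

theorem real_closedBall_mul_eq_of_fourier_eq_zero [ProperSpace F] [μF.IsAddHaarMeasure]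
    (hcond : HasConductorIntegers ψ) {X : Type*} [MeasurableSpace X] (μ : Measure X)
    [IsFiniteMeasure μ] {π : X → F} (hπ : Measurable π) {c₀ : F} (hc₀ : c₀ ≠ 0)
    (h : ∀ b, ‖c₀‖⁻¹ < ‖b‖ → ∫ x, (ψ (b * π x) : ℂ) ∂μ = 0) {c : F} (hc : c ≠ 0)
    (hcc : ‖c‖ ≤ ‖c₀‖) (y : F) :
    μ.real (π ⁻¹' Metric.closedBall y ‖c‖) * μF.real (Metric.closedBall 0 ‖c₀‖) =
      μ.real (π ⁻¹' Metric.closedBall y ‖c₀‖) * μF.real (Metric.closedBall 0 ‖c‖) := by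
  have fubini {c : F} (hc : c ≠ 0) :=
    integral_closedBall_fourier_mul μF μ hcond hπ (integrable_const (1 : ℂ)) hc y
  simp only [one_mul, integral_const, measureReal_restrict_apply_univ, Complex.real_smul,
    mul_one] at fubini
  have truncate : ∫ b in Metric.closedBall 0 ‖c‖⁻¹,
        (ψ (-(b * y)) : ℂ) * ∫ x, (ψ (b * π x) : ℂ) ∂μ ∂μF =
      ∫ b in Metric.closedBall 0 ‖c₀‖⁻¹, (ψ (-(b * y)) : ℂ) * ∫ x, (ψ (b * π x) : ℂ) ∂μ ∂μF := by
    refine setIntegral_eq_of_subset_of_forall_sdiff_eq_zero measurableSet_closedBall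
      (Metric.closedBall_subset_closedBall (by gcongr)) fun b hb => ?_
    rw [h b (by simpa using hb.2), mul_zero]
  rw [fubini hc, fubini hc₀] at truncate
  norm_cast at truncate
  rw [← norm_inv, ← norm_inv, real_closedBall_norm, real_closedBall_norm, absF_inv, absF_inv]
    at truncate
  rw [real_closedBall_norm, real_closedBall_norm]
  have := absF_pos hc
  have := absF_pos hc₀
  have := real_closedBall_pos μF one_pos (0 : F)
  field_simp at truncate
  linear_combination μF.real (Metric.closedBall 0 1) * truncate

end Duality

/-! ### Measures on fibres -/

section Balls

variable {X : Type*} [MetricSpace X]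

theorem eventually_closedBall_norm_subset {F : Type*} [NontriviallyNormedField F] {x : X}
    {U : Set X} (hU : U ∈ 𝓝 x) : ∀ᶠ c in 𝓝[≠] (0 : F), Metric.closedBall x ‖c‖ ⊆ U :=
  (tendsto_norm_zero.mono_left nhdsWithin_le_nhds).eventually
    (eventually_closedBall_subset hU)

theorem isLocallyConstant_closedBall [IsUltrametricDist X] {r : ℝ} (hr : 0 < r) :
    IsLocallyConstant fun x : X => Metric.closedBall x r := by
  rw [IsLocallyConstant.iff_eventually_eq]
  intro x
  filter_upwards [Metric.closedBall_mem_nhds x hr] with y hy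
  exact (IsUltrametricDist.closedBall_eq_of_mem hy).symm

theorem isClopen_setOf_closedBall_subset [IsUltrametricDist X] {r : ℝ} (hr : 0 < r) (U : Set X) :
    IsClopen {x | Metric.closedBall x r ⊆ U} :=
  ⟨⟨isLocallyConstant_closedBall hr {B | B ⊆ U}ᶜ⟩, isLocallyConstant_closedBall hr {B | B ⊆ U}⟩

theorem setOf_closedBall_subset_subset {r : ℝ} (hr : 0 < r) (U : Set X) :
    {x | Metric.closedBall x r ⊆ U} ⊆ U :=
  fun _ hx => hx (Metric.mem_closedBall_self hr.le)

theorem aecover_setOf_closedBall_subset [IsUltrametricDist X] [MeasurableSpace X]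
    [OpensMeasurableSpace X] {Z : Type*} [MeasurableSpace Z] (μ : Measure Z) {π : Z → X}
    (hπ : Measurable π) {U : Set X} (hU : IsOpen U) :
    AECover (μ.restrict (π ⁻¹' U)) atTop
      fun n : ℕ => π ⁻¹' {x | Metric.closedBall x (1 / (n + 1)) ⊆ U} where
  ae_eventually_mem := by
    filter_upwards [ae_restrict_mem (hπ hU.measurableSet)] with z hz
    exact tendsto_one_div_add_atTop_nhds_zero_nat.eventually
      (eventually_closedBall_subset (hU.mem_nhds hz))
  measurableSet n :=
    hπ (isClopen_setOf_closedBall_subset (by positivity) U).isOpen.measurableSet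

end Balls

section FiberMeasure

variable {F : Type*} [NontriviallyNormedField F] [MeasurableSpace F] {μF : Measure F}
  {X : Type*} [TopologicalSpace X] [MeasurableSpace X] {μ : Measure X} {π : X → F} {Y₀ : Set F}

theorem fiberIntegral_indicator {X Y : Type*} [MeasurableSpace X] {π : X → Y}
    (ν : (y : Y) → Measure {x : X // π x = y}) (f : X → ℂ) (C : Set Y) (y : Y) :
    ∫ x : {x : X // π x = y}, (π ⁻¹' C).indicator f x ∂(ν y) =
      C.indicator (fun y => ∫ x : {x : X // π x = y}, f x ∂(ν y)) y := by
  have mem_iff (x : {x : X // π x = y}) : x.1 ∈ π ⁻¹' C ↔ y ∈ C := by rw [Set.mem_preimage, x.2]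
  by_cases hy : y ∈ C <;> simp [Set.indicator, mem_iff, hy]

theorem fiberIntegral_indicator_one {X Y : Type*} [MeasurableSpace X] {π : X → Y}
    (ν : (y : Y) → Measure {x : X // π x = y}) {K : Set X} (hK : MeasurableSet K) (y : Y) :
    ∫ x : {x : X // π x = y}, K.indicator (fun _ => (1 : ℂ)) x ∂(ν y) =
      (ν y).real (Subtype.val ⁻¹' K) := by
  change ∫ x, (Subtype.val ⁻¹' K).indicator (fun _ => (1 : ℂ)) x ∂(ν y) = _
  rw [integral_indicator (measurable_subtype_coe hK)]
  simp

namespace IsFiberMeasure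

variable {ν : (y : F) → Measure {x : X // π x = y}}

theorem indicator_mem (hν : IsFiberMeasure μ μF π Y₀ ν) (hπ : Continuous π) {f : X → ℂ}
    (hf : f ∈ SchwartzBruhat X) {C : Set F} (hC : IsClopen C) (hCY : C ⊆ Y₀) :
    C.indicator (fun y => ∫ x : {x : X // π x = y}, f x ∂(ν y)) ∈ SchwartzBruhat F := by
  simp_rw [funext_iff.2 fun y => (fiberIntegral_indicator ν f C y).symm]
  exact hν.fiber_integral_mem _ (SchwartzBruhat.indicator_mem_of_mem (hC.preimage hπ) hf)
    fun x hx => hCY (Set.mem_of_indicator_ne_zero hx : x ∈ π ⁻¹' C)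

theorem eventually_eq [IsUltrametricDist F] (hν : IsFiberMeasure μ μF π Y₀ ν) (hπ : Continuous π)
    (hY₀ : IsOpen Y₀) {f : X → ℂ} (hf : f ∈ SchwartzBruhat X) {y : F} (hy : y ∈ Y₀) :
    ∀ᶠ z in 𝓝 y, ∫ x : {x : X // π x = z}, f x ∂(ν z) = ∫ x : {x : X // π x = y}, f x ∂(ν y) := by
  obtain ⟨r, hr, hrY⟩ := Metric.nhds_basis_closedBall.mem_iff.1 (hY₀.mem_nhds hy)
  have hC := IsUltrametricDist.isClopen_closedBall y hr.ne'
  filter_upwards [(hν.indicator_mem hπ hf hC hrY).1.eventually_eq y,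
    Metric.closedBall_mem_nhds y hr] with z hz hzC
  rwa [Set.indicator_of_mem hzC, Set.indicator_of_mem (Metric.mem_closedBall_self hr.le)] at hz

variable [BorelSpace F] [BorelSpace X]

theorem setIntegral_eq (hν : IsFiberMeasure μ μF π Y₀ ν) (hπ : Continuous π) {f : X → ℂ}
    (hf : f ∈ SchwartzBruhat X) {C : Set F} (hC : IsClopen C) (hCY : C ⊆ Y₀) :
    ∫ x in π ⁻¹' C, f x ∂μ = ∫ y in C, (∫ x : {x : X // π x = y}, f x ∂(ν y)) ∂μF := by
  rw [← integral_indicator (hC.preimage hπ).isOpen.measurableSet,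
    ← integral_indicator hC.isOpen.measurableSet,
    hν.integral_eq _ (SchwartzBruhat.indicator_mem_of_mem (hC.preimage hπ) hf)
      fun x hx => hCY (Set.mem_of_indicator_ne_zero hx : x ∈ π ⁻¹' C)]
  simp_rw [fiberIntegral_indicator]

variable [IsUltrametricDist F]

theorem integrableOn [IsFiniteMeasureOnCompacts μF] [IsFiniteMeasureOnCompacts μ]
    (hν : IsFiberMeasure μ μF π Y₀ ν)
    (hπ : Continuous π) (hY₀ : IsOpen Y₀) {f : X → ℂ} (hf : f ∈ SchwartzBruhat X) :
    IntegrableOn (fun y => ∫ x : {x : X // π x = y}, f x ∂(ν y)) Y₀ μF := by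
  set J := fun (f : X → ℂ) (y : F) => ∫ x : {x : X // π x = y}, f x ∂(ν y)
  have hnorm : (fun x => (‖f x‖ : ℂ)) ∈ SchwartzBruhat X :=
    ⟨hf.1.comp fun z : ℂ => (‖z‖ : ℂ), hf.2.comp_left (g := fun z : ℂ => (‖z‖ : ℂ)) (by simp)⟩
  have integrableOn_clopen {f : X → ℂ} (hf : f ∈ SchwartzBruhat X) {C : Set F} (hC : IsClopen C)
      (hCY : C ⊆ Y₀) : IntegrableOn (J f) C μF :=
    (integrable_indicator_iff hC.isOpen.measurableSet).1
      (SchwartzBruhat.integrable μF (hν.indicator_mem hπ hf hC hCY))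
  have norm_J_le (y : F) : ‖J f y‖ ≤ (J (fun x => ‖f x‖) y).re := by
    simp only [J, integral_complex_ofReal, Complex.ofReal_re]
    exact norm_integral_le_integral_norm _
  have clopen (n : ℕ) := isClopen_setOf_closedBall_subset (Nat.one_div_pos_of_nat (n := n)) Y₀
  have subset (n : ℕ) := setOf_closedBall_subset_subset (Nat.one_div_pos_of_nat (n := n)) Y₀
  refine (aecover_setOf_closedBall_subset μF measurable_id hY₀).integrable_of_integral_norm_bounded
    (∫ x, ‖f x‖ ∂μ) (fun n => (integrableOn_clopen hf (clopen n) (subset n)).mono_measure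
      Measure.restrict_le_self) (.of_forall fun n => ?_)
  have hint := integrableOn_clopen hnorm (clopen n) (subset n)
  rw [Set.preimage_id, Set.preimage_id, Measure.restrict_restrict_of_subset (subset n)]
  calc ∫ y in {y | Metric.closedBall y (1 / (n + 1)) ⊆ Y₀}, ‖J f y‖ ∂μF
    _ ≤ ∫ y in {y | Metric.closedBall y (1 / (n + 1)) ⊆ Y₀}, (J (fun x => ‖f x‖) y).re ∂μF :=
      integral_mono_of_nonneg (.of_forall fun _ => norm_nonneg _) hint.re (.of_forall norm_J_le)
    _ = (∫ x in π ⁻¹' {y | Metric.closedBall y (1 / (n + 1)) ⊆ Y₀}, (‖f x‖ : ℂ) ∂μ).re := by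
      rw [hν.setIntegral_eq hπ hnorm (clopen n) (subset n)]
      exact integral_re hint
    _ = ∫ x in π ⁻¹' {y | Metric.closedBall y (1 / (n + 1)) ⊆ Y₀}, ‖f x‖ ∂μ := by
      rw [integral_complex_ofReal, Complex.ofReal_re]
    _ ≤ ∫ x, ‖f x‖ ∂μ := setIntegral_le_integral (SchwartzBruhat.integrable μ hf).norm
      (.of_forall fun _ => norm_nonneg _)

theorem integral_eq_setIntegral [IsFiniteMeasureOnCompacts μF] [IsFiniteMeasureOnCompacts μ]
    (hν : IsFiberMeasure μ μF π Y₀ ν)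
    (hπ : Continuous π) (hY₀ : IsOpen Y₀) {f : X → ℂ} (hf : f ∈ SchwartzBruhat X)
    (hnull : μ (Function.support f ∩ π ⁻¹' Y₀ᶜ) = 0) :
    ∫ x, f x ∂μ = ∫ y in Y₀, (∫ x : {x : X // π x = y}, f x ∂(ν y)) ∂μF := by
  have subset (n : ℕ) := setOf_closedBall_subset_subset (Nat.one_div_pos_of_nat (n := n)) Y₀
  have upstairs := (aecover_setOf_closedBall_subset μ hπ.measurable
    hY₀).integral_tendsto_of_countably_generated (SchwartzBruhat.integrable μ hf).integrableOn
  have downstairs := (aecover_setOf_closedBall_subset μF measurable_id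
    hY₀).integral_tendsto_of_countably_generated (hν.integrableOn hπ hY₀ hf)
  simp_rw [Measure.restrict_restrict_of_subset (Set.preimage_mono (f := π) (subset _)),
    hν.setIntegral_eq hπ hf (isClopen_setOf_closedBall_subset Nat.one_div_pos_of_nat Y₀)
      (subset _)] at upstairs
  simp_rw [Set.preimage_id, Measure.restrict_restrict_of_subset (subset _)] at downstairs
  rw [← tendsto_nhds_unique upstairs downstairs]
  refine (setIntegral_eq_integral_of_ae_compl_eq_zero ?_).symm
  filter_upwards [measure_eq_zero_iff_ae_notMem.1 hnull] with x hx hxY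
  exact not_not.1 fun hfx => hx ⟨hfx, hxY⟩

variable [ProperSpace F] [μF.IsAddHaarMeasure]

theorem eventually_setIntegral (hν : IsFiberMeasure μ μF π Y₀ ν) (hπ : Continuous π)
    (hY₀ : IsOpen Y₀) {f : X → ℂ} (hf : f ∈ SchwartzBruhat X) {y : F} (hy : y ∈ Y₀) :
    ∀ᶠ c in 𝓝[≠] (0 : F), ∫ x in π ⁻¹' Metric.closedBall y ‖c‖, f x ∂μ =
      μF.real (Metric.closedBall 0 ‖c‖) * ∫ x : {x : X // π x = y}, f x ∂(ν y) := by
  filter_upwards [eventually_closedBall_norm_subset (hY₀.mem_nhds hy),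
    eventually_closedBall_norm_subset (hν.eventually_eq hπ hY₀ hf hy),
    self_mem_nhdsWithin] with c hcY hc hc0
  have hC := IsUltrametricDist.isClopen_closedBall y (norm_ne_zero_iff.2 hc0)
  rw [hν.setIntegral_eq hπ hf hC hcY, setIntegral_congr_fun hC.isOpen.measurableSet hc]
  simp [measureReal_def, measure_closedBall_eq]

theorem eventually_real_inter [T2Space X] (hν : IsFiberMeasure μ μF π Y₀ ν) (hπ : Continuous π)
    (hY₀ : IsOpen Y₀) {K : Set X} (hK : IsCompact K) (hK' : IsOpen K) {y : F} (hy : y ∈ Y₀) :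
    ∀ᶠ c in 𝓝[≠] (0 : F), μ.real (K ∩ π ⁻¹' Metric.closedBall y ‖c‖) =
      μF.real (Metric.closedBall 0 ‖c‖) * (ν y).real (Subtype.val ⁻¹' K) := by
  filter_upwards [hν.eventually_setIntegral hπ hY₀ (SchwartzBruhat.indicator_mem hK hK') hy]
    with c hc
  rw [fiberIntegral_indicator_one ν hK'.measurableSet, setIntegral_indicator hK'.measurableSet,
    setIntegral_const, Set.inter_comm, Complex.real_smul, mul_one] at hc
  exact_mod_cast hc

theorem integral_comp_eq (hν : IsFiberMeasure μ μF π Y₀ ν) (hπ : Continuous π)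
    (hY₀ : IsOpen Y₀) (e : X ≃ₜ X) (he : ∀ x, π (e x) = π x)
    (hμ : ∀ f ∈ SchwartzBruhat X, ∫ x, f (e x) ∂μ = ∫ x, f x ∂μ) {f : X → ℂ}
    (hf : f ∈ SchwartzBruhat X) {y : F} (hy : y ∈ Y₀) :
    ∫ x : {x : X // π x = y}, f (e x) ∂(ν y) = ∫ x : {x : X // π x = y}, f x ∂(ν y) := by
  obtain ⟨c, ⟨hcf, hcfe⟩, hc⟩ := (((hν.eventually_setIntegral hπ hY₀ hf hy).and
    (hν.eventually_setIntegral hπ hY₀ (SchwartzBruhat.comp_isClosedEmbedding hf e.isClosedEmbedding)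
      hy)).and self_mem_nhdsWithin).exists
  have hc0 := norm_pos_iff.2 hc
  have hB := (IsUltrametricDist.isClopen_closedBall y hc0.ne').preimage hπ
  have invariant := hμ _ (SchwartzBruhat.indicator_mem_of_mem hB hf)
  have indicator_comp : (fun x => (π ⁻¹' Metric.closedBall y ‖c‖).indicator f (e x)) =
      (π ⁻¹' Metric.closedBall y ‖c‖).indicator (f ∘ e) := by
    ext x; simp [Set.indicator, he]
  rw [indicator_comp] at invariant
  rw [integral_indicator hB.isOpen.measurableSet, integral_indicator hB.isOpen.measurableSet, hcf,
    hcfe] at invariant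
  exact mul_left_cancel₀ (by exact_mod_cast (real_closedBall_pos μF hc0 0).ne') invariant

end IsFiberMeasure

end FiberMeasure

section CompactOpenContent

variable {Z : Type*} [TopologicalSpace Z] [T2Space Z]

theorem isSetRing_compactOpen : IsSetRing {C : Set Z | IsOpen C ∧ IsCompact C} where
  empty_mem := ⟨isOpen_empty, isCompact_empty⟩
  union_mem _ _ hC hC' := ⟨hC.1.union hC'.1, hC.2.union hC'.2⟩
  sdiff_mem _ _ hC hC' := ⟨hC.1.sdiff hC'.2.isClosed, hC.2.diff hC'.1⟩

theorem isSigmaSubadditive_compactOpen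
    (m : AddContent ENNReal {C : Set Z | IsOpen C ∧ IsCompact C}) : m.IsSigmaSubadditive := by
  intro C hC hCU
  obtain ⟨I, hI⟩ := hCU.2.elim_finite_subcover C (fun i => (hC i).1) subset_rfl
  calc m (⋃ i, C i) = m (⋃ i ∈ I, C i) := by rw [hI.antisymm (Set.iUnion₂_subset_iUnion _ _)]
    _ ≤ ∑ i ∈ I, m (C i) := addContent_biUnion_le isSetRing_compactOpen fun i _ => hC i
    _ ≤ ∑' i, m (C i) := ENNReal.sum_le_tsum I

theorem exists_measure_eq_of_additive [PrespectralSpace Z] [SecondCountableTopology Z]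
    [MeasurableSpace Z] [BorelSpace Z] (m : Set Z → NNReal) (m_empty : m ∅ = 0)
    (m_union : ∀ C C', IsOpen C → IsCompact C → IsOpen C' → IsCompact C' → Disjoint C C' →
      m (C ∪ C') = m C + m C') :
    ∃ ν : Measure Z, IsFiniteMeasureOnCompacts ν ∧
      ∀ C, IsOpen C → IsCompact C → ν C = m C := by
  let content : AddContent ENNReal {C : Set Z | IsOpen C ∧ IsCompact C} :=
    isSetRing_compactOpen.addContent_of_union (fun C => m C) (by simp [m_empty])
      fun hC hC' hCC' => by simp [m_union _ _ hC.1 hC.2 hC'.1 hC'.2 hCC']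
  have generate : ‹MeasurableSpace Z› = .generateFrom {C : Set Z | IsOpen C ∧ IsCompact C} :=
    BorelSpace.measurable_eq.trans PrespectralSpace.isTopologicalBasis.borel_eq_generateFrom
  have measure_eq (C : Set Z) (hC : IsOpen C) (hC' : IsCompact C) :=
    content.measure_eq isSetRing_compactOpen.isSetSemiring generate
      (isSigmaSubadditive_compactOpen content) ⟨hC, hC'⟩
  refine ⟨_, ⟨fun C hC => ?_⟩, measure_eq⟩
  obtain ⟨U, hU, hU', hCU, -⟩ :=
    PrespectralSpace.exists_isCompact_and_isOpen_between hC isOpen_univ (Set.subset_univ C)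
  calc _ ≤ _ := measure_mono hCU
    _ < ⊤ := (measure_eq U hU' hU).trans_lt ENNReal.coe_lt_top

end CompactOpenContent

section FiberDensity

variable {F : Type*} [NontriviallyNormedField F] [MeasurableSpace F] {μF : Measure F}
  {X : Type*} [MeasurableSpace X] {μ : Measure X} {π : X → F}

theorem lintegral_measure_inter_preimage_closedBall [ProperSpace F] [BorelSpace F]
    [μF.IsAddHaarMeasure] (hπ : Measurable π) {K : Set X} (hK : μ K ≠ ⊤) (r : ℝ) :
    ∫⁻ y, μ (K ∩ π ⁻¹' Metric.closedBall y r) ∂μF = μ K * μF (Metric.closedBall 0 r) := by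
  have := isFiniteMeasure_restrict.2 hK
  have hS : MeasurableSet {p : X × F | dist (π p.1) p.2 ≤ r} :=
    measurableSet_le ((hπ.comp measurable_fst).dist measurable_snd) measurable_const
  have sections (y : F) : μ (K ∩ π ⁻¹' Metric.closedBall y r) =
      μ.restrict K ((fun x => (x, y)) ⁻¹' {p : X × F | dist (π p.1) p.2 ≤ r}) := by
    rw [Set.inter_comm]
    exact (Measure.restrict_apply (hπ measurableSet_closedBall)).symm
  have sections' (x : X) : Prod.mk x ⁻¹' {p : X × F | dist (π p.1) p.2 ≤ r} =
      Metric.closedBall (π x) r := by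
    ext y; simp [dist_comm]
  simp_rw [sections]
  rw [← Measure.prod_apply_symm hS, Measure.prod_apply hS]
  simp_rw [sections', Measure.addHaar_closedBall_center]
  simp [mul_comm]

/-- The pushforward of `μ` restricted to `K` has density `g` with respect to `μF`, in the strong
sense that averaging over balls of any sufficiently small scale gives `g` exactly.  Scales are
norms `‖c‖` of small `c ≠ 0`. -/
def HasFiberDensity (μF : Measure F) (μ : Measure X) (π : X → F) (K : Set X)
    (g : F → NNReal) : Prop :=
  ∀ᶠ c in 𝓝[≠] (0 : F), ∀ y,
    μ (K ∩ π ⁻¹' Metric.closedBall y ‖c‖) = g y * μF (Metric.closedBall 0 ‖c‖)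

namespace HasFiberDensity

variable {K L : Set X} {g g' : F → NNReal}

theorem empty : HasFiberDensity μF μ π ∅ 0 := .of_forall fun c y => by simp

theorem union (h : HasFiberDensity μF μ π K g) (h' : HasFiberDensity μF μ π L g')
    (hK : MeasurableSet K) (hKL : Disjoint K L) : HasFiberDensity μF μ π (K ∪ L) (g + g') := by
  filter_upwards [h, h'] with c hc hc' y
  rw [← measure_inter_add_sdiff _ hK, Set.inter_right_comm, Set.union_inter_cancel_left,
    Set.inter_sdiff_right_comm, Set.union_sdiff_cancel_left hKL.le_bot, hc, hc']
  simp [add_mul]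

variable [ProperSpace F] [μF.IsAddHaarMeasure]

theorem isLocallyConstant [IsUltrametricDist F] (h : HasFiberDensity μF μ π K g) :
    IsLocallyConstant g := by
  obtain ⟨c, hc, hc0⟩ := (h.and self_mem_nhdsWithin).exists
  have hball := (Metric.measure_closedBall_pos μF 0 (norm_pos_iff.2 hc0)).ne'
  have g_eq : g = fun y => (μ (K ∩ π ⁻¹' Metric.closedBall y ‖c‖) /
      μF (Metric.closedBall 0 ‖c‖)).toNNReal := by
    ext y
    rw [hc, ENNReal.mul_div_cancel_right hball measure_closedBall_lt_top.ne, ENNReal.toNNReal_coe]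
  rw [g_eq]
  exact (isLocallyConstant_closedBall (norm_pos_iff.2 hc0)).comp fun B =>
    (μ (K ∩ π ⁻¹' B) / μF (Metric.closedBall 0 ‖c‖)).toNNReal

theorem lintegral_eq [BorelSpace F] (h : HasFiberDensity μF μ π K g) (hπ : Measurable π)
    (hK : μ K ≠ ⊤) : ∫⁻ y, g y ∂μF = μ K := by
  obtain ⟨c, hc, hc0⟩ := (h.and self_mem_nhdsWithin).exists
  have hball := (Metric.measure_closedBall_pos μF 0 (norm_pos_iff.2 hc0)).ne'
  have hball' := (measure_closedBall_lt_top (μ := μF) (x := 0) (r := ‖c‖)).ne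
  have := lintegral_measure_inter_preimage_closedBall (μF := μF) hπ hK ‖c‖
  simp_rw [hc] at this
  rw [lintegral_mul_const' _ _ hball'] at this
  exact (ENNReal.mul_left_inj hball hball').1 this

theorem integral_eq [BorelSpace F] [IsUltrametricDist F] (h : HasFiberDensity μF μ π K g)
    (hπ : Measurable π) (hK : μ K ≠ ⊤) : ∫ y, ((g y : ℝ) : ℂ) ∂μF = μ.real K := by
  have toReal_lintegral : ∫ y, (g y : ℝ) ∂μF = (∫⁻ y, g y ∂μF).toReal :=
    integral_toReal h.isLocallyConstant.continuous.measurable.coe_nnreal_ennreal.aemeasurable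
      (.of_forall fun _ => ENNReal.coe_lt_top)
  rw [integral_complex_ofReal, toReal_lintegral, h.lintegral_eq hπ hK, measureReal_def]

end HasFiberDensity

variable [TopologicalSpace X]

omit [MeasurableSpace F] [MeasurableSpace X] in
theorem eventually_inter_preimage_eq (hπ : Continuous π) {K L : Set X} (hK : IsCompact K)
    (hK' : IsOpen K) (hL : IsCompact L) (hL' : IsOpen L) {y : F}
    (h : ∀ x, π x = y → (x ∈ K ↔ x ∈ L)) :
    ∀ᶠ c in 𝓝[≠] (0 : F),
      K ∩ π ⁻¹' Metric.closedBall y ‖c‖ = L ∩ π ⁻¹' Metric.closedBall y ‖c‖ := by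
  have hD : IsCompact (symmDiff K L) := (hK.diff hL').union (hL.diff hK')
  have hy : (π '' symmDiff K L)ᶜ ∈ 𝓝 y := by
    refine (hD.image hπ).isClosed.isOpen_compl.mem_nhds ?_
    rintro ⟨x, hx | hx, hxy⟩
    exacts [hx.2 ((h x hxy).1 hx.1), hx.2 ((h x hxy).2 hx.1)]
  filter_upwards [eventually_closedBall_norm_subset hy] with c hc
  ext x
  simp only [Set.mem_inter_iff, and_congr_left_iff]
  refine fun hx => ⟨fun hxK => ?_, fun hxL => ?_⟩ <;> by_contra hx'
  exacts [hc hx ⟨x, .inl ⟨hxK, hx'⟩, rfl⟩, hc hx ⟨x, .inr ⟨hxL, hx'⟩, rfl⟩]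

namespace HasFiberDensity

variable {K L : Set X} {g g' : F → NNReal} [ProperSpace F] [μF.IsAddHaarMeasure]

theorem eq_of_trace_eq (h : HasFiberDensity μF μ π K g) (h' : HasFiberDensity μF μ π L g')
    (hπ : Continuous π) (hK : IsCompact K) (hK' : IsOpen K) (hL : IsCompact L) (hL' : IsOpen L)
    {y : F} (hKL : ∀ x, π x = y → (x ∈ K ↔ x ∈ L)) : g y = g' y := by
  obtain ⟨c, ⟨⟨hc, hc'⟩, heq⟩, hc0⟩ := (((h.and h').and
    (eventually_inter_preimage_eq hπ hK hK' hL hL' hKL)).and self_mem_nhdsWithin).exists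
  have hball := (Metric.measure_closedBall_pos μF 0 (norm_pos_iff.2 hc0)).ne'
  have := (hc y).symm.trans ((congrArg μ heq).trans (hc' y))
  exact_mod_cast (ENNReal.mul_left_inj hball measure_closedBall_lt_top.ne).1 this

theorem support_subset (h : HasFiberDensity μF μ π K g) (hπ : Continuous π) (hK : IsCompact K)
    (hK' : IsOpen K) : Function.support g ⊆ π '' K := by
  intro y hy
  by_contra hyK
  refine hy (h.eq_of_trace_eq .empty hπ hK hK' isCompact_empty isOpen_empty fun x hx => ?_)
  simpa using fun hxK => hyK ⟨x, hxK, hx⟩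

theorem mem_schwartzBruhat [IsUltrametricDist F] (h : HasFiberDensity μF μ π K g)
    (hπ : Continuous π) (hK : IsCompact K) (hK' : IsOpen K) :
    (fun y => ((g y : ℝ) : ℂ)) ∈ SchwartzBruhat F := by
  refine ⟨h.isLocallyConstant.comp fun r : NNReal => ((r : ℝ) : ℂ),
    .intro (hK.image hπ) fun y hy => ?_⟩
  simp [Function.notMem_support.1 fun hgy => hy (h.support_subset hπ hK hK' hgy)]

end HasFiberDensity

theorem exists_measure_fiber_eq [T2Space X] [PrespectralSpace X] [SecondCountableTopology X]
    [BorelSpace X] [ProperSpace F] [μF.IsAddHaarMeasure] (hπ : Continuous π) {X₀ : Set X}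
    (hX₀ : IsOpen X₀) (hex : ∀ K ⊆ X₀, IsCompact K → IsOpen K → ∃ g, HasFiberDensity μF μ π K g)
    {y : F} (hy : π ⁻¹' {y} ⊆ X₀) :
    ∃ ν : Measure {x : X // π x = y}, IsFiniteMeasureOnCompacts ν ∧
      ∀ K ⊆ X₀, IsCompact K → IsOpen K → ∀ g, HasFiberDensity μF μ π K g →
        ν (Subtype.val ⁻¹' K) = g y := by
  have hfib : IsClosed {x | π x = y} := isClosed_eq hπ continuous_const
  have := prespectralSpace_subtype hfib
  have : SecondCountableTopology {x : X // π x = y} :=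
    TopologicalSpace.Subtype.secondCountableTopology {x | π x = y}
  have density (C : Set {x : X // π x = y}) : ∃ r : NNReal, ∀ K ⊆ X₀, IsCompact K → IsOpen K →
      (∀ x : {x : X // π x = y}, x.1 ∈ K ↔ x ∈ C) → ∀ g, HasFiberDensity μF μ π K g → r = g y := by
    by_cases hC : ∃ K ⊆ X₀, IsCompact K ∧ IsOpen K ∧ ∀ x : {x : X // π x = y}, x.1 ∈ K ↔ x ∈ C
    · obtain ⟨K, hKX, hK, hK', hKC⟩ := hC
      obtain ⟨g, hg⟩ := hex K hKX hK hK'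
      exact ⟨g y, fun L _ hL hL' hLC g' hg' => hg.eq_of_trace_eq hg' hπ hK hK' hL hL'
        fun x hx => (hKC ⟨x, hx⟩).trans (hLC ⟨x, hx⟩).symm⟩
    · exact ⟨0, fun K hKX hK hK' hKC => (hC ⟨K, hKX, hK, hK', hKC⟩).elim⟩
  choose m hm using density
  have m_empty : m ∅ = 0 := hm ∅ ∅ (Set.empty_subset _) isCompact_empty isOpen_empty (by simp) 0
    .empty
  have extension {C : Set {x : X // π x = y}} (hC : IsOpen C) (hC' : IsCompact C) :=
    exists_isCompact_isOpen_extension hC' hC hX₀ fun x _ => hy x.2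
  obtain ⟨ν, hν, hνm⟩ := exists_measure_eq_of_additive m m_empty fun C C' hC hCc hC' hCc' hCC' => by
    obtain ⟨K, hK, hK', hKC, hKX⟩ := extension hC hCc
    obtain ⟨L, hL, hL', hLC, hLX⟩ := extension hC' hCc'
    have hLK : L \ K ⊆ X₀ := Set.sdiff_subset.trans hLX
    obtain ⟨g, hg⟩ := hex K hKX hK hK'
    obtain ⟨g', hg'⟩ := hex (L \ K) hLK (hL.diff hK') (hL'.sdiff hK.isClosed)
    rw [hm C K hKX hK hK' hKC g hg, hm C' (L \ K) hLK (hL.diff hK') (hL'.sdiff hK.isClosed)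
      (fun x => ?_) g' hg', hm (C ∪ C') (K ∪ L \ K) (Set.union_subset hKX hLK)
      (hK.union (hL.diff hK')) (hK'.union (hL'.sdiff hK.isClosed)) (fun x => ?_) _
      (hg.union hg' hK'.measurableSet Set.disjoint_sdiff_right)]
    · rfl
    · simp [hKC, hLC]
    · simpa [hKC, hLC] using fun hxC' hxC => Set.disjoint_left.1 hCC' hxC hxC'
  refine ⟨ν, hν, fun K hKX hK hK' g hg => ?_⟩
  rw [hνm _ (hK'.preimage continuous_subtype_val)
    (hfib.isClosedEmbedding_subtypeVal.isCompact_preimage hK),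
    hm (Subtype.val ⁻¹' K) K hKX hK hK' (fun x => Iff.rfl) g hg]

theorem isFiberMeasure_of_compactOpen [T2Space X] [BorelSpace X] [IsFiniteMeasureOnCompacts μ]
    [IsUltrametricDist F] [ProperSpace F] [BorelSpace F] [μF.IsAddHaarMeasure] (hπ : Continuous π)
    {Y₀ : Set F} {ν : (y : F) → Measure {x : X // π x = y}}
    (hν : ∀ y, IsFiniteMeasureOnCompacts (ν y))
    (h : ∀ K ⊆ π ⁻¹' Y₀, IsCompact K → IsOpen K →
      ∃ g, HasFiberDensity μF μ π K g ∧ ∀ y, ν y (Subtype.val ⁻¹' K) = g y) :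
    IsFiberMeasure μ μF π Y₀ ν := by
  have integrable_fiber {f : X → ℂ} (hf : f ∈ SchwartzBruhat X) (y : F) :
      Integrable (fun x : {x : X // π x = y} => f x) (ν y) :=
    SchwartzBruhat.integrable (ν y)
      (SchwartzBruhat.comp_subtype hf (isClosed_eq hπ continuous_const))
  have mem_and_eq (f : X → ℂ) (hf : f ∈ SchwartzBruhat X) (hfY : ∀ x, f x ≠ 0 → π x ∈ Y₀) :
      (fun y => ∫ x : {x : X // π x = y}, f x ∂(ν y)) ∈ SchwartzBruhat F ∧
        ∫ x, f x ∂μ = ∫ y, (∫ x : {x : X // π x = y}, f x ∂(ν y)) ∂μF := by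
    refine SchwartzBruhat.induction_on hf (p := fun f =>
      (fun y => ∫ x : {x : X // π x = y}, f x ∂(ν y)) ∈ SchwartzBruhat F ∧
        ∫ x, f x ∂μ = ∫ y, (∫ x : {x : X // π x = y}, f x ∂(ν y)) ∂μF)
      (fun K hK hK' hKf => ?_) (fun f₁ hf₁ f₂ hf₂ h₁ h₂ => ?_) fun c f _ h => ?_
    · obtain ⟨g, hg, hgν⟩ := h K (fun x hx => hfY x (hKf hx)) hK hK'
      simp_rw [fiberIntegral_indicator_one _ hK'.measurableSet, measureReal_def, hgν,
        ENNReal.coe_toReal]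
      exact ⟨hg.mem_schwartzBruhat hπ hK hK', by
        rw [hg.integral_eq hπ.measurable hK.measure_lt_top.ne, integral_indicator hK'.measurableSet]
        simp⟩
    · simp only [Pi.add_apply, integral_add (integrable_fiber hf₁ _) (integrable_fiber hf₂ _)]
      rw [integral_add (SchwartzBruhat.integrable μ hf₁) (SchwartzBruhat.integrable μ hf₂),
        integral_add (SchwartzBruhat.integrable μF h₁.1) (SchwartzBruhat.integrable μF h₂.1), h₁.2,
        h₂.2]
      exact ⟨add_mem h₁.1 h₂.1, rfl⟩
    · simp only [Pi.smul_apply, integral_smul]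
      exact ⟨Submodule.smul_mem _ c h.1, congrArg (c • ·) h.2⟩
  exact ⟨fun y _ => hν y, fun f hf hfY => (mem_and_eq f hf hfY).1,
    fun f hf hfY => (mem_and_eq f hf hfY).2⟩

theorem exists_isFiberMeasure [T2Space X] [PrespectralSpace X] [SecondCountableTopology X]
    [BorelSpace X] [IsFiniteMeasureOnCompacts μ] [IsUltrametricDist F] [ProperSpace F]
    [BorelSpace F] [μF.IsAddHaarMeasure] (hπ : Continuous π) {Y₀ : Set F} (hY₀ : IsOpen Y₀)
    (hex : ∀ K ⊆ π ⁻¹' Y₀, IsCompact K → IsOpen K → ∃ g, HasFiberDensity μF μ π K g) :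
    ∃ ν : (y : F) → Measure {x : X // π x = y}, IsFiberMeasure μ μF π Y₀ ν := by
  have fiber (y : F) : ∃ ν : Measure {x : X // π x = y}, IsFiniteMeasureOnCompacts ν ∧
      ∀ K ⊆ π ⁻¹' Y₀, IsCompact K → IsOpen K → ∀ g, HasFiberDensity μF μ π K g →
        ν (Subtype.val ⁻¹' K) = g y := by
    by_cases hy : y ∈ Y₀
    · exact exists_measure_fiber_eq hπ (hY₀.preimage hπ) hex fun x hx => by
        rwa [Set.mem_preimage, Set.mem_singleton_iff.1 hx]
    · refine ⟨0, inferInstance, fun K hKY hK hK' g hg => ?_⟩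
      have : g y = 0 := Function.notMem_support.1 fun hgy =>
        hy (by obtain ⟨x, hx, rfl⟩ := hg.support_subset hπ hK hK' hgy; exact hKY hx)
      simp [this]
  choose ν hν hνg using fiber
  exact ⟨ν, isFiberMeasure_of_compactOpen hπ hν fun K hKY hK hK' =>
    (hex K hKY hK hK').imp fun g hg => ⟨hg, fun y => hνg y K hKY hK hK' g hg⟩⟩

end FiberDensity

/-! ### Lattices and stationary phase -/

section Lattice

variable {F : Type*} [NontriviallyNormedField F] [ProperSpace F]
  {V : Type*} [AddCommGroup V] [Module F V] [FiniteDimensional F V] [TopologicalSpace V]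
  [IsTopologicalAddGroup V] [ContinuousSMul F V] [T2Space V]

variable (F V) in
/-- The coordinates of `V` with respect to its standard basis `Module.finBasis F V`. -/
noncomputable def coordL : V ≃L[F] (Fin (Module.finrank F V) → F) :=
  (Module.finBasis F V).equivFunL

theorem norm_coordL_finBasis_le (i : Fin (Module.finrank F V)) :
    ‖coordL F V (Module.finBasis F V i)‖ ≤ 1 := by
  refine (pi_norm_le_iff_of_nonneg zero_le_one).2 fun j => ?_
  rw [coordL, Module.Basis.equivFunL_apply, Module.Basis.repr_self, Finsupp.single_apply]
  split_ifs <;> simp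

variable (F V) in
include F in
theorem secondCountable_module : SecondCountableTopology V :=
  (coordL F V).toHomeomorph.secondCountableTopology

theorem continuous_polar_comp (h2 : (2 : F) ≠ 0) (Q : QuadraticForm F V) {X : Type*}
    [TopologicalSpace X] {f g : X → V} (hf : Continuous f) (hg : Continuous g) :
    Continuous fun x => QuadraticMap.polar Q (f x) (g x) := by
  borelize V
  have hQ := continuous_quadraticForm h2 Q
  exact ((hQ.comp (hf.add hg)).sub (hQ.comp hf)).sub (hQ.comp hg)

variable [IsUltrametricDist F]

variable (V) in
/-- The lattice `c L₀`, where `L₀` is spanned over the integers by the standard basis of `V`. -/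
def lattice (c : F) : AddSubgroup V where
  carrier := {v | ‖coordL F V v‖ ≤ ‖c‖}
  zero_mem' := by simp
  add_mem' {x y} hx hy := by
    rw [Set.mem_ofPred_eq, map_add]
    exact (IsUltrametricDist.norm_add_le_max _ _).trans (max_le hx hy)
  neg_mem' {x} hx := by rwa [Set.mem_ofPred_eq, map_neg, norm_neg]

theorem mem_lattice {c : F} {v : V} : v ∈ lattice V c ↔ ‖coordL F V v‖ ≤ ‖c‖ := Iff.rfl

theorem coe_lattice (c : F) :
    (lattice V c : Set V) = coordL F V ⁻¹' Metric.closedBall 0 ‖c‖ := by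
  ext v; simp [mem_lattice]

theorem isClopen_lattice {c : F} (hc : c ≠ 0) : IsClopen (lattice V c : Set V) := by
  rw [coe_lattice]
  exact (IsUltrametricDist.isClopen_closedBall _ (norm_ne_zero_iff.2 hc)).preimage
    (coordL F V).continuous

theorem isCompact_lattice (c : F) : IsCompact (lattice V c : Set V) := by
  rw [coe_lattice]
  exact (coordL F V).toHomeomorph.isCompact_preimage.2 (isCompact_closedBall _ _)

theorem isCompact_setOf_sub_mem_lattice (z : V) (c : F) : IsCompact {v | v - z ∈ lattice V c} :=
  (Homeomorph.subRight z).isCompact_preimage.2 (isCompact_lattice c)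

theorem isOpen_setOf_sub_mem_lattice (z : V) {c : F} (hc : c ≠ 0) :
    IsOpen {v | v - z ∈ lattice V c} :=
  (isClopen_lattice hc).isOpen.preimage (Homeomorph.subRight z).continuous

theorem smul_mem_lattice {a c : F} {v : V} (hv : v ∈ lattice V c) : a • v ∈ lattice V (a * c) := by
  rw [mem_lattice, map_smul, norm_smul, norm_mul]
  exact mul_le_mul_of_nonneg_left hv (norm_nonneg a)

theorem eventually_lattice_subset {U : Set V} (hU : U ∈ 𝓝 (0 : V)) :
    ∀ᶠ c in 𝓝 (0 : F), (lattice V c : Set V) ⊆ U := by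
  have hU' : (coordL F V).symm ⁻¹' U ∈ 𝓝 0 :=
    (coordL F V).symm.continuous.continuousAt.preimage_mem_nhds (by simpa using hU)
  obtain ⟨ε, hε, hεU⟩ := Metric.mem_nhds_iff.1 hU'
  filter_upwards [Metric.ball_mem_nhds 0 hε] with c hc v hv
  have : coordL F V v ∈ Metric.ball 0 ε :=
    mem_ball_zero_iff.2 (lt_of_le_of_lt hv (mem_ball_zero_iff.1 hc))
  simpa using hεU this

theorem eventually_add_mem_of_mem_lattice {K : Set V} (hK : IsCompact K) (hK' : IsOpen K) :
    ∀ᶠ c in 𝓝 (0 : F), ∀ v ∈ K, ∀ l ∈ lattice V c, v + l ∈ K := by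
  obtain ⟨W, hW, hKW⟩ := compact_open_separated_add_right hK hK' le_rfl
  filter_upwards [eventually_lattice_subset hW] with c hc v hv l hl
  exact hKW (Set.add_mem_add hv (hc hl))

variable (F V) in
include F in
theorem prespectralSpace_module : PrespectralSpace V :=
  .of_isClosedEmbedding (coordL F V) (coordL F V).toHomeomorph.isClosedEmbedding

theorem exists_norm_quadraticForm_le (h2 : (2 : F) ≠ 0) (Q : QuadraticForm F V) :
    ∃ C : ℝ, 0 < C ∧ ∀ c : F, ∀ l ∈ lattice V c, ‖Q l‖ ≤ C * ‖c‖ ^ 2 := by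
  borelize V
  obtain ⟨C, hC⟩ := (isCompact_lattice (V := V) (1 : F)).exists_bound_of_continuousOn
    (continuous_quadraticForm h2 Q).continuousOn
  refine ⟨max C 1, by positivity, fun c l hl => ?_⟩
  rcases eq_or_ne c 0 with rfl | hc
  · have : l = 0 := by simpa [mem_lattice] using hl
    simp [this]
  have hl' : c⁻¹ • l ∈ lattice V (1 : F) := by simpa [hc] using smul_mem_lattice (a := c⁻¹) hl
  calc ‖Q l‖ = ‖Q (c⁻¹ • l)‖ * ‖c‖ ^ 2 := by
        rw [QuadraticMap.map_smul]; simp; field_simp [norm_ne_zero_iff.2 hc]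
    _ ≤ max C 1 * ‖c‖ ^ 2 := by gcongr; exact (hC _ hl').trans (le_max_left _ _)

theorem exists_mem_lattice_ne_one {ψ : AddChar F Circle}
    (hcond : HasConductorIntegers ψ) {Q : QuadraticForm F V} {w : V} {d : F}
    (h : 1 < ‖fun i => QuadraticMap.polar Q w (Module.finBasis F V i)‖ * ‖d‖) :
    ∃ l ∈ lattice V d, ψ (QuadraticMap.polar Q w l) ≠ 1 := by
  obtain ⟨i, hi⟩ : ∃ i, 1 < ‖QuadraticMap.polar Q w (Module.finBasis F V i) * d‖ := by
    by_contra! hall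
    refine h.not_ge ?_
    rw [mul_comm, ← norm_smul]
    exact (pi_norm_le_iff_of_nonneg zero_le_one).2 fun i => by
      simpa only [Pi.smul_apply, smul_eq_mul, mul_comm] using hall i
  obtain ⟨y, hy, hy'⟩ := hcond.exists_ne_one hi
  refine ⟨(d * y) • Module.finBasis F V i, ?_, ?_⟩
  · rw [mem_lattice, map_smul, norm_smul, norm_mul]
    calc ‖d‖ * ‖y‖ * _ ≤ ‖d‖ * 1 * 1 := by gcongr; exact norm_coordL_finBasis_le i
      _ = ‖d‖ := by ring
  · rwa [QuadraticMap.polar_smul_right, smul_eq_mul, mul_comm, ← mul_assoc]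

end Lattice

theorem integral_eq_zero_of_setIntegral_add_eq_zero {G : Type*} [AddGroup G] [MeasurableSpace G]
    [MeasurableAdd₂ G] {μ : Measure G} [SFinite μ] [μ.IsAddRightInvariant] {f : G → ℂ}
    (hf : Integrable f μ) {L : Set G} (hL₀ : μ L ≠ 0) (hL : μ L ≠ ⊤)
    (h : ∀ v, ∫ l in L, f (v + l) ∂μ = 0) : ∫ v, f v ∂μ = 0 := by
  have := isFiniteMeasure_restrict.2 hL
  have hint : Integrable (Function.uncurry fun l v => f (v + l)) ((μ.restrict L).prod μ) :=
    (measurePreserving_prod_add_right (μ.restrict L) μ).integrable_comp_of_integrable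
      (hf.comp_snd (μ.restrict L))
  have swap := integral_integral_swap hint
  simp only [h, integral_add_right_eq_self, integral_zero, setIntegral_const, smul_eq_zero,
    measureReal_eq_zero_iff hL, hL₀, false_or] at swap
  exact swap

theorem exists_pos_mul_norm_le {F : Type*} [NontriviallyNormedField F] {X : Type*}
    [TopologicalSpace X] {E W : Type*} [NormedAddCommGroup E] [NormedSpace F E] [ProperSpace E]
    [NormedAddCommGroup W] [NormedSpace F W] {K : Set X} (hK : IsCompact K) (T : X → E →ₗ[F] W)
    (hT : Continuous fun q : X × E => T q.1 q.2) (hinj : ∀ x ∈ K, ∀ p, T x p = 0 → p = 0) :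
    ∃ δ : ℝ, 0 < δ ∧ ∀ x ∈ K, ∀ p, δ * ‖p‖ ≤ ‖T x p‖ := by
  obtain ⟨e, he⟩ := NormedField.exists_one_lt_norm F
  have he₀ : 0 < 1 / ‖e‖ := by positivity
  let shell : Set E := Metric.closedBall 0 1 \ Metric.ball 0 (1 / ‖e‖)
  have hshell : IsCompact shell := (isCompact_closedBall 0 1).diff Metric.isOpen_ball
  have hpos : ∀ q ∈ K ×ˢ shell, 0 < ‖T q.1 q.2‖ := by
    rintro ⟨x, p⟩ ⟨hx, -, hp⟩
    refine norm_pos_iff.2 fun h0 => hp ?_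
    rw [hinj x hx p h0]
    exact Metric.mem_ball_self he₀
  obtain ⟨δ, hδ, hδT⟩ := (hK.prod hshell).exists_forall_le' hT.norm.continuousOn hpos
  refine ⟨δ, hδ, fun x hx p => ?_⟩
  rcases eq_or_ne p 0 with rfl | hp
  · simp
  obtain ⟨d, hd, hdp, hdp', -⟩ := rescale_to_shell he one_pos hp
  have key : δ ≤ ‖d‖ * ‖T x p‖ := by
    simpa [norm_smul] using hδT (x, d • p) ⟨hx, by simpa using hdp.le, by simpa using hdp'⟩
  rw [norm_smul] at hdp
  have hd' : 0 < ‖d‖ := norm_pos_iff.2 hd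
  refine le_of_mul_le_mul_left ?_ hd'
  calc ‖d‖ * (δ * ‖p‖) = δ * (‖d‖ * ‖p‖) := by ring
    _ ≤ δ * 1 := by gcongr
    _ ≤ ‖d‖ * ‖T x p‖ := by rwa [mul_one]

theorem exists_lt_norm_le_mul {F : Type*} [NormedField F] {e : F} (he : 1 < ‖e‖) {r : ℝ}
    (hr : 0 < r) : ∃ d : F, r < ‖d‖ ∧ ‖d‖ ≤ ‖e‖ * r := by
  obtain ⟨n, hn, hn'⟩ := exists_mem_Ico_zpow hr he
  refine ⟨e ^ (n + 1), by rwa [norm_zpow], ?_⟩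
  rw [norm_zpow, zpow_add_one₀ (by positivity), mul_comm]
  gcongr

section Gradient

variable {F : Type*} [NontriviallyNormedField F] {V : Type*} [AddCommGroup V] [Module F V]
  [FiniteDimensional F V] [TopologicalSpace V] [IsTopologicalAddGroup V] [ContinuousSMul F V]
  {Q : QuadraticForm F V} {E : Type*} [NormedAddCommGroup E] [NormedSpace F E]

variable (Q) in
/-- The coordinates `⟨β(p) v + u(p), eᵢ⟩` of the gradient at `v` of the phase
`β(p) Q(v) + ⟨u(p), v⟩`, as a linear function of the parameter `p`. -/
noncomputable def gradient (β : E →L[F] F) (u : E →L[F] V) (v : V) :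
    E →ₗ[F] (Fin (Module.finrank F V) → F) :=
  LinearMap.pi fun i => Q.polarBilin.flip (Module.finBasis F V i) ∘ₗ (β.smulRight v + u).toLinearMap

theorem gradient_apply (β : E →L[F] F) (u : E →L[F] V) (v : V) (p : E)
    (i : Fin (Module.finrank F V)) : gradient Q β u v p i =
      QuadraticMap.polar Q (β p • v + u p) (Module.finBasis F V i) := rfl

theorem gradient_eq_zero_iff (hQ : Q.polarBilin.Nondegenerate) {β : E →L[F] F} {u : E →L[F] V}
    {v : V} {p : E} : gradient Q β u v p = 0 ↔ β p • v + u p = 0 := by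
  refine ⟨fun h => hQ.1 _ fun y => ?_, fun h => ?_⟩
  · have : Q.polarBilin (β p • v + u p) = 0 := (Module.finBasis F V).ext fun i => congrFun h i
    rw [this, LinearMap.zero_apply]
  · ext i
    rw [gradient_apply, h, QuadraticMap.polar_zero_left, Pi.zero_apply]

end Gradient

section StationaryPhase

variable {F : Type*} [NontriviallyNormedField F] [ProperSpace F] [IsUltrametricDist F]
  {ψ : AddChar F Circle} {V : Type*} [AddCommGroup V] [Module F V] [FiniteDimensional F V]
  [TopologicalSpace V] [IsTopologicalAddGroup V] [ContinuousSMul F V] [T2Space V]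
  [MeasurableSpace V] [BorelSpace V] (μ : Measure V) [μ.IsAddHaarMeasure] {Q : QuadraticForm F V}

/-- At `v` the phase `b Q(v) + ⟨u, v⟩` has gradient `b v + u`, up to the quadratic error `b Q(l)`
which is invisible to `ψ` on a small lattice `L`. -/
theorem setIntegral_phase_eq_zero (h2 : (2 : F) ≠ 0) (hψ : Continuous ψ) {L : AddSubgroup V}
    (hL : IsCompact (L : Set V)) (hL' : IsOpen (L : Set V)) {K : Set V} (hK : IsCompact K)
    (hK' : IsOpen K) (hKL : ∀ v ∈ K, ∀ l ∈ L, v + l ∈ K) {b : F} {u : V}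
    (hb : ∀ l ∈ L, ψ (b * Q l) = 1)
    (hgrad : ∀ v ∈ K, ∃ l ∈ L, ψ (QuadraticMap.polar Q (b • v + u) l) ≠ 1) :
    ∫ v in K, (ψ (b * Q v + QuadraticMap.polar Q u v) : ℂ) ∂μ = 0 := by
  have := secondCountable_module F V
  have := prespectralSpace_module F V
  let phase (v : V) : ℂ := ψ (b * Q v + QuadraticMap.polar Q u v)
  have hphase : Continuous phase := continuous_coe_comp hψ
    ((continuous_const.mul (continuous_quadraticForm h2 Q)).add (continuous_polar Q u))
  have taylor (v : V) {l : V} (hl : l ∈ L) :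
      phase (v + l) = phase v * (ψ (QuadraticMap.polar Q (b • v + u) l) : ℂ) := by
    have expand : b * Q (v + l) + QuadraticMap.polar Q u (v + l) = b * Q l +
        (b * Q v + QuadraticMap.polar Q u v + QuadraticMap.polar Q (b • v + u) l) := by
      rw [QuadraticMap.polar_add_right, QuadraticMap.polar_add_left,
        QuadraticMap.polar_smul_left, QuadraticMap.map_add (f := Q), smul_eq_mul]
      ring
    simp only [phase]
    rw [expand, AddChar.map_add_eq_mul, AddChar.map_add_eq_mul, hb l hl, one_mul, Circle.coe_mul]
  rw [← integral_indicator hK'.measurableSet]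
  refine integral_eq_zero_of_setIntegral_add_eq_zero (L := L)
    ((integrable_indicator_iff hK'.measurableSet).2 (hphase.continuousOn.integrableOn_compact hK))
    (hL'.measure_pos μ ⟨0, L.zero_mem⟩).ne' hL.measure_lt_top.ne fun v => ?_
  by_cases hv : v ∈ K
  · obtain ⟨l, hl, hl'⟩ := hgrad v hv
    have indicator_eq : ∀ l ∈ (L : Set V), K.indicator phase (v + l) =
        phase v * (ψ (QuadraticMap.polar Q (b • v + u) l) : ℂ) := fun l hl => by
      rw [Set.indicator_of_mem (hKL v hv l hl), taylor v hl]
    rw [setIntegral_congr_fun hL'.measurableSet indicator_eq, integral_const_mul,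
      integral_character_eq_zero μ hL'.measurableSet (fun x _ y _ => by
        rw [QuadraticMap.polar_add_right, AddChar.map_add_eq_mul, Circle.coe_mul]) hl
      (by rwa [← Circle.coe_one, Ne, Circle.coe_inj]), mul_zero]
  · refine setIntegral_eq_zero_of_forall_eq_zero fun l hl => Set.indicator_of_notMem (fun h => ?_) _
    exact hv (by simpa using hKL _ h (-l) (L.neg_mem hl))

variable {E : Type*} [NormedAddCommGroup E] [NormedSpace F E]

theorem exists_setIntegral_phase_eq_zero [ProperSpace E] (h2 : (2 : F) ≠ 0)
    (hcond : HasConductorIntegers ψ) (hQ : Q.polarBilin.Nondegenerate) {K₀ : Set V}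
    (hK₀ : IsCompact K₀) (β : E →L[F] F) (u : E →L[F] V)
    (hcrit : ∀ v ∈ K₀, ∀ p, β p • v + u p = 0 → p = 0) :
    ∃ R : ℝ, ∀ c : F, ‖c‖ ≤ 1 → ∀ K ⊆ K₀, IsCompact K → IsOpen K →
      (∀ v ∈ K, ∀ l ∈ lattice V c, v + l ∈ K) → ∀ p, R < ‖p‖ * ‖c‖ →
      ∫ v in K, (ψ (β p * Q v + QuadraticMap.polar Q (u p) v) : ℂ) ∂μ = 0 := by
  obtain ⟨C, hC, hCQ⟩ := exists_norm_quadraticForm_le (V := V) h2 Q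
  have hgrad_cont : Continuous fun q : V × E => gradient Q β u q.1 q.2 :=
    continuous_pi fun i => continuous_polar_comp h2 Q
      (((β.continuous.comp continuous_snd).smul continuous_fst).add
        (u.continuous.comp continuous_snd)) continuous_const
  obtain ⟨δ, hδ, hgrad⟩ := exists_pos_mul_norm_le hK₀ (gradient Q β u) hgrad_cont
    fun v hv p hp => hcrit v hv p ((gradient_eq_zero_iff hQ).1 hp)
  obtain ⟨e, he⟩ := NormedField.exists_one_lt_norm F
  refine ⟨max (‖e‖ / δ) (‖β‖ * C * ‖e‖ ^ 2 / δ ^ 2), fun c hc K hKK₀ hK hK' hKc p hp => ?_⟩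
  obtain ⟨hp₁, hp₂⟩ := max_lt_iff.1 hp
  rw [div_lt_iff₀ (by positivity)] at hp₁ hp₂
  have hcp : ‖p‖ * ‖c‖ ≤ ‖p‖ := mul_le_of_le_one_right (norm_nonneg p) hc
  have hp₀ : 0 < ‖p‖ := lt_of_not_ge fun h => by nlinarith [norm_nonneg c]
  -- The integral is split into cosets of the smallest lattice that still detects the gradient.
  obtain ⟨d, hd, hd'⟩ := exists_lt_norm_le_mul he (r := (δ * ‖p‖)⁻¹) (by positivity)
  rw [inv_lt_iff_one_lt_mul₀ (by positivity)] at hd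
  rw [← div_eq_mul_inv, le_div_iff₀ (by positivity)] at hd'
  have hdc : ‖d‖ ≤ ‖c‖ := by
    refine le_of_mul_le_mul_right ?_ (show 0 < δ * ‖p‖ by positivity)
    linarith
  have hquad : ‖β p‖ * (C * ‖d‖ ^ 2) ≤ 1 := by
    refine le_of_mul_le_mul_right ?_ (show 0 < δ ^ 2 * ‖p‖ by positivity)
    calc ‖β p‖ * (C * ‖d‖ ^ 2) * (δ ^ 2 * ‖p‖)
        ≤ ‖β‖ * ‖p‖ * (C * ‖d‖ ^ 2) * (δ ^ 2 * ‖p‖) := by gcongr; exact β.le_opNorm p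
      _ = ‖β‖ * C * (‖d‖ * (δ * ‖p‖)) ^ 2 := by ring
      _ ≤ ‖β‖ * C * ‖e‖ ^ 2 := by gcongr
      _ ≤ 1 * (δ ^ 2 * ‖p‖) := by nlinarith [sq_nonneg δ]
  have hd₀ : d ≠ 0 := by rintro rfl; simp at hd; linarith
  refine setIntegral_phase_eq_zero μ h2 hcond.continuous (isCompact_lattice d)
    (isClopen_lattice hd₀).isOpen hK hK' (fun v hv l hl => hKc v hv l (hl.trans hdc))
    (fun l hl => hcond.eq_one ?_) fun v hv => exists_mem_lattice_ne_one hcond ?_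
  · rw [norm_mul]
    exact (mul_le_mul_of_nonneg_left (hCQ d l hl) (norm_nonneg _)).trans hquad
  · calc 1 < δ * ‖p‖ * ‖d‖ := by linarith
      _ ≤ ‖gradient Q β u v p‖ * ‖d‖ := by gcongr; exact hgrad v (hKK₀ hv) p

end StationaryPhase

/-! ### Scaling and isometries -/

section Scaling

open scoped Pointwise

variable {F : Type*} [NontriviallyNormedField F] [ProperSpace F] [IsUltrametricDist F]
  {V : Type*} [AddCommGroup V] [Module F V] [FiniteDimensional F V] [TopologicalSpace V]
  [IsTopologicalAddGroup V] [ContinuousSMul F V] [T2Space V]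

theorem smul_lattice_one (a : Fˣ) : a • (lattice V (1 : F) : Set V) = lattice V (a : F) := by
  ext v
  rw [Set.mem_smul_set_iff_inv_smul_mem, SetLike.mem_coe, SetLike.mem_coe, mem_lattice, mem_lattice,
    Units.smul_def, map_smul, norm_smul, Units.val_inv_eq_inv_val, norm_inv, norm_one,
    inv_mul_le_one₀ (norm_pos_iff.2 a.ne_zero)]

variable [LocallyCompactSpace V]

theorem distribHaarChar_eq_pow (a : Fˣ) :
    distribHaarChar V a = distribHaarChar F a ^ Module.finrank F V := by
  borelize F V
  have := secondCountable_module F V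
  let ν : Measure V :=
    (Measure.pi fun _ : Fin (Module.finrank F V) => Measure.addHaar).map (coordL F V).symm
  have : ν.IsAddHaarMeasure := (coordL F V).symm.isAddHaarMeasure_map _
  have measure_lattice (c : F) : ν (lattice V c) =
      (Measure.addHaar (Metric.closedBall (0 : F) ‖c‖)) ^ Module.finrank F V := by
    have preimage_lattice : (coordL F V).symm ⁻¹' (lattice V c) = Metric.closedBall 0 ‖c‖ := by
      ext x; simp [mem_lattice]
    rw [Measure.map_apply (coordL F V).symm.continuous.measurable
      (isCompact_lattice c).measurableSet, preimage_lattice,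
      Measure.pi_closedBall _ _ (norm_nonneg c)]
    simp
  refine distribHaarChar_eq_of_measure_smul_eq_mul (μ := ν) (s := lattice V (1 : F)) ?_ ?_ ?_
  · exact ((isClopen_lattice one_ne_zero).isOpen.measure_pos ν ⟨0, (lattice V 1).zero_mem⟩).ne'
  · exact (isCompact_lattice 1).measure_lt_top.ne
  · rw [smul_lattice_one, measure_lattice, measure_lattice, ← smul_unitClosedBall, ← Units.smul_def,
      ← distribHaarChar_mul, mul_pow, ENNReal.coe_pow, norm_one]

variable [MeasurableSpace V] [BorelSpace V] (μ : Measure V) [μ.IsAddHaarMeasure]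

theorem measure_smul_units (a : Fˣ) (s : Set V) :
    μ (a • s) = ENNReal.ofReal (absF (a : F) ^ Module.finrank F V) * μ s := by
  have := secondCountable_module F V
  rw [← distribHaarChar_mul, distribHaarChar_eq_pow, absF_units, ← NNReal.coe_pow,
    ENNReal.ofReal_coe_nnreal]

theorem real_lattice {c : F} (hc : c ≠ 0) : μ.real (lattice V c) =
    absF c ^ Module.finrank F V * μ.real (lattice V (1 : F)) := by
  lift c to Fˣ using hc.isUnit
  rw [measureReal_def, ← smul_lattice_one, measure_smul_units, ENNReal.toReal_mul,
    ENNReal.toReal_ofReal (pow_nonneg (absF_pos hc).le _), measureReal_def]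

theorem integral_comp_smul {a : F} (ha : a ≠ 0) (f : V → ℂ) : ∫ v, f (a • v) ∂μ =
    (((absF a ^ Module.finrank F V)⁻¹ : ℝ) : ℂ) * ∫ v, f v ∂μ := by
  lift a to Fˣ using ha.isUnit
  have map_smul : μ.map ((a : F) • ·) =
      ENNReal.ofReal (absF (a : F) ^ Module.finrank F V)⁻¹ • μ := by
    ext s hs
    have preimage_smul : (fun v => (a : F) • v) ⁻¹' s = a⁻¹ • s := Set.preimage_smul a s
    rw [Measure.map_apply (continuous_const_smul _).measurable hs, preimage_smul,
      measure_smul_units, Units.val_inv_eq_inv_val, absF_inv, inv_pow]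
    rfl
  calc ∫ v, f ((a : F) • v) ∂μ = ∫ v, f v ∂(μ.map ((a : F) • ·)) :=
        ((Homeomorph.smulOfNeZero (a : F) ha).measurableEmbedding.integral_map f).symm
    _ = _ := by
      rw [map_smul, integral_smul_measure, ENNReal.toReal_ofReal
        (inv_nonneg.2 (pow_nonneg (absF_pos ha).le _)), Complex.real_smul]

end Scaling

section Isometry

variable {F G : Type*} [Field F] {ψ : AddChar F Circle} [AddCommGroup G] [TopologicalSpace G]
  [IsTopologicalAddGroup G] [T2Space G] [PrespectralSpace G] [SecondCountableTopology G]
  [MeasurableSpace G] [BorelSpace G] {μ : Measure G} [μ.IsAddHaarMeasure] {B : G → G → F}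

theorem measurePreserving_of_isSelfDual (hμ : IsSelfDual ψ B μ) (e : G ≃ₜ+ G)
    (he : ∀ x y, B (e x) (e y) = B x y) : MeasurePreserving e μ μ := by
  let c : NNReal := addEquivAddHaarChar e
  have smul_map : c • μ.map e = μ := addEquivAddHaarChar_smul_map μ e
  have integral_comp (f : G → ℂ) : (c : ℂ) * ∫ x, f (e x) ∂μ = ∫ x, f x ∂μ := by
    have integral_map : ∫ x, f x ∂(μ.map e) = ∫ x, f (e x) ∂μ :=
      e.toHomeomorph.measurableEmbedding.integral_map f
    conv_rhs => rw [← smul_map, integral_smul_nnreal_measure, integral_map]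
    rfl
  have fourier_comp (f : G → ℂ) (x : G) :
      (c : ℂ) * fourier ψ B μ (f ∘ e) x = fourier ψ B μ f (e x) := by
    rw [fourier, fourier, ← integral_comp fun y => f y * (ψ (B (e x) y) : ℂ)]
    simp only [Function.comp_apply, he]
  obtain ⟨K, hK, hK', h0K, -⟩ := PrespectralSpace.exists_isCompact_and_isOpen_between
    (isCompact_singleton (x := (0 : G))) isOpen_univ (Set.subset_univ _)
  let f : G → ℂ := K.indicator fun _ => 1
  have hf : f ∈ SchwartzBruhat G := SchwartzBruhat.indicator_mem hK hK'
  have f_zero : f 0 = 1 := Set.indicator_of_mem (h0K rfl) _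
  have inversion := hμ f hf 0
  have inversion_comp := hμ (f ∘ e)
    (SchwartzBruhat.comp_isClosedEmbedding hf e.toHomeomorph.isClosedEmbedding) 0
  have c_sq : (c : ℂ) ^ 2 = 1 := by
    calc (c : ℂ) ^ 2 = c * (c * fourier ψ B μ (fourier ψ B μ (f ∘ e)) 0) := by
          rw [inversion_comp, neg_zero, Function.comp_apply, map_zero, f_zero]; ring
      _ = c * fourier ψ B μ (fourier ψ B μ f ∘ e) 0 := by
          rw [fourier, fourier, ← integral_const_mul]
          simp only [Function.comp_apply, ← fourier_comp, mul_assoc]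
      _ = 1 := by rw [fourier_comp, map_zero, inversion, neg_zero, f_zero]
  have c_eq : c = 1 := by
    have c_sq' : c ^ 2 = 1 := by exact_mod_cast c_sq
    simpa using c_sq'
  exact ⟨e.continuous.measurable, by rwa [c_eq, one_smul] at smul_map⟩

theorem fourier_comp (hμ : IsSelfDual ψ B μ) (e : G ≃ₜ+ G)
    (he : ∀ x y, B (e x) (e y) = B x y) (f : G → ℂ) :
    fourier ψ B μ (f ∘ e) = fourier ψ B μ f ∘ e := by
  funext x
  simpa only [Function.comp_apply, fourier, he] using
    (measurePreserving_of_isSelfDual hμ e he).integral_comp e.toHomeomorph.measurableEmbedding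
      fun y => f y * (ψ (B (e x) y) : ℂ)

end Isometry

/-! ### The transfer map -/

theorem exists_linearMap_comp_eq {R M N L : Type*} [Ring R] [AddCommGroup M] [AddCommGroup N]
    [AddCommGroup L] [Module R M] [Module R N] [Module R L] {p : M →ₗ[R] N}
    (hp : Function.Surjective p) (T : M →ₗ[R] L) (h : LinearMap.ker p ≤ LinearMap.ker T) :
    ∃ J : N →ₗ[R] L, ∀ x, J (p x) = T x := by
  let e := p.quotKerEquivOfSurjective hp
  refine ⟨Submodule.liftQ _ T h ∘ₗ e.symm.toLinearMap, fun x => ?_⟩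
  have e_symm : e.symm (p x) = Submodule.Quotient.mk x := by
    rw [LinearEquiv.symm_apply_eq]; rfl
  rw [LinearMap.comp_apply, LinearEquiv.coe_coe, e_symm, Submodule.liftQ_apply]

theorem SchwartzBruhat.map_eq_zero_of_locally {X E : Type*} [TopologicalSpace X] [AddCommGroup E]
    [Module ℂ E] (T : SchwartzBruhat X →ₗ[ℂ] E) {f : SchwartzBruhat X}
    (hT : ∀ x ∈ Function.support f.1, ∃ K : Set X, IsClopen K ∧ x ∈ K ∧
      ∀ g : SchwartzBruhat X, Function.support g.1 ⊆ K → T g = 0) : T f = 0 := by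
  suffices h : ∃ K : Set X, IsClopen K ∧ Function.support f.1 ⊆ K ∧
      ∀ g : SchwartzBruhat X, Function.support g.1 ⊆ K → T g = 0 by
    obtain ⟨K, -, hfK, hK⟩ := h
    exact hK f hfK
  refine (isCompact_support f.2).induction_on (p := fun s => ∃ K : Set X, IsClopen K ∧ s ⊆ K ∧
      ∀ g : SchwartzBruhat X, Function.support g.1 ⊆ K → T g = 0) ?_ ?_ ?_ ?_
  · refine ⟨∅, isClopen_empty, le_rfl, fun g hg => ?_⟩
    have g_zero : g = 0 := Subtype.ext (Function.support_eq_empty_iff.1 (Set.subset_empty_iff.1 hg))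
    rw [g_zero, map_zero]
  · rintro s t hst ⟨K, hK, htK, hTK⟩
    exact ⟨K, hK, hst.trans htK, hTK⟩
  · rintro s t ⟨K, hK, hsK, hTK⟩ ⟨L, hL, htL, hTL⟩
    refine ⟨K ∪ L, hK.union hL, Set.union_subset_union hsK htL, fun g hg => ?_⟩
    let g₁ : SchwartzBruhat X := ⟨_, indicator_mem_of_mem hK g.2⟩
    let g₂ : SchwartzBruhat X := ⟨_, indicator_mem_of_mem hK.compl g.2⟩
    have g_eq : g = g₁ + g₂ := Subtype.ext (Set.indicator_self_add_compl K g.1).symm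
    have support_g₁ : Function.support g₁.1 ⊆ K := Set.support_indicator_subset
    have support_g₂ : Function.support g₂.1 ⊆ L := fun x hx => by
      have hx' := Set.support_indicator.subset hx
      exact (hg hx'.2).resolve_left hx'.1
    rw [g_eq, map_add, hTK g₁ support_g₁, hTL g₂ support_g₂, add_zero]
  · intro x hx
    obtain ⟨K, hK, hxK, hTK⟩ := hT x hx
    exact ⟨K, mem_nhdsWithin_of_mem_nhds (hK.isOpen.mem_nhds hxK), K, hK, le_rfl, hTK⟩

section TransferMap

variable {F : Type*} [NontriviallyNormedField F]
  {V : Type*} [AddCommGroup V] [Module F V] {ψ : AddChar F Circle} {Q : QuadraticForm F V}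

theorem HasConductorIntegers.exists_apply_mul_ne (hcond : HasConductorIntegers ψ) {x y : F}
    (hxy : x ≠ y) : ∃ b, ψ (b * x) ≠ ψ (b * y) := by
  obtain ⟨a, ha⟩ := NormedField.exists_lt_norm F ‖x - y‖⁻¹
  have one_lt : 1 < ‖a * (x - y)‖ := by
    rwa [norm_mul, ← inv_lt_iff_one_lt_mul₀ (norm_pos_iff.2 (sub_ne_zero.2 hxy))]
  obtain ⟨z, -, hz⟩ := hcond.exists_ne_one one_lt
  refine ⟨a * z, fun h => hz ?_⟩
  rw [show a * (x - y) * z = a * z * x - a * z * y by ring, AddChar.map_sub_eq_div, h, div_self']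

theorem weilN_weilN (b c : F) (Φ : V → ℂ) :
    weilN ψ Q b (weilN ψ Q c Φ) = weilN ψ Q (b + c) Φ := by
  funext v
  rw [weilN, weilN, weilN, add_mul, AddChar.map_add_eq_mul, Circle.coe_mul, mul_assoc]

variable [ProperSpace F] [FiniteDimensional F V] [TopologicalSpace V]

theorem mkQ_eq_smul_of_translate [MeasurableSpace V] {μ : Measure V} {v₁ : V} {b : F}
    {f f' : whittakerSpace ψ Q μ v₁} (h : ∀ g, f'.1 g = f.1 (g * nMat b)) :
    (relN ψ Q μ v₁).mkQ f' = (ψ b : ℂ) • (relN ψ Q μ v₁).mkQ f := by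
  rw [← sub_eq_zero, ← map_smul, ← map_sub, Submodule.mkQ_apply, Submodule.Quotient.mk_eq_zero]
  exact Submodule.subset_span ⟨b, f, fun g => by rw [← h g]; rfl⟩

theorem weil_weilN [MeasurableSpace V] (μ : Measure V) (g : SL(2, F)) (b : F) (Φ : V → ℂ) :
    weil ψ Q μ g (weilN ψ Q b Φ) = weil ψ Q μ (g * nMat b) Φ := by
  have mul_nMat (i : Fin 2) : (g * nMat b) i 0 = g i 0 ∧ (g * nMat b) i 1 = g i 0 * b + g i 1 := by
    rw [Matrix.SpecialLinearGroup.coe_mul, Matrix.mul_apply, Matrix.mul_apply, Fin.sum_univ_two]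
    simp [nMat]
  have det_eq := g.det_coe
  rw [Matrix.det_fin_two] at det_eq
  unfold weil
  rw [(mul_nMat 0).1, (mul_nMat 0).2, (mul_nMat 1).1, (mul_nMat 1).2]
  split_ifs with h
  · have h0 : g 0 0 ≠ 0 := fun h0 => by simp [h, h0] at det_eq
    rw [weilN_weilN, add_div, mul_div_cancel_left₀ _ h0, add_comm]
  · rw [weilN_weilN, add_div, mul_div_cancel_left₀ _ h, add_comm]

variable [IsTopologicalAddGroup V] [ContinuousSMul F V] [T2Space V]

theorem weilN_mem (h2 : (2 : F) ≠ 0) (hcond : HasConductorIntegers ψ)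
    (b : F) {Φ : V → ℂ} (hΦ : Φ ∈ SchwartzBruhat V) : weilN ψ Q b Φ ∈ SchwartzBruhat V := by
  borelize V
  have weilN_eq : weilN ψ Q b Φ = fun v => Φ v * (ψ (b * Q v) : ℂ) :=
    funext fun v => mul_comm _ _
  exact weilN_eq ▸ SchwartzBruhat.mul_character_mem hcond (continuous_quadraticForm h2 Q) hΦ b

theorem isClosed_hyperboloid (h2 : (2 : F) ≠ 0) (Q : QuadraticForm F V) (a : F) :
    IsClosed {v | Q v = a} := by
  borelize V
  exact isClosed_eq (continuous_quadraticForm h2 Q) continuous_const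

/-- Restriction `S(V) → S(X_a)`. -/
def resX (h2 : (2 : F) ≠ 0) (Q : QuadraticForm F V) (a : F) :
    SchwartzBruhat V →ₗ[ℂ] SchwartzBruhat (Hyperboloid Q a) where
  toFun Φ := ⟨fun x => Φ.1 x.1, SchwartzBruhat.comp_subtype Φ.2 (isClosed_hyperboloid h2 Q a)⟩
  map_add' _ _ := rfl
  map_smul' _ _ := rfl

/-- The map which sends `Φ` to the class of `Φ|_{X₁}` in `I(X₁)`. -/
def resClass (h2 : (2 : F) ≠ 0) (Q : QuadraticForm F V) (v₁ : V) :
    SchwartzBruhat V →ₗ[ℂ] OrbitalX Q v₁ :=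
  (relX Q v₁).mkQ ∘ₗ resX h2 Q 1

theorem resX_surjective [IsUltrametricDist F] (h2 : (2 : F) ≠ 0) (Q : QuadraticForm F V) (a : F) :
    Function.Surjective (resX h2 Q a) := by
  have := prespectralSpace_module F V
  rintro ⟨φ, hφ⟩
  obtain ⟨Φ, hΦ, h⟩ := SchwartzBruhat.exists_extension hφ
  exact ⟨⟨Φ, hΦ⟩, Subtype.ext (funext h)⟩

theorem resClass_surjective [IsUltrametricDist F] (h2 : (2 : F) ≠ 0) (Q : QuadraticForm F V)
    (v₁ : V) : Function.Surjective (resClass h2 Q v₁) :=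
  (Submodule.mkQ_surjective _).comp (resX_surjective h2 Q 1)

/-- An isometry of `Q` as an automorphism of the topological group `V`. -/
noncomputable def isometryEquiv (h : Q.IsometryEquiv Q) : V ≃ₜ+ V :=
  h.toLinearEquiv.toContinuousLinearEquiv.toContinuousAddEquiv

theorem polar_isometryEquiv (h : Q.IsometryEquiv Q) (x y : V) :
    QuadraticMap.polar Q (isometryEquiv h x) (isometryEquiv h y) = QuadraticMap.polar Q x y := by
  have map_eq (z : V) : Q (isometryEquiv h z) = Q z := h.map_app z
  rw [QuadraticMap.polar, ← map_add, map_eq, map_eq, map_eq, QuadraticMap.polar]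

variable [MeasurableSpace V] [BorelSpace V] (μ : Measure V) [μ.IsAddHaarMeasure]

theorem weil_comp_isometry [IsUltrametricDist F] (hμ : IsSelfDual ψ (QuadraticMap.polar Q) μ)
    (h : Q.IsometryEquiv Q) (g : SL(2, F)) (Φ : V → ℂ) :
    weil ψ Q μ g (Φ ∘ isometryEquiv h) = weil ψ Q μ g Φ ∘ isometryEquiv h := by
  have := prespectralSpace_module F V
  have := secondCountable_module F V
  have weilN_comp (b : F) (f : V → ℂ) :
      weilN ψ Q b (f ∘ isometryEquiv h) = weilN ψ Q b f ∘ isometryEquiv h :=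
    funext fun v => by
      have map_eq : Q (isometryEquiv h v) = Q v := h.map_app v
      simp only [weilN, Function.comp_apply, map_eq]
  have weilT_comp (a : F) (f : V → ℂ) :
      weilT Q a (f ∘ isometryEquiv h) = weilT Q a f ∘ isometryEquiv h :=
    funext fun v => by
      have map_smul : isometryEquiv h (a • v) = a • isometryEquiv h v :=
        h.toLinearEquiv.map_smul a v
      simp only [weilT, Function.comp_apply, map_smul]
  have weilW_comp (f : V → ℂ) :
      weilW ψ Q μ (f ∘ isometryEquiv h) = weilW ψ Q μ f ∘ isometryEquiv h :=
    funext fun v => by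
      simp only [weilW, Function.comp_apply, fourier_comp hμ _ (polar_isometryEquiv h)]
  unfold weil
  split_ifs <;> simp only [weilN_comp, weilT_comp, weilW_comp]

/-- The map `p` as a linear map onto `S(N, ψ \ SL₂)`. -/
noncomputable def pLinear (h2 : (2 : F) ≠ 0) (hψ : Continuous ψ) (Q : QuadraticForm F V)
    (μ : Measure V) [IsFiniteMeasureOnCompacts μ] (v₁ : V) :
    SchwartzBruhat V →ₗ[ℂ] whittakerSpace ψ Q μ v₁ where
  toFun Φ := ⟨pMap ψ Q μ v₁ Φ.1, Submodule.subset_span ⟨Φ.1, Φ.2, rfl⟩⟩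
  map_add' Φ Φ' := Subtype.ext (funext fun g => weil_add h2 hψ Q μ Φ.2 Φ'.2 g v₁)
  map_smul' c Φ := Subtype.ext (funext fun g => weil_smul ψ Q μ c Φ.1 g v₁)

theorem pLinear_surjective (h2 : (2 : F) ≠ 0) (hψ : Continuous ψ) (Q : QuadraticForm F V)
    (μ : Measure V) [IsFiniteMeasureOnCompacts μ] (v₁ : V) :
    Function.Surjective (pLinear h2 hψ Q μ v₁) := by
  rintro ⟨f, hf⟩
  obtain ⟨Φ, hΦ, rfl⟩ := (mem_whittakerSpace_iff h2 hψ Q μ v₁ f).1 hf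
  exact ⟨⟨Φ, hΦ⟩, rfl⟩

/-- The map which sends `Φ` to the class of `p(Φ)` in `I(N, ψ \ SL₂)`. -/
noncomputable def pClass (h2 : (2 : F) ≠ 0) (hψ : Continuous ψ) (Q : QuadraticForm F V)
    (μ : Measure V) [IsFiniteMeasureOnCompacts μ] (v₁ : V) :
    SchwartzBruhat V →ₗ[ℂ] OrbitalN ψ Q μ v₁ :=
  (relN ψ Q μ v₁).mkQ ∘ₗ pLinear h2 hψ Q μ v₁

theorem isTransferMap_iff (h2 : (2 : F) ≠ 0) (hψ : Continuous ψ) {v₁ : V}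
    {t : OrbitalX Q v₁ →ₗ[ℂ] OrbitalN ψ Q μ v₁} :
    IsTransferMap ψ Q μ v₁ t ↔ ∀ Φ, t (resClass h2 Q v₁ Φ) = pClass h2 hψ Q μ v₁ Φ := by
  constructor
  · intro h Φ
    exact h (pLinear h2 hψ Q μ v₁ Φ) (resX h2 Q 1 Φ) ⟨Φ.1, Φ.2, rfl, fun _ => rfl⟩
  · rintro h f φ ⟨Φ, hΦ, hf, hφ⟩
    obtain rfl : pLinear h2 hψ Q μ v₁ ⟨Φ, hΦ⟩ = f := Subtype.ext hf
    obtain rfl : resX h2 Q 1 ⟨Φ, hΦ⟩ = φ := Subtype.ext (funext hφ)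
    exact h ⟨Φ, hΦ⟩

theorem pClass_weilN (h2 : (2 : F) ≠ 0) (hcond : HasConductorIntegers ψ) (v₁ : V) (b : F)
    (Φ : SchwartzBruhat V) :
    pClass h2 hcond.continuous Q μ v₁ ⟨weilN ψ Q b Φ.1, weilN_mem h2 hcond b Φ.2⟩ =
      (ψ b : ℂ) • pClass h2 hcond.continuous Q μ v₁ Φ :=
  mkQ_eq_smul_of_translate fun g => congr_fun (weil_weilN μ g b Φ.1) v₁

theorem pClass_eq_zero_of_vanish (h2 : (2 : F) ≠ 0) (hcond : HasConductorIntegers ψ) (v₁ : V)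
    {Φ : SchwartzBruhat V} (hΦ : ∀ v, Q v = 1 → Φ.1 v = 0) :
    pClass h2 hcond.continuous Q μ v₁ Φ = 0 := by
  refine SchwartzBruhat.map_eq_zero_of_locally _ fun v hv => ?_
  have ne_one : Q v ≠ 1 := fun h => hv (hΦ v h)
  obtain ⟨b, hb⟩ := hcond.exists_apply_mul_ne ne_one
  rw [mul_one] at hb
  have locallyConstant : IsLocallyConstant fun u => ψ (b * Q u) :=
    hcond.isLocallyConstant.comp_continuous
      (continuous_const.mul (continuous_quadraticForm h2 Q))
  refine ⟨_, locallyConstant.isClopen_fiber (ψ (b * Q v)), rfl, fun Ψ hΨ => ?_⟩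
  have weilN_eq : (⟨weilN ψ Q b Ψ.1, weilN_mem h2 hcond b Ψ.2⟩ : SchwartzBruhat V) =
      (ψ (b * Q v) : ℂ) • Ψ := by
    refine Subtype.ext (funext fun u => ?_)
    by_cases hu : Ψ.1 u = 0
    · simp [weilN, hu]
    · have apply_eq : ψ (b * Q u) = ψ (b * Q v) := hΨ hu
      simp [weilN, apply_eq]
  have smul_eq := pClass_weilN (Q := Q) μ h2 hcond v₁ b Ψ
  rw [weilN_eq, map_smul, ← sub_eq_zero, ← sub_smul] at smul_eq
  exact (smul_eq_zero.1 smul_eq).resolve_left (sub_ne_zero.2 fun h => hb (Circle.coe_inj.1 h))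

variable [IsUltrametricDist F]

theorem pLinear_comp_isometry (h2 : (2 : F) ≠ 0) (hψ : Continuous ψ)
    (hμ : IsSelfDual ψ (QuadraticMap.polar Q) μ) {v₁ : V} {h : Q.IsometryEquiv Q} (hh : h v₁ = v₁)
    (Φ : SchwartzBruhat V) :
    pLinear h2 hψ Q μ v₁ ⟨Φ.1 ∘ isometryEquiv h,
      SchwartzBruhat.comp_isClosedEmbedding Φ.2 (isometryEquiv h).toHomeomorph.isClosedEmbedding⟩ =
      pLinear h2 hψ Q μ v₁ Φ :=
  Subtype.ext <| funext fun g =>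
    (congr_fun (weil_comp_isometry μ hμ h g Φ.1) v₁).trans (congr_arg (weil ψ Q μ g Φ.1) hh)

theorem pClass_eq_zero_of_resX_mem (h2 : (2 : F) ≠ 0) (hcond : HasConductorIntegers ψ)
    (hμ : IsSelfDual ψ (QuadraticMap.polar Q) μ) (v₁ : V) {Φ : SchwartzBruhat V}
    (hΦ : resX h2 Q 1 Φ ∈ relX Q v₁) : pClass h2 hcond.continuous Q μ v₁ Φ = 0 := by
  have relX_le : relX Q v₁ ≤
      (LinearMap.ker (pClass h2 hcond.continuous Q μ v₁)).map (resX h2 Q 1) := by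
    refine Submodule.span_le.2 ?_
    rintro η ⟨h, hh, φ, hφ⟩
    obtain ⟨Φ, rfl⟩ := resX_surjective h2 Q 1 φ
    have symm_fix : h.symm v₁ = v₁ := h.toLinearEquiv.symm_apply_eq.2 hh.symm
    let Φ' : SchwartzBruhat V := ⟨Φ.1 ∘ isometryEquiv h.symm,
      SchwartzBruhat.comp_isClosedEmbedding Φ.2
        (isometryEquiv h.symm).toHomeomorph.isClosedEmbedding⟩
    refine ⟨Φ' - Φ, ?_, Subtype.ext (funext fun x => (hφ x).symm)⟩
    rw [SetLike.mem_coe, LinearMap.mem_ker, map_sub, pClass, LinearMap.comp_apply,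
      pLinear_comp_isometry μ h2 hcond.continuous hμ symm_fix, LinearMap.comp_apply, sub_self]
  obtain ⟨Ψ, hΨ, hres⟩ := relX_le hΦ
  have vanish : pClass h2 hcond.continuous Q μ v₁ (Φ - Ψ) = 0 :=
    pClass_eq_zero_of_vanish μ h2 hcond v₁ fun v hv =>
      sub_eq_zero.2 (congr_fun (congr_arg Subtype.val hres) ⟨v, hv⟩).symm
  rwa [map_sub, LinearMap.mem_ker.1 hΨ, sub_zero] at vanish

theorem existsUnique_transferMap (h2 : (2 : F) ≠ 0) (hcond : HasConductorIntegers ψ)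
    (hμ : IsSelfDual ψ (QuadraticMap.polar Q) μ) (v₁ : V) :
    ∃! t, IsTransferMap ψ Q μ v₁ t := by
  have ker_le : LinearMap.ker (resClass h2 Q v₁) ≤
      LinearMap.ker (pClass h2 hcond.continuous Q μ v₁) := fun Φ hΦ =>
    pClass_eq_zero_of_resX_mem μ h2 hcond hμ v₁ ((Submodule.Quotient.mk_eq_zero _).1 hΦ)
  obtain ⟨t, ht⟩ := exists_linearMap_comp_eq (resClass_surjective h2 Q v₁) _ ker_le
  refine ⟨t, (isTransferMap_iff μ h2 hcond.continuous).2 ht, fun t' ht' =>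
    LinearMap.ext fun x => ?_⟩
  obtain ⟨Φ, rfl⟩ := resClass_surjective h2 Q v₁ x
  rw [(isTransferMap_iff μ h2 hcond.continuous).1 ht' Φ, ht]

end TransferMap

/-! ### Fibre measures on quadrics -/

section DensityOfDecay

variable {F : Type*} [NontriviallyNormedField F] [ProperSpace F]
  [MeasurableSpace F] [BorelSpace F] {ψ : AddChar F Circle} {μF : Measure F} [μF.IsAddHaarMeasure]
  {X : Type*} [MeasurableSpace X] {μ : Measure X} {π : X → F} {K : Set X} {c₀ : F}

theorem HasFiberDensity.measure_inter_preimage_singleton {g : F → NNReal}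
    (hg : HasFiberDensity μF μ π K g) (y : F) : μ (K ∩ π ⁻¹' {y}) = 0 := by
  have tendsto_ball : Tendsto (fun c : F => g y * μF (Metric.closedBall 0 ‖c‖)) (𝓝[≠] 0)
      (𝓝 (g y * 0)) := by
    refine ENNReal.Tendsto.const_mul ?_ (.inr ENNReal.coe_ne_top)
    have ball_eq (c : F) : μF (Metric.closedBall 0 ‖c‖) =
        ENNReal.ofReal (absF c * μF.real (Metric.closedBall 0 1)) := by
      rw [← real_closedBall_norm μF c 0, ofReal_measureReal measure_closedBall_lt_top.ne]
    simp_rw [ball_eq]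
    simpa using ENNReal.tendsto_ofReal
      ((tendsto_absF_nhds_zero.mono_left nhdsWithin_le_nhds).mul_const _)
  rw [mul_zero] at tendsto_ball
  refine le_antisymm (ge_of_tendsto tendsto_ball ?_) zero_le
  filter_upwards [hg] with c hc
  rw [← hc y]
  exact measure_mono (Set.inter_subset_inter_right _ (Set.preimage_mono
    (Set.singleton_subset_iff.2 (Metric.mem_closedBall_self (norm_nonneg c)))))

variable [IsUltrametricDist F]

theorem exists_hasFiberDensity (hcond : HasConductorIntegers ψ) (hπ : Measurable π)
    (hK : μ K ≠ ⊤) (hc₀ : c₀ ≠ 0)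
    (hdecay : ∀ b, ‖c₀‖⁻¹ < ‖b‖ → ∫ x in K, (ψ (b * π x) : ℂ) ∂μ = 0) :
    ∃ g, HasFiberDensity μF μ π K g := by
  have := isFiniteMeasure_restrict.2 hK
  have hball {c : F} (hc : c ≠ 0) : 0 < μF.real (Metric.closedBall 0 ‖c‖) :=
    real_closedBall_pos μF (norm_pos_iff.2 hc) 0
  refine ⟨fun y => ((μ.restrict K).real (π ⁻¹' Metric.closedBall y ‖c₀‖) /
    μF.real (Metric.closedBall 0 ‖c₀‖)).toNNReal, ?_⟩
  filter_upwards [eventually_mem_nhdsWithin, nhdsWithin_le_nhds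
    (Metric.closedBall_mem_nhds (0 : F) (norm_pos_iff.2 hc₀))] with c hc hcc y
  have hscale := real_closedBall_mul_eq_of_fourier_eq_zero μF hcond (μ.restrict K) hπ hc₀ hdecay hc
    (mem_closedBall_zero_iff.1 hcc) y
  rw [Set.inter_comm, ← Measure.restrict_apply (hπ measurableSet_closedBall),
    ← ENNReal.toReal_eq_toReal_iff' (measure_ne_top _ _)
      (ENNReal.mul_ne_top ENNReal.coe_ne_top measure_closedBall_lt_top.ne), ENNReal.toReal_mul,
    ENNReal.coe_toReal, Real.coe_toNNReal _ (by positivity), ← measureReal_def, ← measureReal_def,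
    div_mul_eq_mul_div, eq_div_iff (hball hc₀).ne', hscale]

theorem IsFiberMeasure.real_preimage_le [TopologicalSpace X] [T2Space X] [BorelSpace X]
    [IsFiniteMeasureOnCompacts μ] {Y₀ : Set F} {ν : (y : F) → Measure {x : X // π x = y}}
    (hν : IsFiberMeasure μ μF π Y₀ ν) (hcond : HasConductorIntegers ψ) (hπ : Continuous π)
    (hY₀ : IsOpen Y₀) (hK : IsCompact K) (hK' : IsOpen K) (hc₀ : c₀ ≠ 0)
    (hdecay : ∀ b, ‖c₀‖⁻¹ < ‖b‖ → ∫ x in K, (ψ (b * π x) : ℂ) ∂μ = 0) {y : F} (hy : y ∈ Y₀) :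
    (ν y).real (Subtype.val ⁻¹' K) ≤ μ.real K / μF.real (Metric.closedBall 0 ‖c₀‖) := by
  have : IsFiniteMeasure (μ.restrict K) := isFiniteMeasure_restrict.2 hK.measure_lt_top.ne
  obtain ⟨c, ⟨hc, hcc⟩, hc0⟩ := (((hν.eventually_real_inter hπ hY₀ hK hK' hy).and
    (nhdsWithin_le_nhds (Metric.closedBall_mem_nhds (0 : F) (norm_pos_iff.2 hc₀)))).and
    self_mem_nhdsWithin).exists
  have hball := real_closedBall_pos μF (norm_pos_iff.2 hc0) 0
  have hball₀ := real_closedBall_pos μF (norm_pos_iff.2 hc₀) 0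
  have hscale := real_closedBall_mul_eq_of_fourier_eq_zero μF hcond (μ.restrict K) hπ.measurable hc₀
    hdecay hc0 (mem_closedBall_zero_iff.1 hcc) y
  rw [measureReal_restrict_apply (hπ.measurable measurableSet_closedBall), Set.inter_comm, hc,
    mul_right_comm, mul_comm] at hscale
  have total_le := measureReal_mono (μ := μ.restrict K)
    (Set.subset_univ (π ⁻¹' Metric.closedBall y ‖c₀‖))
  rw [measureReal_restrict_apply_univ] at total_le
  rw [le_div_iff₀ hball₀]
  nlinarith

end DensityOfDecay

section Quadric

variable {F : Type*} [NontriviallyNormedField F]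
  {V : Type*} [AddCommGroup V] [Module F V] {Q : QuadraticForm F V} {v₁ : V}

theorem eq_or_eq_neg_of_mem_span (hv₁ : Q v₁ = 1) {x : V} (hx : Q x = 1)
    (h : x ∈ Submodule.span F {v₁}) : x = v₁ ∨ x = -v₁ := by
  obtain ⟨t, rfl⟩ := Submodule.mem_span_singleton.1 h
  rw [QuadraticMap.map_smul, hv₁, smul_eq_mul, mul_one, mul_self_eq_one_iff] at hx
  exact hx.imp (by rintro rfl; exact one_smul F v₁) (by rintro rfl; exact neg_one_smul F v₁)

theorem polar_self_eq_two (hv₁ : Q v₁ = 1) : QuadraticMap.polar Q v₁ v₁ = 2 := by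
  rw [QuadraticMap.polar_self, hv₁, two_nsmul, one_add_one_eq_two]

variable [ProperSpace F] [FiniteDimensional F V] [TopologicalSpace V]
  [IsTopologicalAddGroup V] [ContinuousSMul F V] [T2Space V] [MeasurableSpace V] [BorelSpace V]

theorem continuous_polar_hyperboloid (Q : QuadraticForm F V) (a : F) (v₁ : V) :
    Continuous fun x : Hyperboloid Q a => QuadraticMap.polar Q v₁ x.1 :=
  (continuous_polar Q v₁).comp continuous_subtype_val

variable [IsUltrametricDist F] {ψ : AddChar F Circle} (μV : Measure V) [μV.IsAddHaarMeasure]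

theorem exists_setIntegral_phase_eq_zero_of_isOpen {E : Type*} [NormedAddCommGroup E]
    [NormedSpace F E] [ProperSpace E] (h2 : (2 : F) ≠ 0) (hcond : HasConductorIntegers ψ)
    (hQ : Q.polarBilin.Nondegenerate) {K : Set V} (hK : IsCompact K) (hK' : IsOpen K)
    (β : E →L[F] F) (u : E →L[F] V) (hcrit : ∀ v ∈ K, ∀ p, β p • v + u p = 0 → p = 0) :
    ∃ R : ℝ, ∀ p, R < ‖p‖ →
      ∫ v in K, (ψ (β p * Q v + QuadraticMap.polar Q (u p) v) : ℂ) ∂μV = 0 := by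
  obtain ⟨R, hR⟩ := exists_setIntegral_phase_eq_zero μV h2 hcond hQ hK β u hcrit
  obtain ⟨c, ⟨hKc, hc1⟩, hc⟩ := (((eventually_add_mem_of_mem_lattice hK hK').and
    (Metric.closedBall_mem_nhds (0 : F) one_pos)).filter_mono nhdsWithin_le_nhds
      |>.and (eventually_mem_nhdsWithin (s := {0}ᶜ))).exists
  refine ⟨R / ‖c‖, fun p hp => hR c (mem_closedBall_zero_iff.1 hc1) K le_rfl hK hK' hKc p ?_⟩
  rwa [← div_lt_iff₀ (norm_pos_iff.2 hc)]

theorem exists_setIntegral_polar_eq_zero (h2 : (2 : F) ≠ 0) (hcond : HasConductorIntegers ψ)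
    (hQ : Q.polarBilin.Nondegenerate) (hv₁ : v₁ ≠ 0) {K : Set V} (hK : IsCompact K)
    (hK' : IsOpen K) (hKv : K ⊆ (Submodule.span F {v₁} : Set V)ᶜ) :
    ∃ R : ℝ, ∀ b c : F, R < ‖c‖ →
      ∫ v in K, (ψ (b * Q v + c * QuadraticMap.polar Q v₁ v) : ℂ) ∂μV = 0 := by
  obtain ⟨R, hR⟩ := exists_setIntegral_phase_eq_zero_of_isOpen μV h2 hcond hQ hK hK'
    (ContinuousLinearMap.fst F F F) ((ContinuousLinearMap.snd F F F).smulRight v₁) <| by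
      rintro v hv ⟨b, c⟩ hbc
      replace hbc : b • v + c • v₁ = 0 := hbc
      have hb : b = 0 := by
        by_contra hb
        refine hKv hv (Submodule.mem_span_singleton.2 ⟨-(b⁻¹ * c), ?_⟩)
        rw [neg_smul, mul_smul, ← smul_neg, ← eq_neg_of_add_eq_zero_left hbc, inv_smul_smul₀ hb]
      rw [hb, zero_smul, zero_add] at hbc
      exact Prod.ext hb ((smul_eq_zero.1 hbc).resolve_right hv₁)
  refine ⟨R, fun b c hc => ?_⟩
  simpa [QuadraticMap.polar_smul_left] using hR (b, c) (hc.trans_le (le_max_right ‖b‖ ‖c‖))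

theorem real_setOf_sub_mem_lattice (z : V) {c : F} (hc : c ≠ 0) :
    μV.real {v | v - z ∈ lattice V c} =
      absF c ^ Module.finrank F V * μV.real (lattice V (1 : F)) := by
  have := prespectralSpace_module F V
  rw [← real_lattice μV hc, measureReal_def, measureReal_def,
    ← measure_preimage_add_right μV (-z) (lattice V c)]
  simp only [sub_eq_add_neg]
  rfl

theorem exists_setIntegral_sub_lattice_eq_zero (h2 : (2 : F) ≠ 0) (hcond : HasConductorIntegers ψ)
    (hQ : Q.polarBilin.Nondegenerate) {z : V} (hz : z ≠ 0) :
    ∃ R : ℝ, ∀ᶠ c in 𝓝[≠] (0 : F), ∀ b, R < ‖b‖ * ‖c‖ →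
      ∫ v in {v | v - z ∈ lattice V c}, (ψ (b * Q v) : ℂ) ∂μV = 0 := by
  obtain ⟨c₀, hc₀, hc₀0⟩ := ((eventually_lattice_subset (F := F) (U := {-z}ᶜ)
    (isOpen_compl_singleton.mem_nhds (by simpa using hz))).filter_mono nhdsWithin_le_nhds
      |>.and (eventually_mem_nhdsWithin (s := {0}ᶜ))).exists
  obtain ⟨R, hR⟩ := exists_setIntegral_phase_eq_zero μV h2 hcond hQ
    (isCompact_setOf_sub_mem_lattice z c₀) (ContinuousLinearMap.id F F) 0 fun v hv p hp => by
      have hp' : p • v = 0 := by simpa using hp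
      refine (smul_eq_zero.1 hp').resolve_right fun hv0 => hc₀ (a := -z) ?_ rfl
      simpa [hv0] using hv
  refine ⟨R, ?_⟩
  filter_upwards [eventually_mem_nhdsWithin,
    nhdsWithin_le_nhds (Metric.closedBall_mem_nhds (0 : F) one_pos), nhdsWithin_le_nhds
    (Metric.closedBall_mem_nhds (0 : F) (norm_pos_iff.2 hc₀0))] with c hc hc1 hcc₀ b hb
  rw [mem_closedBall_zero_iff] at hc1 hcc₀
  have stable : ∀ v ∈ {v | v - z ∈ lattice V c}, ∀ l ∈ lattice V c,
      v + l ∈ {v | v - z ∈ lattice V c} := fun v hv l hl => by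
    rw [Set.mem_ofPred_eq, add_sub_right_comm]
    exact add_mem hv hl
  simpa using hR c hc1 {v | v - z ∈ lattice V c} (fun v hv => le_trans hv hcc₀)
    (isCompact_setOf_sub_mem_lattice z c) (isOpen_setOf_sub_mem_lattice z hc) stable b hb

variable {μV} [MeasurableSpace F] [BorelSpace F] {μF : Measure F} [μF.IsAddHaarMeasure]

theorem exists_isFiberMeasure_quadraticForm (h2 : (2 : F) ≠ 0) (hcond : HasConductorIntegers ψ)
    (hQ : Q.polarBilin.Nondegenerate) :
    ∃ ω : (a : F) → Measure (Hyperboloid Q a), IsFiberMeasure μV μF Q {0}ᶜ ω := by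
  have hcont := continuous_quadraticForm h2 Q
  have := prespectralSpace_module F V
  have := secondCountable_module F V
  refine exists_isFiberMeasure hcont isOpen_compl_singleton fun K hK0 hK hK' => ?_
  obtain ⟨R, hR⟩ := exists_setIntegral_phase_eq_zero_of_isOpen μV h2 hcond hQ hK hK'
    (ContinuousLinearMap.id F F) 0 fun v hv p hp => by
      have hp' : p • v = 0 := by simpa using hp
      exact (smul_eq_zero.1 hp').resolve_right fun hv0 => hK0 hv (by simp [hv0])
  obtain ⟨a, ha⟩ := NormedField.exists_lt_norm F (max R 0)
  refine exists_hasFiberDensity (c₀ := a⁻¹) hcond hcont.measurable hK.measure_lt_top.ne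
    (inv_ne_zero (norm_pos_iff.1 ((le_max_right _ _).trans_lt ha))) fun b hb => ?_
  rw [norm_inv, inv_inv] at hb
  simpa using hR b ((le_max_left _ _).trans_lt (ha.trans hb))

variable {ω : (a : F) → Measure (Hyperboloid Q a)}

theorem eventually_setIntegral_weil_eq (h2 : (2 : F) ≠ 0) (hcond : HasConductorIntegers ψ)
    (hμF : IsSelfDual ψ (fun x y : F => x * y) μF) (hω : IsFiberMeasure μV μF Q {0}ᶜ ω)
    {f : V → ℂ} (hf : f ∈ SchwartzBruhat V) :
    ∀ᶠ c in 𝓝[≠] (0 : F), ∫ b in Metric.closedBall 0 ‖c‖⁻¹,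
        (ψ (-b) : ℂ) * ∫ v, f v * (ψ (b * Q v) : ℂ) ∂μV ∂μF =
      ∫ x : Hyperboloid Q 1, f x.1 ∂(ω 1) := by
  have hcont := continuous_quadraticForm h2 Q
  have := prespectralSpace_module F V
  have := secondCountable_module F V
  filter_upwards [hω.eventually_setIntegral hcont isOpen_compl_singleton hf (y := 1) (by simp),
    eventually_mem_nhdsWithin] with c hc hc0
  have dual_volumes : μF.real (Metric.closedBall 0 ‖c‖⁻¹) * μF.real (Metric.closedBall 0 ‖c‖) =
      1 := by
    rw [← norm_inv, real_closedBall_norm, real_closedBall_norm, real_closedBall_one μF hcond hμF,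
      absF_inv, mul_one, mul_one, inv_mul_cancel₀ (absF_pos hc0).ne']
  have h := integral_closedBall_fourier_mul μF μV hcond hcont.measurable
    (SchwartzBruhat.integrable μV hf) hc0 1
  simp_rw [mul_one] at h
  rw [h, hc, ← mul_assoc, ← Complex.ofReal_mul, dual_volumes, Complex.ofReal_one, one_mul]

theorem exists_hasFiberDensity_polar (h2 : (2 : F) ≠ 0) (hcond : HasConductorIntegers ψ)
    (hQ : Q.polarBilin.Nondegenerate) (hμF : IsSelfDual ψ (fun x y : F => x * y) μF)
    (hω : IsFiberMeasure μV μF Q {0}ᶜ ω) (hv₁ : Q v₁ = 1) {K : Set (Hyperboloid Q 1)}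
    (hK : IsCompact K) (hK' : IsOpen K) (hKv : ∀ x ∈ K, x.1 ≠ v₁ ∧ x.1 ≠ -v₁) :
    ∃ g, HasFiberDensity μF (ω 1) (fun x => QuadraticMap.polar Q v₁ x.1) K g := by
  have := hω.finite_on_compacts 1 (by simp)
  have := prespectralSpace_module F V
  obtain ⟨L, hL, hL', hLK, hLv⟩ := exists_isCompact_isOpen_extension hK hK'
    (Submodule.closed_of_finiteDimensional (Submodule.span F {v₁})).isOpen_compl fun x hx h =>
      (eq_or_eq_neg_of_mem_span hv₁ x.2 h).elim (hKv x hx).1 (hKv x hx).2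
  obtain ⟨R, hR⟩ := exists_setIntegral_polar_eq_zero μV h2 hcond hQ
    (by rintro rfl; simp at hv₁) hL hL' hLv
  obtain ⟨a, ha⟩ := NormedField.exists_lt_norm F (max R 0)
  refine exists_hasFiberDensity (c₀ := a⁻¹) hcond (continuous_polar_hyperboloid Q 1 v₁).measurable
    hK.measure_lt_top.ne (inv_ne_zero (norm_pos_iff.1 ((le_max_right _ _).trans_lt ha)))
    fun c hc => ?_
  rw [norm_inv, inv_inv] at hc
  let f (v : V) : ℂ := L.indicator (fun _ => 1) v * (ψ (c * QuadraticMap.polar Q v₁ v) : ℂ)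
  have hf : f ∈ SchwartzBruhat V := SchwartzBruhat.mul_character_mem hcond
    (continuous_polar Q v₁) (SchwartzBruhat.indicator_mem hL hL') c
  have fourier_f (b : F) : ∫ v, f v * (ψ (b * Q v) : ℂ) ∂μV = 0 := by
    rw [← hR b c ((le_max_left _ _).trans_lt (ha.trans hc)), ← integral_indicator hL'.measurableSet]
    refine integral_congr_ae (.of_forall fun v => ?_)
    by_cases hv : v ∈ L <;> simp [f, hv, AddChar.map_add_eq_mul, mul_comm]
  obtain ⟨r, hr⟩ := (eventually_setIntegral_weil_eq h2 hcond hμF hω hf).exists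
  simp_rw [fourier_f, mul_zero, integral_zero] at hr
  rw [← integral_indicator hK'.measurableSet, hr]
  refine integral_congr_ae (.of_forall fun x => ?_)
  by_cases hx : x ∈ K <;> simp [f, hx, hLK]

theorem exists_isFiberMeasure_polar (h2 : (2 : F) ≠ 0) (hcond : HasConductorIntegers ψ)
    (hQ : Q.polarBilin.Nondegenerate) (hμF : IsSelfDual ψ (fun x y : F => x * y) μF)
    (hω : IsFiberMeasure μV μF Q {0}ᶜ ω) (hv₁ : Q v₁ = 1) :
    ∃ ν : (ξ : F) → Measure {x : Hyperboloid Q 1 // QuadraticMap.polar Q v₁ x.1 = ξ},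
      IsFiberMeasure (ω 1) μF (fun x => QuadraticMap.polar Q v₁ x.1) {2, -2}ᶜ ν := by
  have := hω.finite_on_compacts 1 (by simp)
  have := prespectralSpace_module F V
  have := secondCountable_module F V
  have := prespectralSpace_subtype (isClosed_hyperboloid h2 Q 1)
  have : SecondCountableTopology (Hyperboloid Q 1) :=
    TopologicalSpace.Subtype.secondCountableTopology {v | Q v = 1}
  refine exists_isFiberMeasure (continuous_polar_hyperboloid Q 1 v₁)
    (Set.toFinite _).isClosed.isOpen_compl fun K hKξ hK hK' =>
      exists_hasFiberDensity_polar h2 hcond hQ hμF hω hv₁ hK hK' fun x hx =>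
        ⟨fun h => hKξ hx (.inl ?_), fun h => hKξ hx (.inr ?_)⟩
  · change QuadraticMap.polar Q v₁ x.1 = 2
    rw [h, polar_self_eq_two hv₁]
  · change QuadraticMap.polar Q v₁ x.1 = -2
    rw [h, QuadraticMap.polar_neg_right, polar_self_eq_two hv₁]

theorem exists_real_hyperboloid_le (h2 : (2 : F) ≠ 0) (hcond : HasConductorIntegers ψ)
    (hQ : Q.polarBilin.Nondegenerate) (hω : IsFiberMeasure μV μF Q {0}ᶜ ω) {z : V} (hz : z ≠ 0) :
    ∃ C : ℝ, ∀ᶠ c in 𝓝[≠] (0 : F), (ω 1).real {x | x.1 - z ∈ lattice V c} ≤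
      C * absF c ^ (Module.finrank F V - 1) := by
  -- `z + c L₀` has volume of order `|c| ^ n`; `Q` spreads it evenly over balls of radius `|c / a|`.
  obtain ⟨R, hR⟩ := exists_setIntegral_sub_lattice_eq_zero μV h2 hcond hQ hz
  obtain ⟨a, ha⟩ := NormedField.exists_lt_norm F (max R 0)
  have ha0 : a ≠ 0 := norm_pos_iff.1 ((le_max_right _ _).trans_lt ha)
  refine ⟨μV.real (lattice V (1 : F)) / (absF a⁻¹ * μF.real (Metric.closedBall 0 1)), ?_⟩
  filter_upwards [hR, eventually_mem_nhdsWithin] with c hRc hc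
  have real_le := hω.real_preimage_le hcond (continuous_quadraticForm h2 Q) isOpen_compl_singleton
    (isCompact_setOf_sub_mem_lattice z c) (isOpen_setOf_sub_mem_lattice z hc)
    (mul_ne_zero hc (inv_ne_zero ha0)) (fun b hb => hRc b ?_) (y := 1) (by simp)
  · have : Nontrivial V := ⟨z, 0, hz⟩
    have absF_c := (absF_pos hc).ne'
    rw [real_setOf_sub_mem_lattice μV z hc, real_closedBall_norm, absF_mul,
      ← pow_sub_one_mul Module.finrank_pos.ne'] at real_le
    refine real_le.trans_eq ?_
    field_simp
  · rw [norm_mul, mul_inv, norm_inv, inv_inv, mul_comm,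
      mul_inv_lt_iff₀ (norm_pos_iff.2 hc)] at hb
    exact (le_max_left _ _).trans_lt (ha.trans hb)

theorem measure_hyperboloid_singleton (h2 : (2 : F) ≠ 0) (hcond : HasConductorIntegers ψ)
    (hQ : Q.polarBilin.Nondegenerate) (hω : IsFiberMeasure μV μF Q {0}ᶜ ω)
    (hdim : 2 ≤ Module.finrank F V) (z : Hyperboloid Q 1) : ω 1 {z} = 0 := by
  have := hω.finite_on_compacts 1 (by simp)
  obtain ⟨C, hC⟩ := exists_real_hyperboloid_le h2 hcond hQ hω (z := z.1) fun h => by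
    simpa [h] using z.2
  have tendsto_zero : Tendsto (fun c : F => C * absF c ^ (Module.finrank F V - 1)) (𝓝[≠] 0)
      (𝓝 (C * 0 ^ (Module.finrank F V - 1))) :=
    ((tendsto_absF_nhds_zero.mono_left nhdsWithin_le_nhds).pow _).const_mul C
  rw [zero_pow (by omega), mul_zero] at tendsto_zero
  refine (measureReal_eq_zero_iff isCompact_singleton.measure_ne_top).1
    (le_antisymm (ge_of_tendsto tendsto_zero (hC.mono fun c => le_trans ?_)) measureReal_nonneg)
  refine measureReal_mono (by simp) (IsCompact.measure_ne_top ?_)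
  exact (isClosed_hyperboloid h2 Q 1).isClosedEmbedding_subtypeVal.isCompact_preimage
    (isCompact_setOf_sub_mem_lattice z.1 c)

theorem measure_preimage_polar_singleton (h2 : (2 : F) ≠ 0) (hcond : HasConductorIntegers ψ)
    (hQ : Q.polarBilin.Nondegenerate) (hμF : IsSelfDual ψ (fun x y : F => x * y) μF)
    (hω : IsFiberMeasure μV μF Q {0}ᶜ ω) (hdim : 2 ≤ Module.finrank F V) (hv₁ : Q v₁ = 1)
    (ξ : F) : ω 1 ((fun x => QuadraticMap.polar Q v₁ x.1) ⁻¹' {ξ}) = 0 := by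
  have := prespectralSpace_module F V
  have := secondCountable_module F V
  have := prespectralSpace_subtype (isClosed_hyperboloid h2 Q 1)
  have : SecondCountableTopology (Hyperboloid Q 1) :=
    TopologicalSpace.Subtype.secondCountableTopology {v | Q v = 1}
  let z : Hyperboloid Q 1 := ⟨v₁, hv₁⟩
  let z' : Hyperboloid Q 1 := ⟨-v₁, by rw [QuadraticMap.map_neg, hv₁]⟩
  have poles : ω 1 {z, z'} = 0 := by
    rw [Set.insert_eq]
    exact measure_union_null (measure_hyperboloid_singleton h2 hcond hQ hω hdim z)
      (measure_hyperboloid_singleton h2 hcond hQ hω hdim z')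
  refine measure_mono_null (Set.subset_sdiff_union _ {z, z'}) (measure_union_null ?_ poles)
  refine measure_null_of_locally_null _ fun x hx => ?_
  obtain ⟨K, ⟨hK', hK⟩, hxK, hKz⟩ :=
    (PrespectralSpace.isTopologicalBasis (X := Hyperboloid Q 1)).exists_subset_of_mem_open hx.2
      (Set.toFinite {z, z'}).isClosed.isOpen_compl
  obtain ⟨g, hg⟩ := exists_hasFiberDensity_polar h2 hcond hQ hμF hω hv₁ hK hK' fun y hy =>
    ⟨fun h => hKz hy (.inl (Subtype.ext h)), fun h => hKz hy (.inr (Subtype.ext h))⟩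
  refine ⟨_, ?_, hg.measure_inter_preimage_singleton ξ⟩
  exact Filter.inter_mem (nhdsWithin_le_nhds (hK'.mem_nhds hxK))
    (mem_of_superset self_mem_nhdsWithin Set.sdiff_subset)

variable {ν : (ξ : F) → Measure {x : Hyperboloid Q 1 // QuadraticMap.polar Q v₁ x.1 = ξ}}

theorem integral_hyperboloid_eq (h2 : (2 : F) ≠ 0) (hcond : HasConductorIntegers ψ)
    (hQ : Q.polarBilin.Nondegenerate) (hμF : IsSelfDual ψ (fun x y : F => x * y) μF)
    (hω : IsFiberMeasure μV μF Q {0}ᶜ ω) (hdim : 2 ≤ Module.finrank F V) (hv₁ : Q v₁ = 1)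
    (hν : IsFiberMeasure (ω 1) μF (fun x => QuadraticMap.polar Q v₁ x.1) {2, -2}ᶜ ν)
    {φ : Hyperboloid Q 1 → ℂ} (hφ : φ ∈ SchwartzBruhat (Hyperboloid Q 1)) :
    IntegrableOn (fun ξ => ∫ x : {x : Hyperboloid Q 1 // QuadraticMap.polar Q v₁ x.1 = ξ},
      φ x.1 ∂(ν ξ)) {2, -2}ᶜ μF ∧
    ∫ x, φ x ∂(ω 1) = ∫ ξ in {2, -2}ᶜ,
      (∫ x : {x : Hyperboloid Q 1 // QuadraticMap.polar Q v₁ x.1 = ξ}, φ x.1 ∂(ν ξ)) ∂μF := by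
  have := hω.finite_on_compacts 1 (by simp)
  have hcont := continuous_polar_hyperboloid Q 1 v₁
  have hopen : IsOpen ({2, -2}ᶜ : Set F) := (Set.toFinite _).isClosed.isOpen_compl
  refine ⟨hν.integrableOn hcont hopen hφ, hν.integral_eq_setIntegral hcont hopen hφ ?_⟩
  rw [compl_compl, Set.insert_eq, Set.preimage_union]
  exact measure_mono_null Set.inter_subset_right (measure_union_null
    (measure_preimage_polar_singleton h2 hcond hQ hμF hω hdim hv₁ 2)
    (measure_preimage_polar_singleton h2 hcond hQ hμF hω hdim hv₁ (-2)))

end Quadric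

/-! ### Orbital integrals as functions -/

theorem isLocallyConstant_integral_mul_character {F : Type*} [NontriviallyNormedField F]
    {ψ : AddChar F Circle} (hcond : HasConductorIntegers ψ) {X : Type*} [TopologicalSpace X]
    [MeasurableSpace X] (μ : Measure X) {π : X → F} (hπ : Continuous π) {f : X → ℂ}
    (hf : f ∈ SchwartzBruhat X) :
    IsLocallyConstant fun c => ∫ x, f x * (ψ (c * π x) : ℂ) ∂μ := by
  refine (IsLocallyConstant.iff_eventually_eq _).2 fun c => ?_
  obtain ⟨C, hC⟩ := ((SchwartzBruhat.isCompact_support hf).image hπ).isBounded.exists_norm_le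
  have tendsto_zero : Tendsto (fun b : F => ‖b - c‖ * C) (𝓝 c) (𝓝 0) := by
    have h : Continuous fun b : F => ‖b - c‖ * C := by fun_prop
    simpa using h.tendsto c
  filter_upwards [tendsto_zero.eventually_le_const one_pos] with b hb
  refine integral_congr_ae (Eventually.of_forall fun x => ?_)
  by_cases hx : f x = 0
  · simp only [hx, zero_mul]
  have trivial_on : ψ ((b - c) * π x) = 1 := hcond.eq_one <|
    calc ‖(b - c) * π x‖ = ‖b - c‖ * ‖π x‖ := norm_mul _ _
      _ ≤ ‖b - c‖ * C := by gcongr; exact hC _ ⟨x, hx, rfl⟩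
      _ ≤ 1 := hb
  have split : b * π x = (b - c) * π x + c * π x := by ring
  simp only [split, AddChar.map_add_eq_mul, trivial_on, one_mul]

theorem isLocallyConstant_absF_units {F : Type*} [NontriviallyNormedField F] [ProperSpace F]
    [IsUltrametricDist F] : IsLocallyConstant fun a : Fˣ => absF (a : F) := by
  borelize F
  refine (IsLocallyConstant.iff_eventually_eq _).2 fun a => ?_
  have close : ∀ᶠ b : Fˣ in 𝓝 a, (b : F) ∈ Metric.ball (a : F) ‖(a : F)‖ :=
    Units.continuous_val.continuousAt.eventually
      (Metric.ball_mem_nhds _ (norm_pos_iff.2 a.ne_zero))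
  filter_upwards [close] with b hb
  refine absF_congr ?_
  rw [← norm_neg (a : F)]
  refine IsUltrametricDist.norm_eq_of_add_norm_lt_max (lt_max_of_lt_right ?_)
  rwa [← sub_eq_add_neg, norm_neg, ← mem_ball_iff_norm]

section Heart

variable {F : Type*} [NontriviallyNormedField F]

theorem Heart.mem_compl (ξ : Heart F) : ξ.1 ∈ ({2, -2}ᶜ : Set F) := fun h =>
  h.elim ξ.2.1 ξ.2.2

theorem Heart.range_val : Set.range (Subtype.val : Heart F → F) = {2, -2}ᶜ := by
  ext ξ; simp

theorem Heart.measurableEmbedding_val [MeasurableSpace F] [BorelSpace F] :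
    MeasurableEmbedding (Subtype.val : Heart F → F) := by
  refine .subtype_coe (s := {ξ : F | ξ ≠ 2 ∧ ξ ≠ -2}) ?_
  have compl_eq : {ξ : F | ξ ≠ 2 ∧ ξ ≠ -2} = {2, -2}ᶜ := by ext ξ; simp
  rw [compl_eq]
  exact (Set.toFinite _).measurableSet.compl

end Heart

section Invariance

variable {F : Type*} [NontriviallyNormedField F] [ProperSpace F]
  {V : Type*} [AddCommGroup V] [Module F V] [FiniteDimensional F V] [TopologicalSpace V]
  [IsTopologicalAddGroup V] [ContinuousSMul F V] [T2Space V] {Q : QuadraticForm F V} {v₁ : V}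

/-- The action `act` of an isometry on `X_a` as a homeomorphism. -/
noncomputable def actHomeomorph (h : Q.IsometryEquiv Q) (a : F) :
    Hyperboloid Q a ≃ₜ Hyperboloid Q a :=
  (isometryEquiv h).toHomeomorph.subtype fun v => by
    have map_eq : Q (isometryEquiv h v) = Q v := h.map_app v
    exact map_eq ▸ Iff.rfl

variable [MeasurableSpace V] [BorelSpace V] {μV : Measure V} [μV.IsAddHaarMeasure]
  [MeasurableSpace F] {μF : Measure F}
  {ω : (a : F) → Measure (Hyperboloid Q a)}
  {ν : (ξ : F) → Measure {x : Hyperboloid Q 1 // QuadraticMap.polar Q v₁ x.1 = ξ}}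

theorem integrable_fiber_polar
    (hν : IsFiberMeasure (ω 1) μF (fun x => QuadraticMap.polar Q v₁ x.1) {2, -2}ᶜ ν)
    {φ : Hyperboloid Q 1 → ℂ} (hφ : φ ∈ SchwartzBruhat (Hyperboloid Q 1)) (ξ : Heart F) :
    Integrable (fun x : {x : Hyperboloid Q 1 // QuadraticMap.polar Q v₁ x.1 = ξ.1} => φ x.1)
      (ν ξ.1) := by
  have := hν.finite_on_compacts ξ.1 ξ.mem_compl
  exact SchwartzBruhat.integrable _ (SchwartzBruhat.comp_subtype hφ
    (isClosed_eq (continuous_polar_hyperboloid Q 1 v₁) continuous_const))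

/-- Integration along the fibres of `x ↦ ⟨v₁, x⟩`, as a linear map. -/
noncomputable def fiberIntegralX
    (hν : IsFiberMeasure (ω 1) μF (fun x => QuadraticMap.polar Q v₁ x.1) {2, -2}ᶜ ν) :
    SchwartzBruhat (Hyperboloid Q 1) →ₗ[ℂ] (Heart F → ℂ) where
  toFun φ ξ := ∫ x : {x : Hyperboloid Q 1 // QuadraticMap.polar Q v₁ x.1 = ξ.1}, φ.1 x.1 ∂(ν ξ.1)
  map_add' φ φ' := funext fun ξ =>
    integral_add (integrable_fiber_polar hν φ.2 ξ) (integrable_fiber_polar hν φ'.2 ξ)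
  map_smul' c _ := funext fun _ => integral_const_mul c _

variable [IsUltrametricDist F] [BorelSpace F] [μF.IsAddHaarMeasure] {ψ : AddChar F Circle}

theorem integral_hyperboloid_isometry (h2 : (2 : F) ≠ 0)
    (hμ : IsSelfDual ψ (QuadraticMap.polar Q) μV) (hω : IsFiberMeasure μV μF Q {0}ᶜ ω)
    (h : Q.IsometryEquiv Q) {a : F} (ha : a ≠ 0) {φ : Hyperboloid Q a → ℂ}
    (hφ : φ ∈ SchwartzBruhat (Hyperboloid Q a)) :
    ∫ x, φ (act Q h x) ∂(ω a) = ∫ x, φ x ∂(ω a) := by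
  have := prespectralSpace_module F V
  have := secondCountable_module F V
  obtain ⟨Φ, hΦ, hφΦ⟩ := SchwartzBruhat.exists_extension hφ
  obtain rfl : (fun x => Φ x.1) = φ := funext hφΦ
  exact hω.integral_comp_eq (continuous_quadraticForm h2 Q) isOpen_compl_singleton
    (isometryEquiv h).toHomeomorph h.map_app
    (fun f _ => (measurePreserving_of_isSelfDual hμ _ (polar_isometryEquiv h)).integral_comp
      (isometryEquiv h).toHomeomorph.measurableEmbedding f) hΦ ha

theorem fiberIntegralX_comp_act (h2 : (2 : F) ≠ 0)
    (hμ : IsSelfDual ψ (QuadraticMap.polar Q) μV) (hω : IsFiberMeasure μV μF Q {0}ᶜ ω)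
    (hν : IsFiberMeasure (ω 1) μF (fun x => QuadraticMap.polar Q v₁ x.1) {2, -2}ᶜ ν)
    {h : Q.IsometryEquiv Q} (hh : h v₁ = v₁) (φ : SchwartzBruhat (Hyperboloid Q 1)) :
    fiberIntegralX hν ⟨φ.1 ∘ actHomeomorph h 1,
      SchwartzBruhat.comp_isClosedEmbedding φ.2 (actHomeomorph h 1).isClosedEmbedding⟩ =
      fiberIntegralX hν φ := by
  have polar_act (x : Hyperboloid Q 1) :
      QuadraticMap.polar Q v₁ (actHomeomorph h 1 x).1 = QuadraticMap.polar Q v₁ x.1 := by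
    conv_lhs => rw [← hh]
    exact polar_isometryEquiv h v₁ x.1
  exact funext fun ξ => hν.integral_comp_eq (continuous_polar_hyperboloid Q 1 v₁)
    (Set.toFinite _).isClosed.isOpen_compl (actHomeomorph h 1) polar_act
    (fun f hf => integral_hyperboloid_isometry h2 hμ hω h one_ne_zero hf) φ.2 ξ.mem_compl

theorem exists_incarnationX (h2 : (2 : F) ≠ 0)
    (hμ : IsSelfDual ψ (QuadraticMap.polar Q) μV) (hω : IsFiberMeasure μV μF Q {0}ᶜ ω)
    (hν : IsFiberMeasure (ω 1) μF (fun x => QuadraticMap.polar Q v₁ x.1) {2, -2}ᶜ ν) :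
    ∃ J : OrbitalX Q v₁ →ₗ[ℂ] (Heart F → ℂ), IsIncarnationX Q v₁ ν J ∧
      ∀ φ, IsLocallyConstant (J φ) := by
  have relX_le : relX Q v₁ ≤ LinearMap.ker (fiberIntegralX hν) := by
    refine Submodule.span_le.2 ?_
    rintro η ⟨h, hh, φ, hη⟩
    have symm_fix : h.symm v₁ = v₁ := h.toLinearEquiv.symm_apply_eq.2 hh.symm
    have invariant := fiberIntegralX_comp_act h2 hμ hω hν symm_fix φ
    rw [← sub_eq_zero, ← map_sub] at invariant
    exact (congr_arg (fiberIntegralX hν) (Subtype.ext (funext hη))).trans invariant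
  refine ⟨Submodule.liftQ _ _ relX_le, fun _ _ => rfl, fun φ => ?_⟩
  obtain ⟨φ, rfl⟩ := Submodule.mkQ_surjective _ φ
  exact (IsLocallyConstant.iff_eventually_eq _).2 fun ξ =>
    continuous_subtype_val.continuousAt.eventually
      (hν.eventually_eq (continuous_polar_hyperboloid Q 1 v₁)
        (Set.toFinite _).isClosed.isOpen_compl φ.2 ξ.mem_compl)

end Invariance

section Incarnation

variable {F : Type*} [NontriviallyNormedField F]

theorem quadChar_eq_one (h2 : (2 : F) ≠ 0) {d : F} (hd : IsSquare d) (hd' : d ≠ 0) (a : F) :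
    quadChar d a = 1 := by
  obtain ⟨s, rfl⟩ := hd
  have hs : s ≠ 0 := left_ne_zero_of_mul hd'
  refine if_pos ⟨(a + 1) / 2, (a - 1) / (2 * s), ?_⟩
  field_simp
  ring

theorem idealU_eq_closedBall {ϖ : F} (hϖ : ϖ ≠ 0) (n : ℕ) :
    idealU ϖ n = Metric.closedBall 0 ‖ϖ ^ n‖⁻¹ := by
  ext b
  rw [mem_closedBall_zero_iff, ← one_div, le_div_iff₀' (norm_pos_iff.2 (pow_ne_zero n hϖ)),
    ← norm_mul]
  rfl

theorem IsUniformizer.ne_zero {ϖ : F} (hϖ : IsUniformizer ϖ) : ϖ ≠ 0 := by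
  rintro rfl
  obtain ⟨x, hx, hx1⟩ := NormedField.exists_norm_lt_one F
  exact hx.not_ge ((hϖ.2 x hx1).trans_eq norm_zero)

theorem IsUniformizer.tendsto_pow {ϖ : F} (hϖ : IsUniformizer ϖ) :
    Tendsto (fun n : ℕ => ϖ ^ n) atTop (𝓝[≠] 0) :=
  tendsto_nhdsWithin_iff.2 ⟨tendsto_pow_atTop_nhds_zero_of_norm_lt_one hϖ.1,
    Eventually.of_forall fun n => pow_ne_zero n hϖ.ne_zero⟩

variable {V : Type*} [AddCommGroup V] [Module F V] [FiniteDimensional F V] {Q : QuadraticForm F V}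

theorem disc_ne_zero (hQ : Q.polarBilin.Nondegenerate) : disc Q ≠ 0 := by
  refine mul_ne_zero (pow_ne_zero _ (neg_ne_zero.2 one_ne_zero)) ?_
  convert (LinearMap.BilinForm.nondegenerate_iff_det_ne_zero (Module.finBasis F V)).1 hQ using 2
  ext i j
  rw [LinearMap.BilinForm.toMatrix_apply]
  rfl

variable [ProperSpace F] {ψ : AddChar F Circle} [TopologicalSpace V] [IsTopologicalAddGroup V]
  [ContinuousSMul F V] [T2Space V] [MeasurableSpace V] [BorelSpace V] {μV : Measure V} {v₁ : V}

theorem pMap_wMat_tMat_nMat [IsUltrametricDist F] [μV.IsAddHaarMeasure] (h2 : (2 : F) ≠ 0)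
    (hQ : Q.polarBilin.Nondegenerate) (hdisc : IsSquare (disc Q)) (Φ : V → ℂ) (a : Fˣ) (b : F) :
    pMap ψ Q μV v₁ Φ (wMat F * tMat a * nMat b) =
      weilIndex ψ Q μV * ((absF (a : F) ^ (-(Module.finrank F V : ℝ) / 2) : ℝ) : ℂ) *
        ∫ v, Φ v * (ψ ((a : F)⁻¹ * QuadraticMap.polar Q v₁ v) : ℂ) * (ψ (b * Q v) : ℂ) ∂μV := by
  have := prespectralSpace_module F V
  have matrix_eq : (wMat F * tMat a * nMat b).1 = !![0, (a : F)⁻¹; -a, -a * b] := by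
    rw [Matrix.SpecialLinearGroup.coe_mul, Matrix.SpecialLinearGroup.coe_mul]
    simp [wMat, tMat, nMat]
  have entry_00 : (wMat F * tMat a * nMat b) 0 0 = 0 := by rw [matrix_eq]; rfl
  have entry_10 : (wMat F * tMat a * nMat b) 1 0 = -(a : F) := by rw [matrix_eq]; rfl
  have entry_11 : (wMat F * tMat a * nMat b) 1 1 = -(a : F) * b := by rw [matrix_eq]; rfl
  have ha : -(a : F) ≠ 0 := neg_ne_zero.2 a.ne_zero
  have absF_rpow : absF (a : F) ^ (-(Module.finrank F V : ℝ) / 2) =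
      absF (a : F) ^ ((Module.finrank F V : ℝ) / 2) * (absF (a : F) ^ Module.finrank F V)⁻¹ := by
    rw [← Real.rpow_natCast, ← Real.rpow_neg (absF_pos a.ne_zero).le,
      ← Real.rpow_add (absF_pos a.ne_zero)]
    ring_nf
  have change_variables := integral_comp_smul μV a.ne_zero
    fun v => Φ v * (ψ ((a : F)⁻¹ * QuadraticMap.polar Q v₁ v) : ℂ) * (ψ (b * Q v) : ℂ)
  rw [pMap, weil, entry_10, if_neg ha, entry_00, entry_11, mul_div_cancel_left₀ _ ha, zero_div,
    neg_neg, absF_rpow, Complex.ofReal_mul, mul_assoc, mul_assoc, ← change_variables]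
  simp only [weilN, weilW, weilT, fourier, zero_mul, AddChar.map_zero_eq_one, Circle.coe_one,
    one_mul, quadChar_eq_one h2 hdisc (disc_ne_zero hQ), mul_one, ← integral_const_mul]
  refine integral_congr_ae (Eventually.of_forall fun v => ?_)
  simp only [QuadraticMap.polar_smul_right, smul_eq_mul, inv_mul_cancel_left₀ a.ne_zero]
  ring

/-- The map `φ ↦ (a ↦ γ |a|^(-dim V / 2) ∫_{X₁} φ(x) ψ(a⁻¹⟨v₁, x⟩) dx)`.  Its value at `Φ|_{X₁}` is
the function of `(N, ψ)`-orbital integrals of `p(Φ)`. -/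
noncomputable def orbitalN (hcond : HasConductorIntegers ψ) (μV : Measure V) (v₁ : V)
    (μ₁ : Measure (Hyperboloid Q 1)) [IsFiniteMeasureOnCompacts μ₁] :
    SchwartzBruhat (Hyperboloid Q 1) →ₗ[ℂ] (Fˣ → ℂ) where
  toFun φ a := weilIndex ψ Q μV * ((absF (a : F) ^ (-(Module.finrank F V : ℝ) / 2) : ℝ) : ℂ) *
    ∫ x, φ.1 x * (ψ ((a : F)⁻¹ * QuadraticMap.polar Q v₁ x.1) : ℂ) ∂μ₁
  map_add' φ φ' := funext fun a => by
    have integrable (φ : SchwartzBruhat (Hyperboloid Q 1)) := SchwartzBruhat.integrable μ₁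
      (SchwartzBruhat.mul_character_mem hcond (continuous_polar_hyperboloid Q 1 v₁) φ.2 (a : F)⁻¹)
    simp only [Pi.add_apply, Submodule.coe_add, add_mul]
    rw [integral_add (integrable φ) (integrable φ'), mul_add]
  map_smul' c φ := funext fun a => by
    simp only [Pi.smul_apply, Submodule.coe_smul, smul_eq_mul, mul_assoc, integral_const_mul,
      RingHom.id_apply]
    ring

theorem orbitalN_apply (hcond : HasConductorIntegers ψ) (μ₁ : Measure (Hyperboloid Q 1))
    [IsFiniteMeasureOnCompacts μ₁] (φ : SchwartzBruhat (Hyperboloid Q 1)) (a : Fˣ) :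
    orbitalN hcond μV v₁ μ₁ φ a =
      weilIndex ψ Q μV * ((absF (a : F) ^ (-(Module.finrank F V : ℝ) / 2) : ℝ) : ℂ) *
        ∫ x, φ.1 x * (ψ ((a : F)⁻¹ * QuadraticMap.polar Q v₁ x.1) : ℂ) ∂μ₁ :=
  rfl

variable [IsUltrametricDist F]

theorem isLocallyConstant_orbitalN (hcond : HasConductorIntegers ψ)
    (μ₁ : Measure (Hyperboloid Q 1)) [IsFiniteMeasureOnCompacts μ₁]
    (φ : SchwartzBruhat (Hyperboloid Q 1)) :
    IsLocallyConstant (orbitalN hcond μV v₁ μ₁ φ) := by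
  have inv_comp := (isLocallyConstant_integral_mul_character hcond μ₁
    (continuous_polar_hyperboloid Q 1 v₁) φ.2).comp_continuous
      (Units.continuous_coe_inv (M := F))
  simp only [Function.comp_def, Units.val_inv_eq_inv_val] at inv_comp
  exact (isLocallyConstant_absF_units.comp fun r =>
    weilIndex ψ Q μV * ((r ^ (-(Module.finrank F V : ℝ) / 2) : ℝ) : ℂ)).mul inv_comp

variable [MeasurableSpace F] [BorelSpace F] {μF : Measure F} [μF.IsAddHaarMeasure]
  [μV.IsAddHaarMeasure] {ω : (a : F) → Measure (Hyperboloid Q a)}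

theorem eventually_setIntegral_pMap (h2 : (2 : F) ≠ 0) (hcond : HasConductorIntegers ψ)
    (hQ : Q.polarBilin.Nondegenerate) (hdisc : IsSquare (disc Q))
    (hμF : IsSelfDual ψ (fun x y : F => x * y) μF) (hω : IsFiberMeasure μV μF Q {0}ᶜ ω)
    [IsFiniteMeasureOnCompacts (ω 1)] (Φ : SchwartzBruhat V) (a : Fˣ) :
    ∀ᶠ c in 𝓝[≠] (0 : F), ∫ b in Metric.closedBall 0 ‖c‖⁻¹,
      pMap ψ Q μV v₁ Φ.1 (wMat F * tMat a * nMat b) * (starRingEnd ℂ) (ψ b : ℂ) ∂μF =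
        orbitalN hcond μV v₁ (ω 1) (resX h2 Q 1 Φ) a := by
  filter_upwards [eventually_setIntegral_weil_eq h2 hcond hμF hω
    (SchwartzBruhat.mul_character_mem hcond (continuous_polar Q v₁) Φ.2 (a : F)⁻¹)] with c hc
  rw [orbitalN_apply]
  refine Eq.trans ?_ (congr_arg _ hc)
  rw [← integral_const_mul]
  refine integral_congr_ae (Eventually.of_forall fun b => ?_)
  have conj_eq : (starRingEnd ℂ) (ψ b : ℂ) = (ψ (-b) : ℂ) := by
    rw [AddChar.map_neg_eq_inv, Circle.coe_inv_eq_conj]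
  simp only [conj_eq, pMap_wMat_tMat_nMat h2 hQ hdisc]
  ring

theorem exists_linearMap_pLinear_eq_orbitalN (h2 : (2 : F) ≠ 0) (hcond : HasConductorIntegers ψ)
    (hQ : Q.polarBilin.Nondegenerate) (hdisc : IsSquare (disc Q))
    (hμF : IsSelfDual ψ (fun x y : F => x * y) μF) (hω : IsFiberMeasure μV μF Q {0}ᶜ ω)
    [IsFiniteMeasureOnCompacts (ω 1)] (v₁ : V) :
    ∃ J : whittakerSpace ψ Q μV v₁ →ₗ[ℂ] (Fˣ → ℂ), ∀ Φ,
      J (pLinear h2 hcond.continuous Q μV v₁ Φ) = orbitalN hcond μV v₁ (ω 1) (resX h2 Q 1 Φ) := by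
  refine exists_linearMap_comp_eq (pLinear_surjective h2 hcond.continuous Q μV v₁)
    (orbitalN hcond μV v₁ (ω 1) ∘ₗ resX h2 Q 1) fun Φ hΦ => funext fun a => ?_
  have pMap_eq_zero (g : SL(2, F)) : pMap ψ Q μV v₁ Φ.1 g = 0 :=
    congr_fun (congr_arg Subtype.val hΦ) g
  obtain ⟨c, hc⟩ := (eventually_setIntegral_pMap (v₁ := v₁) h2 hcond hQ hdisc hμF hω Φ a).exists
  rw [LinearMap.comp_apply, ← hc]
  simp only [pMap_eq_zero, zero_mul, integral_zero, Pi.zero_apply]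

theorem exists_incarnationN (h2 : (2 : F) ≠ 0) (hcond : HasConductorIntegers ψ)
    (hQ : Q.polarBilin.Nondegenerate) (hdisc : IsSquare (disc Q))
    (hμF : IsSelfDual ψ (fun x y : F => x * y) μF) (hω : IsFiberMeasure μV μF Q {0}ᶜ ω)
    [IsFiniteMeasureOnCompacts (ω 1)] (v₁ : V) {ϖ : F} (hϖ : IsUniformizer ϖ) :
    ∃ J : OrbitalN ψ Q μV v₁ →ₗ[ℂ] (Fˣ → ℂ), IsIncarnationN ψ μF Q μV v₁ ϖ J ∧
      (∀ f, IsLocallyConstant (J f)) ∧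
      ∀ Φ, J (pClass h2 hcond.continuous Q μV v₁ Φ) =
        orbitalN hcond μV v₁ (ω 1) (resX h2 Q 1 Φ) := by
  obtain ⟨J, hJ⟩ := exists_linearMap_pLinear_eq_orbitalN h2 hcond hQ hdisc hμF hω v₁
  have relN_le : relN ψ Q μV v₁ ≤ LinearMap.ker J := by
    refine Submodule.span_le.2 ?_
    rintro η ⟨b, f, hη⟩
    obtain ⟨Φ, rfl⟩ := pLinear_surjective h2 hcond.continuous Q μV v₁ f
    let Φ' : SchwartzBruhat V := ⟨weilN ψ Q b Φ.1, weilN_mem h2 hcond b Φ.2⟩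
    obtain rfl : pLinear h2 hcond.continuous Q μV v₁ (Φ' - (ψ b : ℂ) • Φ) = η := by
      refine Subtype.ext (funext fun g => ?_)
      rw [hη, map_sub, map_smul]
      exact congr_arg (· - _) (congr_fun (weil_weilN μV g b Φ.1) v₁)
    have resX_eq : resX h2 Q 1 Φ' = (ψ b : ℂ) • resX h2 Q 1 Φ :=
      Subtype.ext (funext fun x => by simp [Φ', resX, weilN, x.2])
    rw [SetLike.mem_coe, LinearMap.mem_ker, hJ, map_sub, map_smul, resX_eq, sub_self, map_zero]
  refine ⟨Submodule.liftQ _ J relN_le, fun f a => ?_, fun f => ?_, hJ⟩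
  · obtain ⟨Φ, rfl⟩ := pLinear_surjective h2 hcond.continuous Q μV v₁ f
    filter_upwards [hϖ.tendsto_pow.eventually
      (eventually_setIntegral_pMap (v₁ := v₁) h2 hcond hQ hdisc hμF hω Φ a)] with n hn
    rw [idealU_eq_closedBall hϖ.ne_zero, Submodule.mkQ_apply, Submodule.liftQ_apply, hJ]
    exact hn
  · obtain ⟨f, rfl⟩ := Submodule.mkQ_surjective _ f
    obtain ⟨Φ, rfl⟩ := pLinear_surjective h2 hcond.continuous Q μV v₁ f
    rw [Submodule.mkQ_apply, Submodule.liftQ_apply, hJ]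
    exact isLocallyConstant_orbitalN hcond (ω 1) _

theorem integral_hyperboloid_mul_character (h2 : (2 : F) ≠ 0) (hcond : HasConductorIntegers ψ)
    (hQ : Q.polarBilin.Nondegenerate) (hμF : IsSelfDual ψ (fun x y : F => x * y) μF)
    (hω : IsFiberMeasure μV μF Q {0}ᶜ ω) (hdim : 2 ≤ Module.finrank F V) (hv₁ : Q v₁ = 1)
    {ν : (ξ : F) → Measure {x : Hyperboloid Q 1 // QuadraticMap.polar Q v₁ x.1 = ξ}}
    (hν : IsFiberMeasure (ω 1) μF (fun x => QuadraticMap.polar Q v₁ x.1) {2, -2}ᶜ ν)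
    (φ : SchwartzBruhat (Hyperboloid Q 1)) (c : F) :
    Integrable (fun ξ : Heart F => fiberIntegralX hν φ ξ * (ψ (c * ξ.1) : ℂ))
      (μF.comap Subtype.val) ∧
    ∫ x, φ.1 x * (ψ (c * QuadraticMap.polar Q v₁ x.1) : ℂ) ∂(ω 1) =
      ∫ ξ : Heart F, fiberIntegralX hν φ ξ * (ψ (c * ξ.1) : ℂ) ∂(μF.comap Subtype.val) := by
  have fiber_eq (ξ : F) : ∫ x : {x : Hyperboloid Q 1 // QuadraticMap.polar Q v₁ x.1 = ξ},
      φ.1 x.1 * (ψ (c * QuadraticMap.polar Q v₁ x.1.1) : ℂ) ∂(ν ξ) =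
      (∫ x : {x : Hyperboloid Q 1 // QuadraticMap.polar Q v₁ x.1 = ξ}, φ.1 x.1 ∂(ν ξ)) *
        (ψ (c * ξ) : ℂ) := by
    rw [← integral_mul_const]
    exact integral_congr_ae (Eventually.of_forall fun x => by simp only [x.2])
  have disintegration := integral_hyperboloid_eq h2 hcond hQ hμF hω hdim hv₁ hν
    (SchwartzBruhat.mul_character_mem hcond (continuous_polar_hyperboloid Q 1 v₁) φ.2 c)
  simp_rw [fiber_eq] at disintegration
  rwa [IntegrableOn, ← Heart.range_val, ← Heart.measurableEmbedding_val.map_comap,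
    Heart.measurableEmbedding_val.integrable_map_iff,
    Heart.measurableEmbedding_val.integral_map] at disintegration

end Incarnation

end ThetaTransfer

open ThetaTransfer in
theorem proposition11p1_general
    {F : Type*} [NontriviallyNormedField F] [IsUltrametricDist F] [LocallyCompactSpace F]
    [MeasurableSpace F] [BorelSpace F] (h2 : (2 : F) ≠ 0)
    {V : Type*} [AddCommGroup V] [Module F V] [FiniteDimensional F V] [TopologicalSpace V]
    [IsTopologicalAddGroup V] [ContinuousSMul F V] [T2Space V] [MeasurableSpace V] [BorelSpace V]
    (ψ : AddChar F Circle) (hcond : HasConductorIntegers ψ)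
    (μF : Measure F) [μF.IsAddHaarMeasure]
    (hμF : IsSelfDual ψ (fun x y : F => x * y) μF)
    (Q : QuadraticForm F V) (hQ : Q.polarBilin.Nondegenerate)
    (hdim : 2 ≤ Module.finrank F V)
    (hdisc : IsSquare (disc Q))
    (μV : Measure V) [μV.IsAddHaarMeasure]
    (hμV : IsSelfDual ψ (QuadraticMap.polar Q) μV)
    (v₁ : V) (hv₁ : Q v₁ = 1) (ϖ : F) (hϖ : IsUniformizer ϖ) :
    (∃! t, IsTransferMap ψ Q μV v₁ t) ∧
    (∃ ω : (a : F) → Measure (Hyperboloid Q a),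
      IsFiberMeasure μV μF Q {0}ᶜ ω) ∧
    ∀ ω : (a : F) → Measure (Hyperboloid Q a),
      IsFiberMeasure μV μF Q {0}ᶜ ω →
      (∃ ν : (ξ : F) →
          Measure {x : Hyperboloid Q 1 // QuadraticMap.polar Q v₁ x.1 = ξ},
        IsFiberMeasure (ω 1) μF (fun x => QuadraticMap.polar Q v₁ x.1)
          {2, -2}ᶜ ν) ∧
      ∀ ν : (ξ : F) →
          Measure {x : Hyperboloid Q 1 // QuadraticMap.polar Q v₁ x.1 = ξ},
        IsFiberMeasure (ω 1) μF (fun x => QuadraticMap.polar Q v₁ x.1)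
          {2, -2}ᶜ ν →
        ∃ (JX : OrbitalX Q v₁ →ₗ[ℂ] (Heart F → ℂ))
          (JN : OrbitalN ψ Q μV v₁ →ₗ[ℂ] (Fˣ → ℂ)),
          IsIncarnationX Q v₁ ν JX ∧
          IsIncarnationN ψ μF Q μV v₁ ϖ JN ∧
          (∀ φ, IsLocallyConstant (JX φ)) ∧
          (∀ f, IsLocallyConstant (JN f)) ∧
          ∀ t, IsTransferMap ψ Q μV v₁ t →
            ∀ (φ : OrbitalX Q v₁) (a : Fˣ),
              Integrable
                (fun ξ : Heart F => JX φ ξ * (ψ ((a : F)⁻¹ * ξ.1) : ℂ))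
                (μF.comap Subtype.val) ∧
              JN (t φ) a =
                weilIndex ψ Q μV *
                  ((absF (a : F) ^ (-(Module.finrank F V : ℝ) / 2) : ℝ) : ℂ) *
                  ∫ ξ : Heart F, JX φ ξ * (ψ ((a : F)⁻¹ * ξ.1) : ℂ)
                    ∂(μF.comap Subtype.val) := by
  have : ProperSpace F := .of_locallyCompactSpace F
  refine ⟨existsUnique_transferMap μV h2 hcond hμV v₁,
    exists_isFiberMeasure_quadraticForm h2 hcond hQ, fun ω hω =>
    ⟨exists_isFiberMeasure_polar h2 hcond hQ hμF hω hv₁, fun ν hν => ?_⟩⟩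
  have := hω.finite_on_compacts 1 (by simp)
  obtain ⟨JX, isIncarnationX, locConstX⟩ := exists_incarnationX h2 hμV hω hν
  obtain ⟨JN, isIncarnationN, locConstN, JN_pClass⟩ :=
    exists_incarnationN h2 hcond hQ hdisc hμF hω v₁ hϖ
  refine ⟨JX, JN, isIncarnationX, isIncarnationN, locConstX, locConstN, fun t ht φ a => ?_⟩
  obtain ⟨Φ, rfl⟩ := resClass_surjective h2 Q v₁ φ
  have JX_resClass : ∀ ξ, JX (resClass h2 Q v₁ Φ) ξ = fiberIntegralX hν (resX h2 Q 1 Φ) ξ :=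
    isIncarnationX (resX h2 Q 1 Φ)
  have t_resClass := (isTransferMap_iff μV h2 hcond.continuous).1 ht Φ
  obtain ⟨integrable, disintegration⟩ := integral_hyperboloid_mul_character h2 hcond hQ hμF hω
    hdim hv₁ hν (resX h2 Q 1 Φ) (a : F)⁻¹
  simp_rw [JX_resClass]
  refine ⟨integrable, ?_⟩
  rw [t_resClass, JN_pClass, orbitalN_apply, disintegration]

theorem proposition11p1
    {F : Type*} [NontriviallyNormedField F] [IsUltrametricDist F] [LocallyCompactSpace F]
    [MeasurableSpace F] [BorelSpace F] (h2 : (2 : F) ≠ 0)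
    {V : Type*} [AddCommGroup V] [Module F V] [FiniteDimensional F V] [TopologicalSpace V]
    [IsTopologicalAddGroup V] [ContinuousSMul F V] [T2Space V] [MeasurableSpace V] [BorelSpace V]
    (ψ : AddChar F Circle) (hψ : Continuous ψ) (hcond : ThetaTransfer.HasConductorIntegers ψ)
    (μF : Measure F) [μF.IsAddHaarMeasure]
    (hμF : ThetaTransfer.IsSelfDual ψ (fun x y : F => x * y) μF)
    (Q : QuadraticForm F V) (hQ : Q.polarBilin.Nondegenerate)
    (hdim : 3 ≤ Module.finrank F V) (heven : Even (Module.finrank F V))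
    (hdisc : IsSquare (ThetaTransfer.disc Q))
    (μV : Measure V) [μV.IsAddHaarMeasure]
    (hμV : ThetaTransfer.IsSelfDual ψ (QuadraticMap.polar Q) μV)
    (v₁ : V) (hv₁ : Q v₁ = 1) (ϖ : F) (hϖ : ThetaTransfer.IsUniformizer ϖ) :
    -- the transfer map exists and is unique
    (∃! t, ThetaTransfer.IsTransferMap ψ Q μV v₁ t) ∧
    -- the measures on the fibres `X_a` of `Q : V → F`, `a ≠ 0`, exist
    (∃ ω : (a : F) → Measure (ThetaTransfer.Hyperboloid Q a),
      ThetaTransfer.IsFiberMeasure μV μF Q {0}ᶜ ω) ∧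
    ∀ ω : (a : F) → Measure (ThetaTransfer.Hyperboloid Q a),
      ThetaTransfer.IsFiberMeasure μV μF Q {0}ᶜ ω →
      -- the measures on the fibres of `x ↦ ⟨v₁, x⟩` on `X₁` over `F ∖ {2, -2}` exist
      (∃ ν : (ξ : F) →
          Measure {x : ThetaTransfer.Hyperboloid Q 1 // QuadraticMap.polar Q v₁ x.1 = ξ},
        ThetaTransfer.IsFiberMeasure (ω 1) μF (fun x => QuadraticMap.polar Q v₁ x.1)
          {2, -2}ᶜ ν) ∧
      ∀ ν : (ξ : F) →
          Measure {x : ThetaTransfer.Hyperboloid Q 1 // QuadraticMap.polar Q v₁ x.1 = ξ},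
        ThetaTransfer.IsFiberMeasure (ω 1) μF (fun x => QuadraticMap.polar Q v₁ x.1)
          {2, -2}ᶜ ν →
        ∃ (JX : ThetaTransfer.OrbitalX Q v₁ →ₗ[ℂ] (ThetaTransfer.Heart F → ℂ))
          (JN : ThetaTransfer.OrbitalN ψ Q μV v₁ →ₗ[ℂ] (Fˣ → ℂ)),
          ThetaTransfer.IsIncarnationX Q v₁ ν JX ∧
          ThetaTransfer.IsIncarnationN ψ μF Q μV v₁ ϖ JN ∧
          (∀ φ, IsLocallyConstant (JX φ)) ∧
          (∀ f, IsLocallyConstant (JN f)) ∧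
          ∀ t, ThetaTransfer.IsTransferMap ψ Q μV v₁ t →
            ∀ (φ : ThetaTransfer.OrbitalX Q v₁) (a : Fˣ),
              Integrable
                (fun ξ : ThetaTransfer.Heart F => JX φ ξ * (ψ ((a : F)⁻¹ * ξ.1) : ℂ))
                (μF.comap Subtype.val) ∧
              JN (t φ) a =
                ThetaTransfer.weilIndex ψ Q μV *
                  ((ThetaTransfer.absF (a : F) ^ (-(Module.finrank F V : ℝ) / 2) : ℝ) : ℂ) *
                  ∫ ξ : ThetaTransfer.Heart F, JX φ ξ * (ψ ((a : F)⁻¹ * ξ.1) : ℂ)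
                    ∂(μF.comap Subtype.val) := by
  exact proposition11p1_general h2 ψ hcond μF hμF Q hQ ((Nat.le_succ 2).trans hdim) hdisc μV hμV
    v₁ hv₁ ϖ hϖ
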